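/- Let $m\ge 1$, $n=4^m+1$, and $\mathbb F_4=\mathbb F_2(\eta)$ with $\eta^2+\eta+1=0$; let $\sigma$ be the Frobenius automorphism of $\mathbb F_4$, acting on the coefficients of polynomials. For $\mathbf a,\mathbf b\in\mathbb F_2^n$ let $U_{\mathbf a}|\mathbf x\rangle=|\mathbf x+\mathbf a\rangle$ and $V_{\mathbf b}|\mathbf x\rangle=(-1)^{\mathbf b^{T}\mathbf x}|\mathbf x\rangle$ on $(\mathbb C^2)^{\otimes n}$; the weight of $U_{\mathbf a}V_{\mathbf b}$ is the number of positions $i$ with $a_i\ne 0$ or $b_i\neq 0$. The error group is generated by all $U_{\mathbf a}V_{\mathbf b}$ and $\iota U_{\mathbf a}V_{\mathbf b}$, $\iota=\sqrt{-1}$. A Gottesman subgroup is an Abelian subgroup $\mathcal S$ of the error group that contains no $\omega I$ with $\omega\ne1$ a root of unity; its code consists of the vectors fixed by $\mathcal S$, and its underlying set is the set of all $(\mathbf a,\mathbf b)$ such that $\omega U_{\mathbf a}V_{\mathbf b}\in\mathcal S$ for some scalar $\omega$. Identify $(\mathbf a,\mathbf b)$ with $\sum_{i=0}^{n-1}(a_i+\eta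 b_i)X^i\in\mathbb F_4[X]/(X^n-1)$. A $4^m+1$-code with generating pair $(g,h)$ is the code of a Gottesman subgroup $\mathcal S$ whose underlying set is the ideal of $\mathbb F_4[X]/(X^n-1)$ generated by $gh$, where $g\in\mathbb F_2[X]$ divides $X^n-1$ and $h\in\mathbb F_4[X]$ is a divisor of $(X^n-1)/g$ such that, for every irreducible factor $r$ of $(X^n-1)/g$ over $\mathbb F_4$, $r\mid h$ if and only if $\sigma(r)\nmid h$. Its BCH distance is the largest integer $d$ such that, for some primitive $n$-th root of unity $\beta$ and some $l$, the powers $\beta^{l},\beta^{l+1},\dots,\beta^{l+d-2}$ are distinct and are roots of $h$. **Theorem.** There are a single quantum algorithm and a polynomial $p$ such that the following holds for all $m\ge1$ and every $4^m+1$-code $\mathcal C$, of length $n=4^m+1$, given by $(g,h)$ and $\mathcal S$. Suppose that the BCH distance of $\mathcal C$ is $2t+1$. The algorithm is given a classical description of the code (the number $n$, the coefficients of $g$ and $h$, and, for $k<n$, the phases of the elements of $\mathcal S$ that belong to $X^kgh$ and to $\eta X^kgh$) and $n$ qubits in a state $U_{\mathbf a}V_{\mathbf b}|\varphi\rangle$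 with $|\varphi\rangle\in\mathcal C$ and $U_{\mathbf a}V_{\mathbf b}$ an unknown error of weight at most $t$. For all possible measurement outcomes it halts after at most $p(n)$ steps, with these $n$ qubits in the state $|\varphi\rangle$, unentangled with the work qubits. Here a quantum algorithm is a program for a random access machine (unit cost; addition and truncated subtraction of natural numbers, indirect addressing, branching and loops) that applies the gates $H$, $T$ and CNOT to qubits and measures qubits in the computational basis. -/

import Mathlib

open Polynomial

namespace QuantumBCH

/-! ### Qubits, Weyl operators, stabiliser codes -/

/-- The `n`-fold tensor power of the space of functions `𝔽₂ → ℂ`; the basis vector `|x⟩` is the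
indicator function of `x`. -/
abbrev Qubits (n : ℕ) : Type := (Fin n → ZMod 2) → ℂ

/-- The sign `(-1)^c`. -/
noncomputable def sign (c : ZMod 2) : ℂ := (-1) ^ c.val

theorem sign_mul_self (c : ZMod 2) : sign c * sign c = 1 := by
  unfold sign
  rw [← mul_pow]
  norm_num

/-- `U_a |x⟩ = |x + a⟩`. -/
def bitFlip {n : ℕ} (a : Fin n → ZMod 2) : Qubits n ≃ₗ[ℂ] Qubits n where
  toFun φ := fun x => φ (x - a)
  invFun φ := fun x => φ (x + a)
  map_add' _ _ := rfl
  map_smul' _ _ := rfl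
  left_inv φ := by funext x; simp
  right_inv φ := by funext x; simp

/-- `V_b |x⟩ = (-1)^(bᵀx) |x⟩`. -/
noncomputable def phaseFlip {n : ℕ} (b : Fin n → ZMod 2) : Qubits n ≃ₗ[ℂ] Qubits n where
  toFun φ := fun x => sign (b ⬝ᵥ x) * φ x
  invFun φ := fun x => sign (b ⬝ᵥ x) * φ x
  map_add' φ ψ := by funext x; simp [mul_add]
  map_smul' c φ := by funext x; simp [mul_left_comm]
  left_inv φ := by funext x; simp [← mul_assoc, sign_mul_self]
  right_inv φ := by funext x; simp [← mul_assoc, sign_mul_self]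

/-- The Weyl operator `U_a V_b`. -/
noncomputable def weyl {n : ℕ} (a b : Fin n → ZMod 2) : Qubits n ≃ₗ[ℂ] Qubits n :=
  bitFlip a * phaseFlip b

/-- The operator `ω I`. -/
noncomputable def scalar (n : ℕ) (ω : ℂˣ) : Qubits n ≃ₗ[ℂ] Qubits n :=
  LinearEquiv.smulOfUnit ω

/-- The imaginary unit as an invertible complex number. -/
noncomputable def iota : ℂˣ := Units.mk0 Complex.I Complex.I_ne_zero

/-- The error group for `n` qubits: generated by the Weyl operators `W` and `ι W`. -/
noncomputable def errorGroup (n : ℕ) : Subgroup (Qubits n ≃ₗ[ℂ] Qubits n) :=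
  Subgroup.closure {E | ∃ a b : Fin n → ZMod 2, E = weyl a b ∨ E = scalar n iota * weyl a b}

/-- Gottesman subgroups: Abelian subgroups of the error group that contain no `ω I` with
`ω ≠ 1` a root of unity. -/
structure IsGottesman {n : ℕ} (G : Subgroup (Qubits n ≃ₗ[ℂ] Qubits n)) : Prop where
  le_errorGroup : G ≤ errorGroup n
  comm : ∀ A ∈ G, ∀ B ∈ G, A * B = B * A
  scalar_eq_one : ∀ ω : ℂˣ, IsOfFinOrder ω → scalar n ω ∈ G → ω = 1

/-- The stabiliser code of `G`: the vectors fixed by all elements of `G`. -/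
def stabiliserCode {n : ℕ} (G : Subgroup (Qubits n ≃ₗ[ℂ] Qubits n)) : Set (Qubits n) :=
  {φ | ∀ E ∈ G, E φ = φ}

/-- The subset of `𝔽₂ⁿ × 𝔽₂ⁿ` underlying `G`. -/
def underlying {n : ℕ} (G : Subgroup (Qubits n ≃ₗ[ℂ] Qubits n)) :
    Set ((Fin n → ZMod 2) × (Fin n → ZMod 2)) :=
  {u | ∃ ω : ℂˣ, scalar n ω * weyl u.1 u.2 ∈ G}

/-- The exponent `k ∈ {0, 1, 2, 3}` such that `ι^k U_c V_d` lies in `G` (for a Gottesman subgroup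
`G` and a pair `(c, d)` in its underlying set). -/
noncomputable def phase {n : ℕ} (G : Subgroup (Qubits n ≃ₗ[ℂ] Qubits n))
    (c d : Fin n → ZMod 2) : ℕ :=
  sInf {k : ℕ | scalar n (iota ^ k) * weyl c d ∈ G}

/-- The number of positions at which `a` or `b` is nonzero. -/
def jointWeight {n : ℕ} (a b : Fin n → ZMod 2) : ℕ :=
  (Finset.univ.filter fun i => a i ≠ 0 ∨ b i ≠ 0).card

/-! ### The codes of length `4^m + 1` -/

/-- The field with four elements. -/
abbrev F4 : Type := GaloisField 2 2

/-- The polynomial over `𝔽₄` with the same coefficients as a polynomial over `𝔽₂`. -/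
noncomputable def liftPoly (g : (ZMod 2)[X]) : F4[X] := g.map (algebraMap (ZMod 2) F4)

/-- The Frobenius automorphism of `𝔽₄`, applied to the coefficients. -/
noncomputable def sigma (r : F4[X]) : F4[X] := r.map (frobenius F4 2)

/-- The element of `𝔽₄[X]/(Xⁿ - 1)` identified with the pair `(a, b)`, that is
`a(X) + η b(X)`. -/
noncomputable def pairElem (n : ℕ) (η : F4) (a b : Fin n → ZMod 2) :
    AdjoinRoot (X ^ n - 1 : F4[X]) :=
  AdjoinRoot.mk (X ^ n - 1 : F4[X])
    (∑ i : Fin n, C (algebraMap (ZMod 2) F4 (a i) + η * algebraMap (ZMod 2) F4 (b i)) *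
      X ^ (i : ℕ))

/-- Generating pairs: `g` is a factor of `Xⁿ - 1` over `𝔽₂`, `n = 4^m + 1`, and `h` is a product of
irreducible factors of `(Xⁿ - 1)/g` over `𝔽₄` which, for every irreducible factor `r` of
`(Xⁿ - 1)/g`, is divisible by exactly one of `r` and `σ(r)`. -/
structure IsGeneratingPair (m : ℕ) (g : (ZMod 2)[X]) (h : F4[X]) : Prop where
  dvd_left : g ∣ X ^ (4 ^ m + 1) - 1
  dvd_right : h ∣ liftPoly ((X ^ (4 ^ m + 1) - 1) / g)
  conj : ∀ r : F4[X], Irreducible r → r ∣ liftPoly ((X ^ (4 ^ m + 1) - 1) / g) →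
    (r ∣ h ↔ ¬ sigma r ∣ h)

/-- `G` is a Gottesman subgroup defining a `4^m + 1`-code with generating pair `(g, h)`: its
underlying set is the ideal of `𝔽₄[X]/(Xⁿ - 1)` generated by `g h`. -/
structure IsCodeGroup (m : ℕ) (η : F4) (g : (ZMod 2)[X]) (h : F4[X])
    (G : Subgroup (Qubits (4 ^ m + 1) ≃ₗ[ℂ] Qubits (4 ^ m + 1))) : Prop where
  pair : IsGeneratingPair m g h
  gottesman : IsGottesman G
  underlying_eq : underlying G =
    {u | pairElem (4 ^ m + 1) η u.1 u.2 ∈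
      Ideal.span {AdjoinRoot.mk (X ^ (4 ^ m + 1) - 1 : F4[X]) (liftPoly g * h)}}

/-- `d` is the BCH distance of the factor `h` of `Xⁿ - 1`: the largest `d` such that, for some
primitive `n`-th root of unity `β` and some `l`, the powers `β^l, …, β^(l+d-2)` are distinct
(that is, `d - 1 ≤ n`) and are roots of `h`. -/
def IsBCHDistance {k : Type*} [Field k] (n : ℕ) (h : k[X]) (d : ℕ) : Prop :=
  IsGreatest {e : ℕ | e ≤ n + 1 ∧ ∃ β : AlgebraicClosure k, IsPrimitiveRoot β n ∧
    ∃ l : ℕ, ∀ i : ℕ, i + 2 ≤ e → aeval (β ^ (l + i)) h = 0} d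

/-! ### Quantum algorithms: a random access machine that controls qubits -/

/-- Expressions (with values in `ℕ`) over the random access memory. -/
inductive Expr : Type
  | const (k : ℕ)
  | load (addr : Expr)
  | add (e f : Expr)
  | sub (e f : Expr)

/-- The value of an expression in memory `M`; the subtraction is the truncated one. -/
def Expr.eval (M : ℕ → ℕ) : Expr → ℕ
  | .const k => k
  | .load addr => M (addr.eval M)
  | .add e f => e.eval M + f.eval M
  | .sub e f => e.eval M - f.eval M

/-- Programs. The quantum instructions are the gates `H`, `T` and `CNOT`, and the measurement of a
qubit in the computational basis, whose outcome is written to the memory. -/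
inductive Program : Type
  | skip
  | assign (addr e : Expr)
  | seq (P Q : Program)
  | ite (e : Expr) (P Q : Program)
  | while (e : Expr) (P : Program)
  | hadamard (q : Expr)
  | tgate (q : Expr)
  | cnot (c q : Expr)
  | measure (q addr : Expr)

/-- Amplitudes of a state of the quantum register, whose qubits are numbered by `ℕ`. (In every
state that is reachable from an input, the amplitudes are supported on finitely many labels.) -/
abbrev QState : Type := (ℕ → ZMod 2) → ℂ

/-- The Hadamard gate on qubit `q`. -/
noncomputable def applyH (q : ℕ) (ψ : QState) : QState := fun x =>
  (ψ (Function.update x q 0) + sign (x q) * ψ (Function.update x q 1)) / (Real.sqrt 2 : ℂ)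

/-- The gate `T = diag(1, exp(iπ/4))` on qubit `q`. -/
noncomputable def applyT (q : ℕ) (ψ : QState) : QState := fun x =>
  if x q = 1 then Complex.exp (Complex.I * Real.pi / 4) * ψ x else ψ x

/-- The controlled NOT gate with control qubit `c` and target qubit `q`; nothing happens if these
are the same. -/
def applyCNOT (c q : ℕ) (ψ : QState) : QState := fun x =>
  if c = q then ψ x else ψ (Function.update x q (x q + x c))

/-- The (unnormalised) state after a measurement of qubit `q` with outcome `b`. -/
def project (q : ℕ) (b : ZMod 2) (ψ : QState) : QState := fun x =>
  if x q = b then ψ x else 0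

/-- A configuration: the stack of programs still to be executed, the classical memory and the state
of the quantum register. -/
structure Config : Type where
  todo : List Program
  mem : ℕ → ℕ
  state : QState

/-- The possible configurations after one step. Only a measurement branches: into the outcomes of
nonzero probability. -/
noncomputable def Config.next : Config → Set Config
  | ⟨[], _, _⟩ => ∅
  | ⟨.skip :: K, M, ψ⟩ => {⟨K, M, ψ⟩}
  | ⟨.assign addr e :: K, M, ψ⟩ => {⟨K, Function.update M (addr.eval M) (e.eval M), ψ⟩}
  | ⟨.seq P Q :: K, M, ψ⟩ => {⟨P :: Q :: K, M, ψ⟩}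
  | ⟨.ite e P Q :: K, M, ψ⟩ => {⟨(if e.eval M ≠ 0 then P else Q) :: K, M, ψ⟩}
  | ⟨.while e P :: K, M, ψ⟩ =>
      {⟨if e.eval M ≠ 0 then P :: .while e P :: K else K, M, ψ⟩}
  | ⟨.hadamard q :: K, M, ψ⟩ => {⟨K, M, applyH (q.eval M) ψ⟩}
  | ⟨.tgate q :: K, M, ψ⟩ => {⟨K, M, applyT (q.eval M) ψ⟩}
  | ⟨.cnot c q :: K, M, ψ⟩ => {⟨K, M, applyCNOT (c.eval M) (q.eval M) ψ⟩}
  | ⟨.measure q addr :: K, M, ψ⟩ =>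
      {γ | ∃ b : ZMod 2, project (q.eval M) b ψ ≠ 0 ∧
        γ = ⟨K, Function.update M (addr.eval M) b.val, project (q.eval M) b ψ⟩}

/-- `HaltsWithin Q T γ`: whatever the measurement outcomes, the machine started in `γ` halts after
at most `T` steps, in a configuration that satisfies `Q`. -/
def HaltsWithin (Q : Config → Prop) : ℕ → Config → Prop
  | 0, γ => γ.todo = [] ∧ Q γ
  | T + 1, γ => (γ.todo = [] ∧ Q γ) ∨ (γ.todo ≠ [] ∧ ∀ γ' ∈ γ.next, HaltsWithin Q T γ')

/-- The state `φ ⊗ χ` with `φ` on the first `n` qubits and `χ` on the other ones. -/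
def tensor {n : ℕ} (φ : Qubits n) (χ : QState) : QState := fun x =>
  φ (fun i => x i) * χ (fun j => x (n + j))

open Classical in
/-- The state of a register with all qubits in state `|0⟩`. -/
noncomputable def zeroState : QState := fun x => if x = 0 then 1 else 0

open Classical in
/-- The bit `u` of an element `u + η v` of `𝔽₄`. -/
noncomputable def loBit (η x : F4) : ℕ := if x = 0 ∨ x = η then 0 else 1

open Classical in
/-- The bit `v` of an element `u + η v` of `𝔽₄`. -/
noncomputable def hiBit (x : F4) : ℕ := if x = 0 ∨ x = 1 then 0 else 1

/-- The phase exponent of the stabiliser element that belongs to a polynomial `f`, read modulo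
`Xⁿ - 1` and identified with a pair of vectors. -/
noncomputable def polyPhase {n : ℕ} (η : F4) (G : Subgroup (Qubits n ≃ₗ[ℂ] Qubits n))
    (f : F4[X]) : ℕ :=
  phase G (fun i => (loBit η ((f %ₘ (X ^ n - 1)).coeff i) : ZMod 2))
    (fun i => (hiBit ((f %ₘ (X ^ n - 1)).coeff i) : ZMod 2))

/-- The classical description of a code, given to the algorithm as input: the length, the
coefficients of `g` and of `h`, and the phases of the stabiliser elements that belong to `X^k g h`
and to `η X^k g h`, for `k < n`. -/
noncomputable def description {n : ℕ} (η : F4) (g : (ZMod 2)[X]) (h : F4[X])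
    (G : Subgroup (Qubits n ≃ₗ[ℂ] Qubits n)) : List ℕ :=
  [n] ++ (List.range (n + 1)).map (fun k => (g.coeff k).val)
    ++ (List.range (n + 1)).map (fun k => loBit η (h.coeff k))
    ++ (List.range (n + 1)).map (fun k => hiBit (h.coeff k))
    ++ (List.range n).map (fun k => polyPhase η G (X ^ k * (liftPoly g * h)))
    ++ (List.range n).map (fun k => polyPhase η G (C η * (X ^ k * (liftPoly g * h))))

/-- The initial configuration of a program: the classical input is at the beginning of the memory,
which is zero elsewhere, the quantum input is on the first `n` qubits and all other qubits are in
state `|0⟩`. -/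
noncomputable def initial {n : ℕ} (P : Program) (input : List ℕ) (ψ : Qubits n) : Config :=
  ⟨[P], fun k => input.getD k 0, tensor ψ zeroState⟩

end QuantumBCH

namespace QuantumBCH

/-! ### Running programs -/

/-! Read the error as a vector e over 𝔽₄. Each of the 2n stabiliser generators belonging to X^k g h
and η X^k g h commutes with the error up to a sign, and the two sign bits for k combine to the
element Σ_i e_i σ(f_i) of 𝔽₄, where f = X^k g h (`syndrome_eq`). Summing these values against β^k,
for a root β of h, gives σ(g h)(β⁻¹) · e(β) (`sum_check_mul`). Since β⁻¹ = β^(4^m), and raising to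
the power 4^m fixes 𝔽₄, the first factor is the 4^m-th power of g(β) · σ(h)(β). This is nonzero
because X^n - 1 is separable and h contains exactly one of r and σ(r). Hence the syndrome determines
e modulo h (`IsGeneratingPair.dvd_of_check`), and classical BCH decoding remains.

Any solution r of the syndrome equations agrees with e at 2t consecutive powers of β. A locator of
degree at most t that satisfies the key equations for r vanishes at every error position by a
Vandermonde argument, and the product of the linear factors at these positions is a locator that
vanishes nowhere else (`exists_locator_iff`). Once the positions are known, e is the only solution
supported there (`eq_zero_of_killed`).

The algorithm knows none of β, l and t. A root of unity is replaced by a nonzero element v of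
𝔽₄[X]/(X^n - 1) that satisfies linear conditions over 𝔽₄: it is annihilated by the geometric sums
that express primitivity, and by the values of h at the powers ξ^(l+i) of the class ξ of X. Such v
exist exactly when suitable primitive β exist (`exists_primitiveRoot_of_isKilled`,
`exists_isKilled_of_primitiveRoot`). Locators with coefficients of this kind form the kernel of a
linear system over 𝔽₄, so no factorisation and no extension field is needed. Among all pairs (l, t)
with a nonzero locator one with the largest t is taken; maximality of the BCH distance shows that
this t is the right one (`IsGeneratingPair.decodes`).

For the running time, classical functions are written as terms with bounded sums, which compile to
programs of polynomial cost (`Machine.runs_compile`); Gaussian elimination is a table whose entries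
are given by such a term in the earlier entries (`exists_tab`, `exists_elim`). Each generator is
measured by phase kickback on a fresh work qubit. The damaged state is an eigenvector, so the
outcome is certain and the data qubits are undisturbed (`exists_measure`). Finally the operator U_a
V_b is applied once more; its square is a sign, which the state of the work qubits absorbs
(`exists_decoder`). -/

theorem HaltsWithin.succ {Q : Config → Prop} {T : ℕ} {γ : Config} (h : HaltsWithin Q T γ) :
    HaltsWithin Q (T + 1) γ := by
  induction T generalizing γ with
  | zero => exact Or.inl h
  | succ T ih =>
    rcases h with h | ⟨h₁, h₂⟩
    · exact Or.inl h
    · exact Or.inr ⟨h₁, fun γ' hγ' => ih (h₂ γ' hγ')⟩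

theorem HaltsWithin.mono {Q : Config → Prop} {T T' : ℕ} {γ : Config} (h : HaltsWithin Q T γ)
    (hT : T ≤ T') : HaltsWithin Q T' γ := by
  induction hT with
  | refl => exact h
  | step _ ih => exact ih.succ

theorem haltsWithin_cons {Q : Config → Prop} {T : ℕ} {P : Program} {K : List Program}
    {M : ℕ → ℕ} {ψ : QState} (h : ∀ γ' ∈ Config.next ⟨P :: K, M, ψ⟩, HaltsWithin Q T γ') :
    HaltsWithin Q (T + 1) ⟨P :: K, M, ψ⟩ :=
  Or.inr ⟨by simp, h⟩

/-! ### Memory layout and rules for programs with time bounds -/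

/-- The parameters of a run: the number `S` of arrays, the length `n` and the input. -/
structure Machine where
  S : ℕ
  n : ℕ
  inp : ℕ → ℕ
  n_pos : 0 < n
  inp_zero : inp 0 = n
  inp_eq_zero : ∀ i, 8 * n ≤ i → inp i = 0

/-- Contents of the arrays: `A k i` is the entry with index `i` of array `k`. -/
abbrev Arrays : Type := ℕ → ℕ → ℕ

/-- Change of one entry. -/
def Arrays.set (A : Arrays) (k i v : ℕ) : Arrays :=
  Function.update A k (Function.update (A k) i v)

theorem Arrays.set_self (A : Arrays) (k i v : ℕ) : A.set k i v k i = v := by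
  simp [Arrays.set]

theorem Arrays.set_of_ne (A : Arrays) {k k' : ℕ} (i v : ℕ) (h : k' ≠ k) : A.set k i v k' = A k' := by
  simp [Arrays.set, h]

theorem Arrays.set_of_idx_ne (A : Arrays) {k i i' : ℕ} (v : ℕ) (h : i' ≠ i) :
    A.set k i v k i' = A k i' := by
  simp [Arrays.set, h]

/-- The memory `M` contains the input, followed by the `S` interleaved arrays of `A`. -/
structure Machine.Layout (W : Machine) (A : Arrays) (M : ℕ → ℕ) : Prop where
  input : ∀ i < 8 * W.n, M i = W.inp i
  cells : ∀ k < W.S, ∀ i, M (8 * W.n + W.S * i + k) = A k i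

theorem Machine.Layout.zero {W : Machine} {A : Arrays} {M : ℕ → ℕ} (h : W.Layout A M) :
    M 0 = W.n := by
  rw [h.input 0 (by have := W.n_pos; omega), W.inp_zero]

/-- Distinct pairs (array, index) have distinct addresses, so a write changes one entry only and
never touches the input. -/
theorem Machine.Layout.set {W : Machine} {A : Arrays} {M : ℕ → ℕ} (h : W.Layout A M) {k : ℕ}
    (hk : k < W.S) (i v : ℕ) :
    W.Layout (A.set k i v) (Function.update M (8 * W.n + W.S * i + k) v) := by
  refine ⟨fun j hj => ?_, fun k' hk' i' => ?_⟩
  · rw [Function.update_of_ne (by omega), h.input j hj]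
  · by_cases hkk : k' = k
    · subst hkk
      by_cases hi : i' = i
      · subst hi; simp [Arrays.set]
      · rw [A.set_of_idx_ne v hi, Function.update_of_ne, h.cells _ hk]
        intro he
        apply hi
        have h1 : W.S * i' = W.S * i := by omega
        exact Nat.eq_of_mul_eq_mul_left (by omega) h1
    · rw [A.set_of_ne i v hkk, Function.update_of_ne, h.cells _ hk']
      intro he
      apply hkk
      -- The arrays are interleaved with stride `W.S`, so the residue of an address recovers the
      -- array number.
      have h1 : (k' + W.S * i') % W.S = (k + W.S * i) % W.S := by congr 1; omega
      rwa [Nat.add_mul_mod_self_left, Nat.add_mul_mod_self_left, Nat.mod_eq_of_lt hk,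
        Nat.mod_eq_of_lt hk'] at h1

/-- From a memory with contents `A` and the state `ψ`, the program `P` ends after at most `c` steps,
for all measurement outcomes, with contents and state that satisfy `Post`. -/
def Machine.Runs (W : Machine) (P : Program) (c : ℕ) (A : Arrays) (ψ : QState)
    (Post : Arrays → QState → Prop) : Prop :=
  ∀ M K Q T, W.Layout A M →
    (∀ A' M' ψ', W.Layout A' M' → Post A' ψ' → HaltsWithin Q T ⟨K, M', ψ'⟩) →
    HaltsWithin Q (c + T) ⟨P :: K, M, ψ⟩

/-- The expression `e` has the value `v` when the arrays contain `A`. -/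
def Machine.Denotes (W : Machine) (e : Expr) (A : Arrays) (v : ℕ) : Prop :=
  ∀ M, W.Layout A M → e.eval M = v

/-- The expression `c e`. -/
def Expr.smul : ℕ → Expr → Expr
  | 0, _ => .const 0
  | c + 1, e => .add (Expr.smul c e) e

theorem Expr.eval_smul (M : ℕ → ℕ) (c : ℕ) (e : Expr) : (Expr.smul c e).eval M = c * e.eval M := by
  induction c with
  | zero => simp [Expr.smul, Expr.eval]
  | succ c ih => simp [Expr.smul, Expr.eval, ih, add_mul]

/-- The address of the entry with index `e` of array `k`. -/
def addr (S k : ℕ) (e : Expr) : Expr :=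
  .add (.add (.smul 8 (.load (.const 0))) (.smul S e)) (.const k)

/-- The entry with index `0` of array `k`, used as a register. -/
def reg (S k : ℕ) : Expr := .load (addr S k (.const 0))

namespace Machine

variable {W : Machine} {A : Arrays} {ψ : QState} {Post : Arrays → QState → Prop}

theorem denotes_const (k : ℕ) : W.Denotes (.const k) A k := fun _ _ => rfl

theorem denotes_n : W.Denotes (.load (.const 0)) A W.n := fun _ hM => hM.zero

theorem Denotes.add {e f : Expr} {u v : ℕ} (he : W.Denotes e A u) (hf : W.Denotes f A v) :
    W.Denotes (.add e f) A (u + v) := fun M hM => by simp [Expr.eval, he M hM, hf M hM]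

theorem Denotes.sub {e f : Expr} {u v : ℕ} (he : W.Denotes e A u) (hf : W.Denotes f A v) :
    W.Denotes (.sub e f) A (u - v) := fun M hM => by simp [Expr.eval, he M hM, hf M hM]

theorem Denotes.smul {e : Expr} {u : ℕ} (c : ℕ) (he : W.Denotes e A u) :
    W.Denotes (.smul c e) A (c * u) := fun M hM => by simp [Expr.eval_smul, he M hM]

theorem Denotes.addr {e : Expr} {i : ℕ} (k : ℕ) (he : W.Denotes e A i) :
    W.Denotes (addr W.S k e) A (8 * W.n + W.S * i + k) :=
  ((denotes_n.smul 8).add (he.smul _)).add (denotes_const k)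

theorem Denotes.load {e : Expr} {i k : ℕ} (hk : k < W.S) (he : W.Denotes e A i) :
    W.Denotes (.load (QuantumBCH.addr W.S k e)) A (A k i) := fun M hM => by
  simp only [Expr.eval, he.addr k M hM, hM.cells k hk]

theorem denotes_reg {k : ℕ} (hk : k < W.S) : W.Denotes (reg W.S k) A (A k 0) :=
  (denotes_const 0).load hk

theorem Denotes.input {e : Expr} {i : ℕ} (he : W.Denotes e A i) (hi : i < 8 * W.n) :
    W.Denotes (.load e) A (W.inp i) := fun M hM => by
  simp only [Expr.eval, he M hM, hM.input i hi]

theorem Runs.mono {P : Program} {c c' : ℕ} {Post' : Arrays → QState → Prop}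
    (h : W.Runs P c A ψ Post) (hc : c ≤ c') (hP : ∀ A' ψ', Post A' ψ' → Post' A' ψ') :
    W.Runs P c' A ψ Post' := fun M K Q T hM hK =>
  (h M K Q T hM fun A' M' ψ' hL hp => hK A' M' ψ' hL (hP _ _ hp)).mono (by omega)

theorem runs_skip (h : Post A ψ) : W.Runs .skip 1 A ψ Post := fun M K Q T hM hK => by
  rw [add_comm]
  refine haltsWithin_cons fun γ hγ => ?_
  simp only [Config.next, Set.mem_singleton_iff] at hγ
  subst hγ
  exact hK _ _ _ hM h

theorem runs_assign {k i v : ℕ} {ei e : Expr} (hk : k < W.S) (hi : W.Denotes ei A i)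
    (he : W.Denotes e A v) (h : Post (A.set k i v) ψ) :
    W.Runs (.assign (addr W.S k ei) e) 1 A ψ Post := fun M K Q T hM hK => by
  rw [add_comm]
  refine haltsWithin_cons fun γ hγ => ?_
  simp only [Config.next, Set.mem_singleton_iff, hi.addr k M hM, he M hM] at hγ
  subst hγ
  exact hK _ _ _ (hM.set hk i v) h

theorem runs_assign_reg {k v : ℕ} {e : Expr} (hk : k < W.S)
    (he : W.Denotes e A v) (h : Post (A.set k 0 v) ψ) :
    W.Runs (.assign (addr W.S k (.const 0)) e) 1 A ψ Post :=
  runs_assign hk (denotes_const 0) he h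

/-- `Runs` quantifies over all stacks and all goals reached afterwards, so composition is
instantiation: the stack for `P` is the given one with `Q` pushed on it. -/
theorem Runs.seq {P Q : Program} {c₁ c₂ : ℕ} {Mid : Arrays → QState → Prop}
    (hP : W.Runs P c₁ A ψ Mid) (hQ : ∀ A' ψ', Mid A' ψ' → W.Runs Q c₂ A' ψ' Post) :
    W.Runs (.seq P Q) (c₁ + c₂ + 1) A ψ Post := fun M K R T hM hK => by
  rw [show c₁ + c₂ + 1 + T = (c₁ + (c₂ + T)) + 1 by omega]
  refine haltsWithin_cons fun γ hγ => ?_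
  simp only [Config.next, Set.mem_singleton_iff] at hγ
  subst hγ
  exact hP M _ R _ hM fun A' M' ψ' hM' hmid => hQ A' ψ' hmid M' K R T hM' hK

theorem runs_ite {e : Expr} {P Q : Program} {v c : ℕ} (he : W.Denotes e A v)
    (hP : v ≠ 0 → W.Runs P c A ψ Post) (hQ : v = 0 → W.Runs Q c A ψ Post) :
    W.Runs (.ite e P Q) (c + 1) A ψ Post := fun M K R T hM hK => by
  rw [show c + 1 + T = (c + T) + 1 by omega]
  refine haltsWithin_cons fun γ hγ => ?_
  simp only [Config.next, Set.mem_singleton_iff, he M hM] at hγ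
  subst hγ
  by_cases hv : v = 0
  · simpa [hv] using hQ hv M K R T hM hK
  · simpa [hv] using hP hv M K R T hM hK

/-- `for ctr < lim do P`. -/
def forLoop (S lim ctr : ℕ) (P : Program) : Program :=
  .seq (.assign (addr S ctr (.const 0)) (.const 0))
    (.while (.sub (reg S lim) (reg S ctr))
      (.seq P (.assign (addr S ctr (.const 0)) (.add (reg S ctr) (.const 1)))))

theorem runs_while {lim ctr L c : ℕ} {P : Program} (hl : lim < W.S) (hc : ctr < W.S)
    (hne : lim ≠ ctr)
    (I : ℕ → Arrays → QState → Prop)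
    (step : ∀ j < L, ∀ A ψ, I j A ψ → A lim 0 = L → A ctr 0 = j →
      W.Runs P c A ψ fun A' ψ' => A' lim 0 = L ∧ A' ctr 0 = j ∧ I (j + 1) (A'.set ctr 0 (j + 1)) ψ')
    (post : ∀ A ψ, I L A ψ → Post A ψ) (d j : ℕ) :
    ∀ A ψ, j + d = L → I j A ψ → A lim 0 = L → A ctr 0 = j →
    W.Runs (.while (.sub (reg W.S lim) (reg W.S ctr))
      (.seq P (.assign (addr W.S ctr (.const 0)) (.add (reg W.S ctr) (.const 1)))))
      (d * (c + 3) + 1) A ψ Post := by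
  induction d generalizing j with
  | zero =>
    intro A ψ hj hI hA hB M K R T hM hK
    rw [show 0 * (c + 3) + 1 + T = T + 1 by omega]
    refine haltsWithin_cons fun γ hγ => ?_
    have := ((denotes_reg hl).sub (denotes_reg hc)) M hM
    have h0 : A lim 0 - A ctr 0 = 0 := by omega
    simp only [Config.next, Set.mem_singleton_iff, this, h0] at hγ
    subst hγ
    simp only [ne_eq, not_true_eq_false, if_false]
    have : j = L := by omega
    subst this
    exact hK _ _ _ hM (post _ _ hI)
  | succ d ih =>
    intro A ψ hj hI hA hB M K R T hM hK
    rw [show (d + 1) * (c + 3) + 1 + T = (c + 1 + 1 + (d * (c + 3) + 1 + T)) + 1 by ring]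
    refine haltsWithin_cons fun γ hγ => ?_
    have := ((denotes_reg hl).sub (denotes_reg hc)) M hM
    have h0 : A lim 0 - A ctr 0 ≠ 0 := by omega
    simp only [Config.next, Set.mem_singleton_iff, this] at hγ
    subst hγ
    rw [if_pos h0]
    have key : W.Runs (.seq P (.assign (addr W.S ctr (.const 0)) (.add (reg W.S ctr) (.const 1))))
        (c + 1 + 1) A ψ fun A' ψ' => A' lim 0 = L ∧ A' ctr 0 = j + 1 ∧ I (j + 1) A' ψ' := by
      refine (step j (by omega) A ψ hI hA hB).seq fun A' ψ' h => ?_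
      have hd := (denotes_reg (A := A') hc).add (denotes_const 1)
      rw [h.2.1] at hd
      refine runs_assign_reg hc hd ⟨?_, ?_, h.2.2⟩
      · rw [A'.set_of_ne _ _ hne, h.1]
      · rw [A'.set_self]
    exact key M _ R _ hM fun A' M' ψ' hM' h =>
      ih (j + 1) A' ψ' (by omega) h.2.2 h.1 h.2.1 M' K R T hM' hK

theorem runs_forLoop {lim ctr L c : ℕ} {P : Program} (hl : lim < W.S) (hc : ctr < W.S)
    (hne : lim ≠ ctr) (hL : A lim 0 = L)
    (I : ℕ → Arrays → QState → Prop) (init : I 0 (A.set ctr 0 0) ψ)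
    (step : ∀ j < L, ∀ A ψ, I j A ψ → A lim 0 = L → A ctr 0 = j →
      W.Runs P c A ψ fun A' ψ' => A' lim 0 = L ∧ A' ctr 0 = j ∧ I (j + 1) (A'.set ctr 0 (j + 1)) ψ')
    (post : ∀ A ψ, I L A ψ → Post A ψ) :
    W.Runs (forLoop W.S lim ctr P) (L * (c + 3) + 3) A ψ Post := by
  have := (runs_assign_reg (Post := fun A' ψ' => I 0 A' ψ' ∧ A' lim 0 = L ∧ A' ctr 0 = 0) hc
    (denotes_const 0) ⟨init, by rw [A.set_of_ne _ _ hne, hL], A.set_self _ _ _⟩).seq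
    (Q := .while (.sub (reg W.S lim) (reg W.S ctr))
      (.seq P (.assign (addr W.S ctr (.const 0)) (.add (reg W.S ctr) (.const 1)))))
    (Post := Post) (c₂ := L * (c + 3) + 1)
    fun A' ψ' h => runs_while hl hc hne I step post L 0 A' ψ' (by omega) h.1 h.2.1 h.2.2
  exact this.mono (by omega) fun _ _ h => h

/-! ### Quantum instructions -/

theorem runs_hadamard {e : Expr} {q : ℕ} (he : W.Denotes e A q) (h : Post A (applyH q ψ)) :
    W.Runs (.hadamard e) 1 A ψ Post := fun M K Q T hM hK => by
  rw [add_comm]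
  refine haltsWithin_cons fun γ hγ => ?_
  simp only [Config.next, Set.mem_singleton_iff, he M hM] at hγ
  subst hγ
  exact hK _ _ _ hM h

theorem runs_tgate {e : Expr} {q : ℕ} (he : W.Denotes e A q) (h : Post A (applyT q ψ)) :
    W.Runs (.tgate e) 1 A ψ Post := fun M K Q T hM hK => by
  rw [add_comm]
  refine haltsWithin_cons fun γ hγ => ?_
  simp only [Config.next, Set.mem_singleton_iff, he M hM] at hγ
  subst hγ
  exact hK _ _ _ hM h

theorem runs_cnot {e f : Expr} {c q : ℕ} (he : W.Denotes e A c) (hf : W.Denotes f A q)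
    (h : Post A (applyCNOT c q ψ)) : W.Runs (.cnot e f) 1 A ψ Post := fun M K Q T hM hK => by
  rw [add_comm]
  refine haltsWithin_cons fun γ hγ => ?_
  simp only [Config.next, Set.mem_singleton_iff, he M hM, hf M hM] at hγ
  subst hγ
  exact hK _ _ _ hM h

theorem runs_measure {e ei : Expr} {q k i : ℕ} (hk : k < W.S) (he : W.Denotes e A q)
    (hi : W.Denotes ei A i)
    (h : ∀ b : ZMod 2, project q b ψ ≠ 0 → Post (A.set k i b.val) (project q b ψ)) :
    W.Runs (.measure e (addr W.S k ei)) 1 A ψ Post := fun M K Q T hM hK => by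
  rw [add_comm]
  refine haltsWithin_cons fun γ hγ => ?_
  simp only [Config.next, Set.mem_ofPred_eq, he M hM, hi.addr k M hM] at hγ
  obtain ⟨b, hb, rfl⟩ := hγ
  exact hK _ _ _ (hM.set hk i _) (h b hb)

end Machine

/-! ### Terms with bounded sums -/

/-- Terms for functions that can be computed in polynomial time: the variables are de Bruijn
indices, `inp` reads the input, `rd a` reads array `a`, and `sum b t` is the sum of the values of
`t` for all values less than `b` of the variable with index `0`. -/
inductive Tm : Type
  | const (k : ℕ)
  | var (i : ℕ)
  | inp (t : Tm)
  | rd (a : Fin 8) (t : Tm)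
  | add (t u : Tm)
  | sub (t u : Tm)
  | ite (c t u : Tm)
  | sum (b t : Tm)

/-- Extension of a sequence by a first entry. -/
def vcons (j : ℕ) (v : ℕ → ℕ) : ℕ → ℕ
  | 0 => j
  | i + 1 => v i

namespace Tm

/-- The value of a term. -/
def den (inp : ℕ → ℕ) (D : Fin 8 → ℕ → ℕ) : Tm → (ℕ → ℕ) → ℕ
  | .const k, _ => k
  | .var i, v => v i
  | .inp t, v => inp (t.den inp D v)
  | .rd a t, v => D a (t.den inp D v)
  | .add t u, v => t.den inp D v + u.den inp D v
  | .sub t u, v => t.den inp D v - u.den inp D v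
  | .ite c t u, v => if c.den inp D v ≠ 0 then t.den inp D v else u.den inp D v
  | .sum b t, v => ∑ j ∈ Finset.range (b.den inp D v), t.den inp D (vcons j v)

/-- The number of registers that are needed to compute a term. -/
def depth : Tm → ℕ
  | .const _ => 1
  | .var _ => 1
  | .inp t => t.depth
  | .rd _ t => t.depth
  | .add t u => t.depth + u.depth + 1
  | .sub t u => t.depth + u.depth + 1
  | .ite c t u => c.depth + t.depth + u.depth
  | .sum b t => b.depth + t.depth + 3

theorem depth_pos (t : Tm) : 0 < t.depth := by
  induction t <;> simp [depth] <;> omega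

/-- The program that writes the value of a term to register `d`; the registers above `d` hold
intermediate results, and variable `i` is held in register `ρ i`. -/
def compile (S : ℕ) : Tm → (ℕ → ℕ) → ℕ → Program
  | .const k, _, d => .assign (addr S d (.const 0)) (.const k)
  | .var i, ρ, d => .assign (addr S d (.const 0)) (reg S (ρ i))
  | .inp t, ρ, d => .seq (t.compile S ρ d)
      (.ite (.sub (.smul 8 (.load (.const 0))) (reg S d))
        (.assign (addr S d (.const 0)) (.load (reg S d)))
        (.assign (addr S d (.const 0)) (.const 0)))
  | .rd a t, ρ, d => .seq (t.compile S ρ d)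
      (.assign (addr S d (.const 0)) (.load (addr S a (reg S d))))
  | .add t u, ρ, d => .seq (t.compile S ρ d) (.seq (u.compile S ρ (d + 1))
      (.assign (addr S d (.const 0)) (.add (reg S d) (reg S (d + 1)))))
  | .sub t u, ρ, d => .seq (t.compile S ρ d) (.seq (u.compile S ρ (d + 1))
      (.assign (addr S d (.const 0)) (.sub (reg S d) (reg S (d + 1)))))
  | .ite c t u, ρ, d => .seq (c.compile S ρ d)
      (.ite (reg S d) (t.compile S ρ d) (u.compile S ρ d))
  | .sum b t, ρ, d => .seq (b.compile S ρ d)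
      (.seq (.assign (addr S (d + 1) (.const 0)) (.const 0))
        (.seq (forLoop' S d (t.compile S (vcons (d + 2) ρ) (d + 3)))
          (.assign (addr S d (.const 0)) (reg S (d + 1)))))
where
  /-- The loop that sums up the values in register `d + 3`. -/
  forLoop' (S d : ℕ) (P : Program) : Program := Machine.forLoop S d (d + 2)
    (.seq P (.assign (addr S (d + 1) (.const 0)) (.add (reg S (d + 1)) (reg S (d + 3)))))

/-- A bound on the value of a term if `X` bounds the input, the arrays and the variables. -/
noncomputable def bound : Tm → ℕ[X]
  | .const k => (k : ℕ[X])
  | .var _ => X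
  | .inp _ => X
  | .rd _ _ => X
  | .add t u => t.bound + u.bound
  | .sub t _ => t.bound
  | .ite _ t u => t.bound + u.bound
  | .sum b t => b.bound * t.bound.comp (X + b.bound)

/-- A bound on the number of steps that are needed to compute a term. -/
noncomputable def cost : Tm → ℕ[X]
  | .const _ => 1
  | .var _ => 1
  | .inp t => t.cost + 3
  | .rd _ t => t.cost + 2
  | .add t u => t.cost + u.cost + 3
  | .sub t u => t.cost + u.cost + 3
  | .ite c t u => c.cost + t.cost + u.cost + 2
  | .sum b t => b.cost + b.bound * (t.cost.comp (X + b.bound) + 5) + 8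

theorem den_le_bound {inp : ℕ → ℕ} {D : Fin 8 → ℕ → ℕ} (t : Tm) :
    ∀ {v : ℕ → ℕ} {B : ℕ}, (∀ i, inp i ≤ B) → (∀ a i, D a i ≤ B) → (∀ i, v i ≤ B) →
      t.den inp D v ≤ t.bound.eval B := by
  induction t with
  | const k => intro v B _ _ _; simp [den, bound]
  | var i => intro v B _ _ hv; simpa [den, bound] using hv i
  | inp t ih => intro v B hi _ _; simpa [den, bound] using hi _
  | rd a t ih => intro v B _ hD _; simpa [den, bound] using hD _ _
  | add t u iht ihu =>
    intro v B hi hD hv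
    simpa [den, bound] using add_le_add (iht hi hD hv) (ihu hi hD hv)
  | sub t u iht ihu =>
    intro v B hi hD hv
    simpa [den, bound] using (Nat.sub_le _ _).trans (iht hi hD hv)
  | ite c t u _ iht ihu =>
    intro v B hi hD hv
    have h1 := iht hi hD hv
    have h2 := ihu hi hD hv
    simp only [den, bound, eval_add]
    split_ifs <;> omega
  | sum b t ihb iht =>
    intro v B hi hD hv
    have h1 := ihb hi hD hv
    simp only [den, bound, eval_mul, eval_comp, eval_add, eval_X]
    -- The summation index is one more variable, bounded by the value of `b`; this is why the bound
    -- of `t` is taken at the enlarged argument.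
    calc _ ≤ ∑ j ∈ Finset.range (b.den inp D v), t.bound.eval (B + b.bound.eval B) := by
          refine Finset.sum_le_sum fun j hj => iht (fun i => (hi i).trans (by omega))
            (fun a i => (hD a i).trans (by omega)) ?_
          rintro (_ | i)
          · have := Finset.mem_range.1 hj
            simp only [vcons]; omega
          · exact (hv i).trans (by omega)
      _ ≤ _ := by
          rw [Finset.sum_const, Finset.card_range, smul_eq_mul]
          exact Nat.mul_le_mul_right _ h1

end Tm

/-- The arrays that terms can read. -/
def Arrays.data (A : Arrays) : Fin 8 → ℕ → ℕ := fun a => A a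

theorem Arrays.data_congr {A A' : Arrays} {d : ℕ} (hd : 8 ≤ d) (h : ∀ k < d, A' k = A k) :
    A'.data = A.data := by
  funext a
  exact h a (by omega)

namespace Machine

/-- Registers below `d` are never written, which protects the variables, the readable arrays and the
intermediate results of the enclosing term; this is what makes the induction on terms work. -/
theorem runs_compile {W : Machine} (t : Tm) :
    ∀ {ρ : ℕ → ℕ} {d B : ℕ} {A : Arrays} {ψ : QState}, (∀ i, ρ i < d) → 8 ≤ d →
      d + t.depth ≤ W.S → (∀ i, W.inp i ≤ B) → (∀ a i, A.data a i ≤ B) →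
      (∀ i, A (ρ i) 0 ≤ B) →
      W.Runs (t.compile W.S ρ d) (t.cost.eval B) A ψ fun A' ψ' => ψ' = ψ ∧
        (∀ k < d, A' k = A k) ∧ A' d 0 = t.den W.inp A.data fun i => A (ρ i) 0 := by
  have hset : ∀ (A : Arrays) (d v : ℕ), ∀ k < d, A.set d 0 v k = A k :=
    fun A d v k hk => A.set_of_ne _ _ hk.ne
  induction t with
  | const c =>
    intro ρ d B A ψ hρ hd hS hi hD hv
    simp only [Tm.cost, eval_one]
    exact runs_assign_reg (by simp [Tm.depth] at hS; omega) (denotes_const c)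
      ⟨rfl, hset A d _, A.set_self _ _ _⟩
  | var i =>
    intro ρ d B A ψ hρ hd hS hi hD hv
    simp only [Tm.cost, eval_one]
    simp only [Tm.depth] at hS
    exact runs_assign_reg (by omega) (denotes_reg ((hρ i).trans (by omega)))
      ⟨rfl, hset A d _, A.set_self _ _ _⟩
  | inp t ih =>
    intro ρ d B A ψ hρ hd hS hi hD hv
    simp only [Tm.cost, eval_add]
    simp only [Tm.depth] at hS
    have hp := t.depth_pos
    refine Runs.mono (c := t.cost.eval B + (1 + 1) + 1) ((ih hρ hd hS hi hD hv).seq ?_)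
      (by simp) (fun _ _ h => h)
    rintro A' ψ' ⟨rfl, hA, hval⟩
    have hdS : d < W.S := by omega
    -- Cells from 8n on hold arrays. The test replaces a read beyond the input by 0, the value that
    -- the input function has there.
    refine runs_ite ((denotes_n.smul 8).sub (denotes_reg hdS)) (fun h => ?_) (fun h => ?_)
    · refine runs_assign_reg hdS ((denotes_reg hdS).input (by omega)) ⟨rfl, ?_, ?_⟩
      · intro k hk; rw [hset A' d _ k hk, hA k hk]
      · rw [A'.set_self, hval]; rfl
    · refine runs_assign_reg hdS (denotes_const 0) ⟨rfl, ?_, ?_⟩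
      · intro k hk; rw [hset A' d _ k hk, hA k hk]
      · rw [A'.set_self, Tm.den, ← hval, W.inp_eq_zero _ (by omega)]
  | rd a t ih =>
    intro ρ d B A ψ hρ hd hS hi hD hv
    simp only [Tm.cost, eval_add]
    simp only [Tm.depth] at hS
    have hp := t.depth_pos
    refine Runs.mono (c := t.cost.eval B + 1 + 1) ((ih hρ hd hS hi hD hv).seq ?_)
      (by simp) (fun _ _ h => h)
    rintro A' ψ' ⟨rfl, hA, hval⟩
    have hdS : d < W.S := by omega
    refine runs_assign_reg hdS ((denotes_reg hdS).load (k := a) (by omega)) ⟨rfl, ?_, ?_⟩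
    · intro k hk; rw [hset A' d _ k hk, hA k hk]
    · rw [A'.set_self, hval, hA a (by omega)]; rfl
  | add t u iht ihu | sub t u iht ihu =>
    intro ρ d B A ψ hρ hd hS hi hD hv
    simp only [Tm.cost, eval_add]
    simp only [Tm.depth] at hS
    have hp := t.depth_pos
    have hp' := u.depth_pos
    refine Runs.mono (c := t.cost.eval B + (u.cost.eval B + 1 + 1) + 1)
      ((iht hρ hd (by omega) hi hD hv).seq ?_)
      (by simp; omega) (fun _ _ h => h)
    rintro A' ψ' ⟨rfl, hA, hval⟩
    have hdat : A'.data = A.data := Arrays.data_congr hd hA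
    have hv' : (fun i => A' (ρ i) 0) = fun i => A (ρ i) 0 := by funext i; rw [hA _ (hρ i)]
    refine (ihu (d := d + 1) (fun i => (hρ i).trans (by omega)) (by omega) (by omega) hi
      (hdat ▸ hD) (fun i => (congrFun hv' i).le.trans (hv i))).seq ?_
    rintro A'' ψ'' ⟨rfl, hA', hval'⟩
    have hdS : d < W.S := by omega
    have hdS' : d + 1 < W.S := by omega
    have r₁ : W.Denotes (reg W.S d) A'' _ := denotes_reg hdS
    have r₂ : W.Denotes (reg W.S (d + 1)) A'' _ := denotes_reg hdS'
    first
    | refine runs_assign_reg hdS (r₁.add r₂) ⟨rfl, ?_, ?_⟩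
      · intro k hk; rw [hset A'' d _ k hk, hA' k (by omega), hA k hk]
      · rw [A''.set_self, hval', hA' d (by omega), hval, hdat, hv']; rfl
    | refine runs_assign_reg hdS (r₁.sub r₂) ⟨rfl, ?_, ?_⟩
      · intro k hk; rw [hset A'' d _ k hk, hA' k (by omega), hA k hk]
      · rw [A''.set_self, hval', hA' d (by omega), hval, hdat, hv']; rfl
  | ite c t u ihc iht ihu =>
    intro ρ d B A ψ hρ hd hS hi hD hv
    simp only [Tm.cost, eval_add]
    simp only [Tm.depth] at hS
    have hp := c.depth_pos
    refine Runs.mono (c := c.cost.eval B + (t.cost.eval B + u.cost.eval B + 1) + 1)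
      ((ihc hρ hd (by omega) hi hD hv).seq ?_)
      (by simp; omega) (fun _ _ h => h)
    rintro A' ψ' ⟨rfl, hA, hval⟩
    have hdS : d < W.S := by omega
    have hdat : A'.data = A.data := Arrays.data_congr hd hA
    have hv' : (fun i => A' (ρ i) 0) = fun i => A (ρ i) 0 := by funext i; rw [hA _ (hρ i)]
    have hv'' : ∀ i, A' (ρ i) 0 ≤ B := fun i => (congrFun hv' i).le.trans (hv i)
    refine runs_ite (denotes_reg hdS) (fun h => ?_) (fun h => ?_)
    · refine (iht hρ hd (by omega) hi (hdat ▸ hD) hv'').mono (by omega) ?_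
      rintro A'' ψ'' ⟨rfl, hA', hval'⟩
      refine ⟨rfl, fun k hk => (hA' k hk).trans (hA k hk), ?_⟩
      rw [hval', hdat, hv', Tm.den, if_pos (hval ▸ h)]
    · refine (ihu hρ hd (by omega) hi (hdat ▸ hD) hv'').mono (by omega) ?_
      rintro A'' ψ'' ⟨rfl, hA', hval'⟩
      refine ⟨rfl, fun k hk => (hA' k hk).trans (hA k hk), ?_⟩
      rw [hval', hdat, hv', Tm.den, if_neg (hval ▸ not_not.2 h)]
  | sum b t ihb iht =>
    intro ρ d B A ψ hρ hd hS hi hD hv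
    simp only [Tm.depth] at hS
    have hp := b.depth_pos
    have hp' := t.depth_pos
    have hb := b.den_le_bound hi hD hv
    set L := b.den W.inp A.data fun i => A (ρ i) 0 with hL
    set B' := B + b.bound.eval B with hB'
    rw [Tm.compile, Tm.compile.forLoop']
    refine Runs.mono (c := b.cost.eval B +
      (1 + ((L * ((t.cost.eval B' + 1 + 1) + 3) + 3) + 1 + 1) + 1) + 1)
      ((ihb hρ hd (by omega) hi hD hv).seq ?_) ?_ (fun _ _ h => h)
    · rintro A₁ ψ₁ ⟨rfl, hA₁, hval₁⟩
      refine Runs.seq (Mid := fun A' ψ' => ψ' = ψ₁ ∧ A' = A₁.set (d + 1) 0 0)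
        (runs_assign_reg (by omega) (denotes_const 0) ⟨rfl, rfl⟩) ?_
      rintro A₂ ψ₂ ⟨rfl, rfl⟩
      refine Runs.seq (c₁ := L * ((t.cost.eval B' + 1 + 1) + 3) + 3) (c₂ := 1)
        (Mid := fun A' ψ' => ψ' = ψ₂ ∧ (∀ k < d, A' k = A k) ∧ A' (d + 1) 0 =
        ∑ j ∈ Finset.range L, t.den W.inp A.data (vcons j fun i => A (ρ i) 0)) ?_ ?_
      -- Register `d` holds the limit, `d + 1` the partial sum, `d + 2` the counter, which serves as
      -- variable 0 of `t`, and `d + 3` the summand.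
      · refine runs_forLoop (L := L) (by omega) (by omega) (by omega) ?_
          (fun j A' ψ' => ψ' = ψ₂ ∧ (∀ k < d, A' k = A k) ∧ A' (d + 1) 0 =
            ∑ j ∈ Finset.range j, t.den W.inp A.data (vcons j fun i => A (ρ i) 0)) ?_ ?_
          (fun _ _ h => h)
        · rw [Arrays.set_of_ne _ _ _ (by omega), hval₁]
        · refine ⟨rfl, fun k hk => ?_, ?_⟩
          · rw [Arrays.set_of_ne _ _ _ (by omega), Arrays.set_of_ne _ _ _ (by omega), hA₁ k hk]
          · rw [Arrays.set_of_ne _ _ _ (by omega), Arrays.set_self]; simp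
        · rintro j hj A₃ ψ₃ ⟨rfl, hA₃, hsum⟩ hlim hctr
          have hdat : A₃.data = A.data := Arrays.data_congr hd hA₃
          have hv' : (fun i => A₃ (vcons (d + 2) ρ i) 0) = vcons j fun i => A (ρ i) 0 := by
            funext i
            rcases i with _ | i
            · exact hctr
            · simp only [vcons]; rw [hA₃ _ (hρ i)]
          refine (iht (d := d + 3) (B := B') ?_ (by omega) (by omega)
            (fun i => (hi i).trans (by omega)) (fun a i => (hdat ▸ hD a i).trans (by omega))
            ?_).seq ?_
          · rintro (_ | i)
            · simp [vcons]
            · exact (hρ i).trans (by omega)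
          · intro i
            rw [congrFun hv' i]
            rcases i with _ | i
            · simp only [vcons]; omega
            · exact (hv i).trans (by omega)
          · rintro A₄ ψ₄ ⟨rfl, hA₄, hval₄⟩
            refine runs_assign_reg (by omega)
              ((denotes_reg (by omega)).add (denotes_reg (by omega))) ⟨?_, ?_, rfl, ?_, ?_⟩
            · rw [Arrays.set_of_ne _ _ _ (by omega), hA₄ d (by omega), hlim]
            · rw [Arrays.set_of_ne _ _ _ (by omega), hA₄ (d + 2) (by omega), hctr]
            · intro k hk
              rw [Arrays.set_of_ne _ _ _ (by omega), Arrays.set_of_ne _ _ _ (by omega),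
                hA₄ k (by omega), hA₃ k hk]
            · rw [Arrays.set_of_ne _ _ _ (by omega), Arrays.set_self, hA₄ (d + 1) (by omega), hsum,
                hval₄, hdat, hv', Finset.sum_range_succ]
      · rintro A₅ ψ₅ ⟨rfl, hA₅, hval₅⟩
        have r : W.Denotes (reg W.S (d + 1)) A₅ _ := denotes_reg (by omega)
        refine runs_assign_reg (by omega) r ⟨rfl, ?_, ?_⟩
        · intro k hk; rw [hset A₅ d _ k hk, hA₅ k hk]
        · rw [A₅.set_self, hval₅]; rfl
    · simp only [Tm.cost, eval_add, eval_mul, eval_comp, eval_X, eval_ofNat]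
      have := Nat.mul_le_mul_right (t.cost.eval B' + 5) hb
      rw [← hB', show L * (t.cost.eval B' + 1 + 1 + 3) = L * (t.cost.eval B' + 5) by ring]
      omega

end Machine

/-! ### Functions given by terms -/

/-- The input, the readable arrays and, as a ghost that no program can access, an element `η` of
`𝔽₄` with `η² + η + 1 = 0`. -/
structure Base where
  η : F4
  hη : η ^ 2 + η + 1 = 0
  inp : ℕ → ℕ
  data : Fin 8 → ℕ → ℕ

/-- Contexts: the base data together with the values of some variables. -/
class Ctx (α : Type) where
  base : α → Base
  var : α → ℕ → ℕ

instance : Ctx Base := ⟨id, fun _ _ => 0⟩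

instance {α : Type} [Ctx α] : Ctx (α × ℕ) :=
  ⟨fun p => Ctx.base p.1, fun p => vcons p.2 (Ctx.var p.1)⟩

namespace Tm

/-- Renaming of variables. -/
def rename : Tm → (ℕ → ℕ) → Tm
  | .const k, _ => .const k
  | .var i, ξ => .var (ξ i)
  | .inp t, ξ => .inp (t.rename ξ)
  | .rd a t, ξ => .rd a (t.rename ξ)
  | .add t u, ξ => .add (t.rename ξ) (u.rename ξ)
  | .sub t u, ξ => .sub (t.rename ξ) (u.rename ξ)
  | .ite c t u, ξ => .ite (c.rename ξ) (t.rename ξ) (u.rename ξ)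
  | .sum b t, ξ => .sum (b.rename ξ) (t.rename (vcons 0 fun i => ξ i + 1))

theorem den_rename (inp : ℕ → ℕ) (D : Fin 8 → ℕ → ℕ) (t : Tm) :
    ∀ (ξ v : ℕ → ℕ), (t.rename ξ).den inp D v = t.den inp D fun i => v (ξ i) := by
  induction t with
  | const k => intros; rfl
  | var i => intros; rfl
  | inp t ih => intros; simp only [rename, den, ih]
  | rd a t ih => intros; simp only [rename, den, ih]
  | add t u iht ihu => intros; simp only [rename, den, iht, ihu]
  | sub t u iht ihu => intros; simp only [rename, den, iht, ihu]
  | ite c t u ihc iht ihu => intros; simp only [rename, den, ihc, iht, ihu]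
  | sum b t ihb iht =>
    intro ξ v
    simp only [rename, den, ihb, iht]
    refine Finset.sum_congr rfl fun j _ => ?_
    congr 1
    funext i
    rcases i with _ | i <;> rfl

end Tm

/-- Functions that are given by a term. -/
def PF {α : Type} [Ctx α] (f : α → ℕ) : Prop :=
  ∃ t : Tm, ∀ a, t.den (Ctx.base a).inp (Ctx.base a).data (Ctx.var a) = f a

/-- Predicates that are given by a term. -/
def PD {α : Type} [Ctx α] (p : α → Prop) : Prop :=
  ∃ f : α → ℕ, PF f ∧ ∀ a, p a ↔ f a ≠ 0

section closure

variable {α : Type} [Ctx α] {f g : α → ℕ} {p q : α → Prop}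

theorem PF.congr (hf : PF f) (h : ∀ a, f a = g a) : PF g := by
  obtain ⟨t, ht⟩ := hf
  exact ⟨t, fun a => (ht a).trans (h a)⟩

theorem PD.congr (hp : PD p) (h : ∀ a, p a ↔ q a) : PD q := by
  obtain ⟨f, hf, hp⟩ := hp
  exact ⟨f, hf, fun a => (h a).symm.trans (hp a)⟩

theorem PF.const (k : ℕ) : PF fun _ : α => k := ⟨.const k, fun _ => rfl⟩

theorem PF.snd : PF fun a : α × ℕ => a.2 := ⟨.var 0, fun _ => rfl⟩

theorem PF.wk (hf : PF f) : PF fun a : α × ℕ => f a.1 := by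
  obtain ⟨t, ht⟩ := hf
  exact ⟨t.rename Nat.succ, fun a => (t.den_rename _ _ _ _).trans (ht a.1)⟩

theorem PF.inp (hf : PF f) : PF fun a => (Ctx.base a).inp (f a) := by
  obtain ⟨t, ht⟩ := hf
  exact ⟨.inp t, fun a => congrArg _ (ht a)⟩

theorem PF.rd (k : Fin 8) (hf : PF f) : PF fun a => (Ctx.base a).data k (f a) := by
  obtain ⟨t, ht⟩ := hf
  exact ⟨.rd k t, fun a => congrArg _ (ht a)⟩

theorem PF.add (hf : PF f) (hg : PF g) : PF fun a => f a + g a := by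
  obtain ⟨t, ht⟩ := hf
  obtain ⟨u, hu⟩ := hg
  exact ⟨.add t u, fun a => by simp only [Tm.den, ht, hu]⟩

theorem PF.sub (hf : PF f) (hg : PF g) : PF fun a => f a - g a := by
  obtain ⟨t, ht⟩ := hf
  obtain ⟨u, hu⟩ := hg
  exact ⟨.sub t u, fun a => by simp only [Tm.den, ht, hu]⟩

theorem PF.sum {b : α → ℕ} {f : α → ℕ → ℕ} (hb : PF b) (hf : PF fun a : α × ℕ => f a.1 a.2) :
    PF fun a => ∑ j ∈ Finset.range (b a), f a j := by
  obtain ⟨t, ht⟩ := hb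
  obtain ⟨u, hu⟩ := hf
  refine ⟨.sum t u, fun a => ?_⟩
  simp only [Tm.den, ht]
  exact Finset.sum_congr rfl fun j _ => hu (a, j)

theorem PF.ite (hp : PD p) (hf : PF f) (hg : PF g) [DecidablePred p] :
    PF fun a => if p a then f a else g a := by
  obtain ⟨c, ⟨s, hs⟩, hp⟩ := hp
  obtain ⟨t, ht⟩ := hf
  obtain ⟨u, hu⟩ := hg
  refine ⟨.ite s t u, fun a => ?_⟩
  simp only [Tm.den, ht, hu, hs, hp]

theorem PD.not (hp : PD p) : PD fun a => ¬ p a := by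
  obtain ⟨f, hf, hp⟩ := hp
  refine ⟨_, (PF.const 1).sub hf, fun a => ?_⟩
  change ¬ p a ↔ _
  rw [hp]; omega

theorem PD.and (hp : PD p) (hq : PD q) : PD fun a => p a ∧ q a := by
  obtain ⟨f, hf, hp⟩ := hp
  obtain ⟨g, hg, hq⟩ := hq
  refine ⟨_, (PF.const 1).sub (((PF.const 1).sub hf).add ((PF.const 1).sub hg)), fun a => ?_⟩
  change p a ∧ q a ↔ _
  rw [hp, hq]; omega

theorem PD.lt (hf : PF f) (hg : PF g) : PD fun a => f a < g a :=
  ⟨_, hg.sub hf, fun a => by omega⟩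

theorem PD.eq (hf : PF f) (hg : PF g) : PD fun a => f a = g a :=
  ⟨_, (PF.const 1).sub ((hf.sub hg).add (hg.sub hf)), fun a => by omega⟩

/-- A sum of natural numbers is nonzero exactly when one of its summands is. -/
theorem PD.ex {b : α → ℕ} {p : α → ℕ → Prop} (hb : PF b) (hp : PD fun a : α × ℕ => p a.1 a.2) :
    PD fun a => ∃ j < b a, p a j := by
  obtain ⟨f, hf, hp⟩ := hp
  refine ⟨_, hb.sum (f := fun a j => f (a, j)) hf, fun a => ?_⟩
  simp only [ne_eq, Finset.sum_eq_zero_iff, Finset.mem_range, not_forall]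
  exact ⟨fun ⟨j, hj, h⟩ => ⟨j, hj, (hp (a, j)).1 h⟩, fun ⟨j, hj, h⟩ => ⟨j, hj, (hp (a, j)).2 h⟩⟩

theorem PD.all {b : α → ℕ} {p : α → ℕ → Prop} (hb : PF b) (hp : PD fun a : α × ℕ => p a.1 a.2) :
    PD fun a => ∀ j < b a, p a j :=
  (PD.ex (p := fun a j => ¬ p a j) hb hp.not).not.congr fun a => by push Not; rfl

theorem PF.mul (hf : PF f) (hg : PF g) : PF fun a => f a * g a :=
  (hf.sum (f := fun a _ => g a) hg.wk).congr fun a => by simp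

/-- The quotient counts the numbers v with (v + 1) g ≤ f; all of them are below f when g is
positive. -/
theorem PF.div (hf : PF f) (hg : PF g) : PF fun a => f a / g a := by
  refine (PF.ite (PD.eq hg (PF.const 0)) (PF.const 0)
    (hf.sum (f := fun a v => if (v + 1) * g a < f a + 1 then 1 else 0)
      (PF.ite (PD.lt ((PF.snd.add (PF.const 1)).mul hg.wk) (hf.wk.add (PF.const 1)))
        (PF.const 1) (PF.const 0)))).congr fun a => ?_
  split_ifs with h
  · simp [h]
  · rw [← Finset.sum_filter, Finset.sum_const, smul_eq_mul, mul_one]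
    have : (Finset.range (f a)).filter (fun v => (v + 1) * g a < f a + 1)
        = Finset.range (f a / g a) := by
      ext v
      have h1 := Nat.le_div_iff_mul_le (x := v + 1) (y := f a) (Nat.pos_of_ne_zero h)
      have h2 := Nat.div_le_self (f a) (g a)
      simp only [Finset.mem_filter, Finset.mem_range]
      omega
    rw [this, Finset.card_range]

theorem PF.mod (hf : PF f) (hg : PF g) : PF fun a => f a % g a :=
  (hf.sub (hg.mul (hf.div hg))).congr fun a => by
    have := Nat.div_add_mod (f a) (g a)
    omega

end closure

/-- The first index less than `N` that satisfies `p`, and `N` if there is none. -/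
def firstIdx (N : ℕ) (p : ℕ → Prop) [DecidablePred p] : ℕ :=
  ∑ u ∈ Finset.range N, if ∀ u' < u + 1, ¬ p u' then 1 else 0

/-- The summand is 1 exactly for the indices below the least solution, so the sum counts up to it.
This turns an unbounded-looking search into a bounded sum. -/
theorem firstIdx_spec {N : ℕ} {p : ℕ → Prop} [DecidablePred p] (h : ∃ q < N, p q) :
    firstIdx N p < N ∧ p (firstIdx N p) ∧ ∀ q < firstIdx N p, ¬ p q := by
  have hex : ∃ q, p q := h.imp fun q hq => hq.2
  have hlt : Nat.find hex < N := by
    obtain ⟨q, hq, hp⟩ := h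
    exact (Nat.find_min' hex hp).trans_lt hq
  have : firstIdx N p = Nat.find hex := by
    unfold firstIdx
    rw [← Finset.sum_filter, Finset.sum_const, smul_eq_mul, mul_one]
    have : (Finset.range N).filter (fun u => ∀ u' < u + 1, ¬ p u')
        = Finset.range (Nat.find hex) := by
      ext u
      simp only [Finset.mem_filter, Finset.mem_range, Nat.lt_find_iff]
      constructor
      · rintro ⟨_, h⟩ m hm; exact h m (by omega)
      · intro h
        refine ⟨?_, fun m hm => h m (by omega)⟩
        by_contra hu
        exact h _ (by omega) (Nat.find_spec hex)
    rw [this, Finset.card_range]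
  rw [this]
  exact ⟨hlt, Nat.find_spec hex, fun q hq => Nat.find_min hex hq⟩

theorem PF.firstIdx {α : Type} [Ctx α] {b : α → ℕ} {p : α → ℕ → Prop}
    [∀ a, DecidablePred (p a)] (hb : PF b)
    (hp : PD fun a : (α × ℕ) × ℕ => p a.1.1 a.2) : PF fun a => firstIdx (b a) (p a) := by
  unfold QuantumBCH.firstIdx
  exact hb.sum (f := fun a u => if ∀ u' < u + 1, ¬ p a u' then 1 else 0)
    (PF.ite (PD.all (p := fun a u' => ¬ p a.1 u') (PF.snd.add (PF.const 1)) hp.not) (PF.const 1)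
      (PF.const 0))

/-! ### The field with four elements -/

/-- The code of an element `u + η v` of `𝔽₄`. -/
noncomputable def enc (η x : F4) : ℕ := loBit η x + 2 * hiBit x

/-- The element of `𝔽₄` with a given code. -/
noncomputable def dec (η : F4) (c : ℕ) : F4 := (c : F4) + η * ((c / 2 : ℕ) : F4)

theorem F4.two : (2 : F4) = 0 := CharTwo.two_eq_zero

theorem F4.cast_mod (k : ℕ) : ((k % 2 : ℕ) : F4) = k := by
  conv_rhs => rw [← Nat.mod_add_div k 2]
  push_cast
  rw [F4.two]
  ring

section F4

variable {η : F4}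

theorem eta_ne (hη : η ^ 2 + η + 1 = 0) : η ≠ 0 ∧ η ≠ 1 := by
  constructor
  · rintro rfl; simp at hη
  · rintro rfl
    have : (1 : F4) = 0 := by linear_combination hη - F4.two
    exact one_ne_zero this

theorem F4.pow_four (x : F4) : x ^ 4 = x := by
  have h := GaloisField.card 2 2 (by norm_num)
  have : Fintype F4 := Fintype.ofFinite _
  rw [Nat.card_eq_fintype_card] at h
  have := FiniteField.pow_card x
  rw [h] at this
  exact this

theorem F4.cases (hη : η ^ 2 + η + 1 = 0) (x : F4) : x = 0 ∨ x = 1 ∨ x = η ∨ x = 1 + η := by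
  have h := F4.pow_four x
  -- Modulo η² + η + 1 and 2, the polynomial X⁴ - X is the product of these four linear factors.
  have : x * ((x - 1) * ((x - η) * (x - (1 + η)))) = 0 := by
    linear_combination h + (x ^ 2 - x) * hη + (x * η + η * x ^ 2 - x ^ 3 * η - x ^ 3 + x - x * η) * F4.two
  simpa [sub_eq_zero] using this

theorem enc_add_mul (hη : η ^ 2 + η + 1 = 0) (a b : ℕ) :
    enc η ((a : F4) + η * (b : F4)) = a % 2 + 2 * (b % 2) := by
  obtain ⟨h0, h1⟩ := eta_ne hη
  have h2 : η + 1 ≠ 0 := fun h => h1 (by linear_combination h - F4.two)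
  rw [← F4.cast_mod a, ← F4.cast_mod b]
  rcases Nat.mod_two_eq_zero_or_one a with ha | ha <;>
  rcases Nat.mod_two_eq_zero_or_one b with hb | hb <;> rw [ha, hb] <;>
  simp [enc, loBit, hiBit, h0, h1, h1.symm, h2, add_comm]

theorem enc_dec (hη : η ^ 2 + η + 1 = 0) (c : ℕ) : enc η (dec η c) = c % 2 + 2 * (c / 2 % 2) :=
  enc_add_mul hη c (c / 2)

theorem exists_nat (hη : η ^ 2 + η + 1 = 0) (x : F4) :
    ∃ a b : ℕ, a < 2 ∧ b < 2 ∧ x = (a : F4) + η * (b : F4) := by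
  rcases F4.cases hη x with h | h | h | h
  · exact ⟨0, 0, by simp [h]⟩
  · exact ⟨1, 0, by simp [h]⟩
  · exact ⟨0, 1, by simp [h]⟩
  · exact ⟨1, 1, by simp [h]⟩

theorem enc_lt (hη : η ^ 2 + η + 1 = 0) (x : F4) : enc η x < 4 := by
  obtain ⟨a, b, ha, hb, rfl⟩ := exists_nat hη x
  rw [enc_add_mul hη]; omega

theorem enc_split (hη : η ^ 2 + η + 1 = 0) (x : F4) :
    x = ((enc η x % 2 : ℕ) : F4) + η * ((enc η x / 2 : ℕ) : F4) := by
  obtain ⟨a, b, ha, hb, rfl⟩ := exists_nat hη x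
  rw [enc_add_mul hη, F4.cast_mod]
  rw [show (a % 2 + 2 * (b % 2)) / 2 = b by omega, Nat.cast_add, F4.cast_mod, Nat.cast_mul]
  push_cast
  linear_combination (-((b % 2 : ℕ) : F4)) * F4.two

theorem dec_enc (hη : η ^ 2 + η + 1 = 0) (x : F4) : dec η (enc η x) = x := by
  conv_rhs => rw [enc_split hη x]
  rw [dec, F4.cast_mod]

theorem enc_zero : enc η 0 = 0 := by simp [enc, loBit, hiBit]

theorem enc_eq_zero (hη : η ^ 2 + η + 1 = 0) {x : F4} : enc η x = 0 ↔ x = 0 := by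
  refine ⟨fun h => ?_, fun h => h ▸ enc_zero⟩
  rw [← dec_enc hη x, h]; simp [dec]

end F4

/-- Functions to `𝔽₄` whose code is given by a term. -/
def PF4 {α : Type} [Ctx α] (f : α → F4) : Prop := PF fun a => enc (Ctx.base a).η (f a)

section closure

variable {α : Type} [Ctx α] {f g : α → F4} {p : α → Prop}

theorem PF4.congr (hf : PF4 f) (h : ∀ a, f a = g a) : PF4 g :=
  PF.congr hf fun a => by rw [h]

theorem PF4.dec {f : α → ℕ} (hf : PF f) : PF4 fun a => dec (Ctx.base a).η (f a) :=
  ((hf.mod (PF.const 2)).add ((PF.const 2).mul ((hf.div (PF.const 2)).mod (PF.const 2)))).congr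
    fun a => (enc_dec (Ctx.base a).hη _).symm

theorem PF4.natCast {f : α → ℕ} (hf : PF f) : PF4 fun a => (f a : F4) :=
  (hf.mod (PF.const 2)).congr fun a => by
    have := enc_add_mul (Ctx.base a).hη (f a) 0
    simp at this
    exact this.symm

theorem PF4.zero : PF4 fun _ : α => (0 : F4) := (PF4.natCast (PF.const 0)).congr (by simp)

theorem PF4.one : PF4 fun _ : α => (1 : F4) := (PF4.natCast (PF.const 1)).congr (by simp)

theorem PF4.eta : PF4 fun a : α => (Ctx.base a).η :=
  (PF.const 2).congr fun a => by
    have := enc_add_mul (Ctx.base a).hη 0 1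
    simp at this
    exact this.symm

theorem PF4.ite (hp : PD p) (hf : PF4 f) (hg : PF4 g) [DecidablePred p] :
    PF4 fun a => if p a then f a else g a :=
  (PF.ite hp hf hg).congr fun a => by dsimp only; split_ifs <;> rfl

theorem PF4.eq_zero (hf : PF4 f) : PD fun a => f a = 0 :=
  (PD.eq hf (PF.const 0)).congr fun a => enc_eq_zero (Ctx.base a).hη

theorem PF4.mul (hf : PF4 f) (hg : PF4 g) : PF4 fun a => f a * g a := by
  have hf0 := PF.mod hf (PF.const 2)
  have hf1 := PF.div hf (PF.const 2)
  have hg0 := PF.mod hg (PF.const 2)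
  have hg1 := PF.div hg (PF.const 2)
  refine ((((hf0.mul hg0).add (hf1.mul hg1)).mod (PF.const 2)).add ((PF.const 2).mul
    ((((hf0.mul hg1).add (hf1.mul hg0)).add (hf1.mul hg1)).mod (PF.const 2)))).congr fun a => ?_
  have hη := (Ctx.base a).hη
  set η := (Ctx.base a).η
  rw [← enc_add_mul hη]
  congr 1
  dsimp only
  conv_rhs => rw [enc_split hη (f a), enc_split hη (g a)]
  push_cast
  generalize ((enc η (f a) % 2 : ℕ) : F4) = a0
  generalize ((enc η (f a) / 2 : ℕ) : F4) = a1
  generalize ((enc η (g a) % 2 : ℕ) : F4) = b0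
  generalize ((enc η (g a) / 2 : ℕ) : F4) = b1
  linear_combination (-a1 * b1) * hη + a1 * b1 * (1 + η) * F4.two

theorem PF4.add (hf : PF4 f) (hg : PF4 g) : PF4 fun a => f a + g a := by
  have hf0 := PF.mod hf (PF.const 2)
  have hf1 := PF.div hf (PF.const 2)
  have hg0 := PF.mod hg (PF.const 2)
  have hg1 := PF.div hg (PF.const 2)
  refine (((hf0.add hg0).mod (PF.const 2)).add ((PF.const 2).mul
    ((hf1.add hg1).mod (PF.const 2)))).congr fun a => ?_
  have hη := (Ctx.base a).hη
  rw [← enc_add_mul hη]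
  congr 1
  dsimp only
  conv_rhs => rw [enc_split hη (f a), enc_split hη (g a)]
  push_cast
  ring

/-- Nonzero elements satisfy x³ = 1, so the inverse is the square; this is also correct at 0. -/
theorem PF4.inv (hf : PF4 f) : PF4 fun a => (f a)⁻¹ :=
  (PF4.mul hf hf).congr fun a => by
    by_cases h : f a = 0
    · simp [h]
    · refine eq_inv_of_mul_eq_one_left (mul_right_cancel₀ h ?_)
      ( linear_combination F4.pow_four (f a))

theorem PF4.sum {b : α → ℕ} {f : α → ℕ → F4} (hb : PF b) (hf : PF4 fun a : α × ℕ => f a.1 a.2) :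
    PF4 fun a => ∑ j ∈ Finset.range (b a), f a j := by
  have hf0 := PF.mod hf (PF.const 2)
  have hf1 := PF.div hf (PF.const 2)
  refine (((hb.sum (f := fun a j => enc (Ctx.base a).η (f a j) % 2) hf0).mod (PF.const 2)).add
    ((PF.const 2).mul ((hb.sum (f := fun a j => enc (Ctx.base a).η (f a j) / 2) hf1).mod
      (PF.const 2)))).congr fun a => ?_
  have hη := (Ctx.base a).hη
  rw [← enc_add_mul hη]
  congr 1
  push_cast
  rw [Finset.mul_sum, ← Finset.sum_add_distrib]
  exact Finset.sum_congr rfl fun j _ => (enc_split hη (f a j)).symm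

end closure

/-! ### Elimination -/

section elimination

variable (N : ℕ)

/-- The scalar product of the first `N` entries. -/
noncomputable def dot (a v : ℕ → F4) : F4 := ∑ j ∈ Finset.range N, a j * v j

open Classical in
/-- One step of the elimination: vectors that span the subspace of the span of the vectors `v q` on
which the functional `a` vanishes. -/
noncomputable def pivot (a : ℕ → F4) (v : ℕ → ℕ → F4) (q j : ℕ) : F4 :=
  v q j + dot N a (v q) * (dot N a (v (firstIdx N fun u => dot N a (v u) ≠ 0)))⁻¹ *
    v (firstIdx N fun u => dot N a (v u) ≠ 0) j

/-- Vectors that span the kernel of the first `s` functionals. -/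
noncomputable def fam (row : ℕ → ℕ → F4) : ℕ → ℕ → ℕ → F4
  | 0 => fun q j => if q = j then 1 else 0
  | s + 1 => pivot N (row s) (fam row s)

variable {N}

theorem dot_add (a v w : ℕ → F4) : dot N a (fun j => v j + w j) = dot N a v + dot N a w := by
  simp [dot, mul_add, Finset.sum_add_distrib]

theorem dot_smul (a v : ℕ → F4) (c : F4) : dot N a (fun j => c * v j) = c * dot N a v := by
  simp [dot, Finset.mul_sum, mul_left_comm]

theorem dot_sum {ι : Type*} (a : ℕ → F4) (s : Finset ι) (v : ι → ℕ → F4) :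
    dot N a (fun j => ∑ q ∈ s, v q j) = ∑ q ∈ s, dot N a (v q) := by
  simp only [dot, Finset.mul_sum]
  exact Finset.sum_comm

theorem dot_congr {a v w : ℕ → F4} (h : ∀ j < N, v j = w j) : dot N a v = dot N a w :=
  Finset.sum_congr rfl fun j hj => by rw [h j (Finset.mem_range.1 hj)]

theorem dot_pivot_of_dot {a b : ℕ → F4} {v : ℕ → ℕ → F4} (h : ∀ q < N, dot N b (v q) = 0) {q : ℕ}
    (hq : q < N) : dot N b (pivot N a v q) = 0 := by
  classical
  unfold pivot
  rw [dot_add, dot_smul, h q hq, zero_add]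
  by_cases hex : ∃ u < N, dot N a (v u) ≠ 0
  · rw [h _ (firstIdx_spec hex).1, mul_zero]
  · push Not at hex
    rw [hex q hq]; simp

/-- In characteristic 2 the added multiple of the pivot vector cancels the value of `a`. The pivot
vector itself becomes zero, so the number of vectors stays `N`. Without a pivot all values of `a`
are zero already. -/
theorem dot_pivot {a : ℕ → F4} {v : ℕ → ℕ → F4} {q : ℕ} (hq : q < N) :
    dot N a (pivot N a v q) = 0 := by
  classical
  unfold pivot
  rw [dot_add, dot_smul]
  by_cases hex : ∃ u < N, dot N a (v u) ≠ 0
  · rw [mul_assoc, inv_mul_cancel₀ (firstIdx_spec hex).2.1, mul_one, CharTwo.add_self_eq_zero]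
  · push Not at hex
    rw [hex q hq]; simp

theorem fam_dot (row : ℕ → ℕ → F4) {s s' : ℕ} (hs : s' < s) {q : ℕ} (hq : q < N) :
    dot N (row s') (fam N row s q) = 0 := by
  induction s generalizing q with
  | zero => omega
  | succ s ih =>
    rcases Nat.lt_succ_iff_lt_or_eq.1 hs with h | rfl
    · exact dot_pivot_of_dot (fun q hq => ih h hq) hq
    · exact dot_pivot hq

/-- A kernel vector keeps its coordinates x q as coefficients through all steps, although the
vectors become dependent: one step changes Σ x q v q by a multiple of the pivot vector whose factor
contains the value of the current functional at x, and this is 0. -/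
theorem fam_span (row : ℕ → ℕ → F4) {s : ℕ} {x : ℕ → F4} (hx : ∀ s' < s, dot N (row s') x = 0) :
    ∀ j < N, x j = ∑ q ∈ Finset.range N, x q * fam N row s q j := by
  induction s with
  | zero =>
    intro j hj
    simp [fam, hj]
  | succ s ih =>
    intro j hj
    have ih := ih fun s' hs => hx s' (by omega)
    have h0 : ∑ q ∈ Finset.range N, x q * dot N (row s) (fam N row s q) = 0 := by
      rw [← hx s (by omega), dot_congr ih, dot_sum]
      exact Finset.sum_congr rfl fun q _ => (dot_smul _ _ _).symm
    simp only [fam, pivot, mul_add, Finset.sum_add_distrib]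
    rw [← ih j hj]
    simp only [← mul_assoc]
    rw [← Finset.sum_mul, ← Finset.sum_mul, h0]
    simp

/-- A functional that does not vanish on the kernel of some functionals does not vanish on one of
the vectors that the elimination computes. -/
theorem exists_fam (row : ℕ → ℕ → F4) {s : ℕ} {x : ℕ → F4} (hx : ∀ s' < s, dot N (row s') x = 0)
    {a : ℕ → F4} (ha : dot N a x ≠ 0) : ∃ q < N, dot N a (fam N row s q) ≠ 0 := by
  by_contra h
  push Not at h
  apply ha
  rw [dot_congr (fam_span row hx), dot_sum]
  refine Finset.sum_eq_zero fun q hq => ?_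
  rw [dot_smul, h q (Finset.mem_range.1 hq), mul_zero]

end elimination

/-! ### Tabulation -/

/-- Functions of the base data that are given by a term in every context. -/
def PFB (f : Base → ℕ) : Prop := ∀ (β : Type) [Ctx β], PF fun b : β => f (Ctx.base b)

/-- Functions of the base data and three numbers that are given by a term in every context. -/
def PFB₃ (f : Base → ℕ → ℕ → ℕ → F4) : Prop :=
  ∀ (β : Type) [Ctx β] (x y z : β → ℕ), PF x → PF y → PF z →
    PF4 fun b => f (Ctx.base b) (x b) (y b) (z b)

/-- `RunsD` is `Runs` restricted to the arrays that terms can read. -/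
def Machine.RunsD (W : Machine) (P : Program) (c : ℕ) (D : Fin 8 → ℕ → ℕ) (ψ : QState)
    (Post : (Fin 8 → ℕ → ℕ) → QState → Prop) : Prop :=
  ∀ A : Arrays, A.data = D → A 8 0 = 0 →
    W.Runs P c A ψ fun A' ψ' => A' 8 0 = 0 ∧ Post A'.data ψ'

theorem Machine.RunsD.mono {W : Machine} {P : Program} {c c' : ℕ} {D : Fin 8 → ℕ → ℕ} {ψ : QState}
    {Post Post' : (Fin 8 → ℕ → ℕ) → QState → Prop} (h : W.RunsD P c D ψ Post) (hc : c ≤ c')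
    (hP : ∀ D' ψ', Post D' ψ' → Post' D' ψ') : W.RunsD P c' D ψ Post' := fun A hA h8 =>
  (h A hA h8).mono hc fun _ _ h => ⟨h.1, hP _ _ h.2⟩

theorem Machine.RunsD.seq {W : Machine} {P Q : Program} {c₁ c₂ : ℕ} {D : Fin 8 → ℕ → ℕ} {ψ : QState}
    {Mid Post : (Fin 8 → ℕ → ℕ) → QState → Prop} (h : W.RunsD P c₁ D ψ Mid)
    (h' : ∀ D' ψ', Mid D' ψ' → W.RunsD Q c₂ D' ψ' Post) :
    W.RunsD (.seq P Q) (c₁ + c₂ + 1) D ψ Post := fun A hA h8 =>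
  (h A hA h8).seq fun A' _ hm => h' _ _ hm.2 A' rfl hm.1

/-- The base data that belong to the contents `D` of the arrays. -/
def Machine.base (W : Machine) {η : F4} (hη : η ^ 2 + η + 1 = 0) (D : Fin 8 → ℕ → ℕ) : Base :=
  ⟨η, hη, W.inp, D⟩

/-- The bounds on the input and the arrays under which the costs are estimated. -/
def Machine.Bounded (W : Machine) (B : ℕ) (D : Fin 8 → ℕ → ℕ) : Prop :=
  (∀ i, W.inp i ≤ B) ∧ ∀ a i, D a i ≤ B

theorem Arrays.data_set (A : Arrays) (a : Fin 8) (i v : ℕ) :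
    (A.set a i v).data = Function.update A.data a (Function.update (A.data a) i v) := by
  funext k
  by_cases h : k = a
  · subst h; simp [Arrays.set, Arrays.data]
  · rw [Function.update_of_ne h, Arrays.data, A.set_of_ne _ _ (by simpa [Fin.ext_iff] using h)]
    rfl

/-- The term may read the array that is being filled: when entry j is computed, all earlier entries
have their final values, whence the form of the condition on `F`. This is the source of recursion.
The bound on `F` keeps `B` valid throughout, so the cost does not compound. Register 8 holds 0 and
stands for unused variables, 9 the length and 10 the counter. -/
theorem exists_tab (a : Fin 8) {b : Base → ℕ} {f : Base × ℕ → ℕ} (hb : PF b) (hf : PF f) :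
    ∃ (s : ℕ) (c : ℕ[X]) (P : ℕ → Program), ∀ W : Machine, s ≤ W.S →
      ∀ {η : F4} (hη : η ^ 2 + η + 1 = 0) (D : Fin 8 → ℕ → ℕ) (ψ : QState) (B : ℕ) (F : ℕ → ℕ),
      W.Bounded B D → (∀ j < b (W.base hη D), F j ≤ B ∧
        f (W.base hη (Function.update D a fun i => if i < j then F i else D a i), j) = F j) →
      W.RunsD (P W.S) (c.eval B) D ψ fun D' ψ' => ψ' = ψ ∧ W.Bounded B D' ∧
        D' = Function.update D a fun i => if i < b (W.base hη D) then F i else D a i := by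
  obtain ⟨tb, htb⟩ := hb
  obtain ⟨t, ht⟩ := hf
  refine ⟨11 + tb.depth + t.depth,
    tb.cost + (tb.bound * (t.cost.comp (X + tb.bound) + 5) + 3) + 1,
    fun S => .seq (tb.compile S (fun _ => 8) 9) (Machine.forLoop S 9 10
      (.seq (t.compile S (vcons 10 fun _ => 8) 11)
        (.assign (addr S a (reg S 10)) (reg S 11)))), ?_⟩
  intro W hS η hη D ψ B F hB hF A hA h8
  have hp := tb.depth_pos
  have hp' := t.depth_pos
  set L := b (W.base hη D) with hL
  -- `G j` is the contents after `j` entries have been written.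
  set G : ℕ → Fin 8 → ℕ → ℕ :=
    fun j => Function.update D a fun i => if i < j then F i else D a i with hG
  have hGB : ∀ j ≤ L, W.Bounded B (G j) := by
    intro j hj
    refine ⟨hB.1, fun k i => ?_⟩
    by_cases hk : k = a
    · subst hk
      simp only [hG, Function.update_self]
      split_ifs with h
      · exact (hF i (by omega)).1
      · exact hB.2 _ _
    · simp only [hG, Function.update_of_ne hk]; exact hB.2 _ _
  have hden : tb.den W.inp A.data (fun _ => A 8 0) = L := by
    rw [hA, h8]; exact htb (W.base hη D)
  have hLB : L ≤ tb.bound.eval B := hden ▸ tb.den_le_bound hB.1 (hA ▸ hB.2) (by simp [h8])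
  set B' := B + tb.bound.eval B with hB'
  refine Machine.Runs.mono (c := tb.cost.eval B + (L * ((t.cost.eval B' + 1 + 1) + 3) + 3) + 1)
    ((Machine.runs_compile tb (fun _ => by omega) (by omega) (by omega) hB.1 (hA ▸ hB.2)
      (by simp [h8])).seq ?_) ?_ (fun _ _ h => h)
  · rintro A₁ ψ₁ ⟨rfl, hA₁, hval⟩
    refine Machine.runs_forLoop (L := L) (by omega) (by omega) (by omega) (hval.trans hden)
      (fun j A' ψ' => ψ' = ψ₁ ∧ A' 8 0 = 0 ∧ A'.data = G j) ?_ ?_ ?_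
    · refine ⟨rfl, ?_, ?_⟩
      · rw [Arrays.set_of_ne _ _ _ (by omega), hA₁ 8 (by omega), h8]
      · rw [Arrays.data_congr (d := 10) (A := A₁) (by omega)
          (fun k hk => Arrays.set_of_ne _ _ _ (by omega)),
          Arrays.data_congr (d := 9) (A := A) (by omega) hA₁, hA]
        simp [hG]
    · rintro j hj A₂ ψ₂ ⟨rfl, h8', hD⟩ hlim hctr
      have hv : (fun i => A₂ (vcons 10 (fun _ => 8) i) 0) = vcons j fun _ => 0 := by
        funext i; rcases i with _ | i
        · exact hctr
        · exact h8'
      have hGj := hGB j hj.le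
      refine (Machine.runs_compile t (d := 11) (B := B') ?_ (by omega) (by omega)
        (fun i => (hB.1 i).trans (by omega)) (fun k i => (hD ▸ hGj.2 k i).trans (by omega))
        (fun i => ?_)).seq ?_
      · rintro (_ | i) <;> simp [vcons]
      · rw [congrFun hv i]
        rcases i with _ | i <;> simp only [vcons] <;> omega
      · rintro A₃ ψ₃ ⟨rfl, hA₃, hval₃⟩
        have r : W.Denotes (reg W.S 10) A₃ _ := Machine.denotes_reg (by omega)
        have r' : W.Denotes (reg W.S 11) A₃ _ := Machine.denotes_reg (by omega)
        have h10 : A₃ 10 0 = j := by rw [hA₃ 10 (by omega), hctr]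
        have h11 : A₃ 11 0 = F j := by
          rw [hval₃, hv, hD]
          exact (ht (W.base hη (G j), j)).trans (hF j hj).2
        rw [h10] at r
        rw [h11] at r'
        have ha : (a : ℕ) < 8 := a.2
        refine Machine.runs_assign (by omega) r r' ⟨?_, ?_, rfl, ?_, ?_⟩
        · rw [Arrays.set_of_ne _ _ _ (by omega), hA₃ 9 (by omega), hlim]
        · rw [Arrays.set_of_ne _ _ _ (by omega), h10]
        · rw [Arrays.set_of_ne _ _ _ (by omega), Arrays.set_of_ne _ _ _ (by omega),
            hA₃ 8 (by omega), h8']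
        · rw [Arrays.data_congr (d := 10) (A := A₃.set a j (F j)) (by omega)
            (fun k hk => Arrays.set_of_ne _ _ _ (by omega)), Arrays.data_set,
            Arrays.data_congr (d := 11) (A := A₂) (by omega) hA₃, hD]
          simp only [hG, Function.update_idem, Function.update_self]
          congr 1
          funext i
          by_cases hi : i = j
          · subst hi; simp
          · rw [Function.update_of_ne hi]
            by_cases h : i < j
            · simp [h, h.trans (Nat.lt_succ_self j)]
            · have : ¬ i < j + 1 := by omega
              simp [h, this]
    · rintro A₂ ψ₂ ⟨h, h8', hD⟩
      exact ⟨h8', h, hD ▸ hGB L le_rfl, hD⟩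
  · simp only [eval_add, eval_mul, eval_comp, eval_X, eval_ofNat, eval_one]
    have := Nat.mul_le_mul_right (t.cost.eval B' + 5) hLB
    rw [← hB', show L * (t.cost.eval B' + 1 + 1 + 3) = L * (t.cost.eval B' + 5) by ring]
    omega

/-! ### Elimination as a table in one array -/

theorem mul_add_mod_of_lt {a N q : ℕ} (h : q < N) : (a * N + q) % N = q := by
  rw [Nat.mul_add_mod', Nat.mod_eq_of_lt h]

theorem mul_add_div_of_lt {a N q : ℕ} (h : q < N) : (a * N + q) / N = a := by
  rw [add_comm, Nat.add_mul_div_right _ _ (by omega), Nat.div_eq_of_lt h, zero_add]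

/-- The index at which entry `j` of vector `q` after step `s` of elimination `p` is stored. -/
def elimIdx (N R p s q j : ℕ) : ℕ := ((p * (R + 1) + s) * N + q) * N + j

theorem elimIdx_mod {N R p s q j : ℕ} (hj : j < N) : elimIdx N R p s q j % N = j := by
  rw [elimIdx, mul_add_mod_of_lt hj]

theorem elimIdx_div {N R p s q j : ℕ} (hj : j < N) :
    elimIdx N R p s q j / N = (p * (R + 1) + s) * N + q := by
  rw [elimIdx, mul_add_div_of_lt hj]

/-- The entry with index `i`, computed from the previous ones. -/
noncomputable def elimEntry (N R : ℕ) (row : ℕ → ℕ → ℕ → F4) (Z : ℕ → F4) (i : ℕ) : F4 :=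
  if i / N / N % (R + 1) = 0 then (if i / N % N = i % N then 1 else 0)
  else pivot N (row (i / N / N / (R + 1)) (i / N / N % (R + 1) - 1))
    (fun q j => Z (elimIdx N R (i / N / N / (R + 1)) (i / N / N % (R + 1) - 1) q j))
    (i / N % N) (i % N)

/-- Vectors and coordinates from `N` on play no role. If there is no pivot, the vector with number
`N` does occur in the formula, but with coefficient 0. -/
theorem pivot_congr {N : ℕ} {a : ℕ → F4} {v w : ℕ → ℕ → F4} (h : ∀ q < N, ∀ j < N, v q j = w q j)
    {q j : ℕ} (hq : q < N) (hj : j < N) : pivot N a v q j = pivot N a w q j := by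
  classical
  have hd : ∀ q < N, dot N a (v q) = dot N a (w q) := fun q hq => dot_congr (h q hq)
  have hf : (firstIdx N fun u => dot N a (v u) ≠ 0) = firstIdx N fun u => dot N a (w u) ≠ 0 := by
    unfold firstIdx
    refine Finset.sum_congr rfl fun u hu => ?_
    have : (∀ u' < u + 1, ¬ dot N a (v u') ≠ 0) ↔ ∀ u' < u + 1, ¬ dot N a (w u') ≠ 0 :=
      forall₂_congr fun u' hu' => by
        rw [hd u' (by have := Finset.mem_range.1 hu; omega)]
    simp only [this]
  unfold pivot
  rw [h q hq j hj, hd q hq, hf]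
  by_cases hex : ∃ u < N, dot N a (w u) ≠ 0
  · have := (firstIdx_spec hex).1
    rw [h _ this j hj, hd _ this]
  · push Not at hex
    rw [hex q hq]; simp

theorem elimEntry_eq {N R : ℕ} {row : ℕ → ℕ → ℕ → F4} {Z : ℕ → F4} {p s q j : ℕ}
    (hs : s ≤ R) (hq : q < N) (hj : j < N)
    (hZ : ∀ s' < s, ∀ q < N, ∀ j < N, Z (elimIdx N R p s' q j) = fam N (row p) s' q j) :
    elimEntry N R row Z (elimIdx N R p s q j) = fam N (row p) s q j := by
  unfold elimEntry
  have h1 : ((p * (R + 1) + s) * N + q) % N = q := mul_add_mod_of_lt hq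
  have h2 : ((p * (R + 1) + s) * N + q) / N = p * (R + 1) + s := mul_add_div_of_lt hq
  have h3 : (p * (R + 1) + s) % (R + 1) = s := mul_add_mod_of_lt (by omega)
  have h4 : (p * (R + 1) + s) / (R + 1) = p := mul_add_div_of_lt (by omega)
  rw [elimIdx_div hj, elimIdx_mod hj, h1, h2, h3, h4]
  rcases s with _ | s
  · simp [fam]
  · rw [if_neg (by omega)]
    exact pivot_congr (hZ s (by omega)) hq hj

/-- The step is a more significant digit than the vector and the coordinate, so all entries of step
s' are stored before any entry of step s is computed. -/
theorem elimIdx_lt {N R p s s' q q' j j' : ℕ} (hs : s' < s) (hq : q' < N) (hj : j' < N) :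
    elimIdx N R p s' q' j' < elimIdx N R p s q j := by
  unfold elimIdx
  have h1 : (p * (R + 1) + s') * N + q' < (p * (R + 1) + s' + 1) * N := by
    rw [add_mul _ 1]; omega
  have h2 : (p * (R + 1) + s' + 1) * N ≤ (p * (R + 1) + s) * N := Nat.mul_le_mul_right _ (by omega)
  have h3 : ((p * (R + 1) + s') * N + q') * N + j' < ((p * (R + 1) + s') * N + q' + 1) * N := by
    rw [add_mul _ 1]; omega
  have h4 := Nat.mul_le_mul_right N (show (p * (R + 1) + s') * N + q' + 1 ≤
    (p * (R + 1) + s) * N + q by omega)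
  omega

theorem elimIdx_lt_size {N R P p s q j : ℕ} (hp : p < P) (hs : s ≤ R) (hq : q < N) (hj : j < N) :
    elimIdx N R p s q j < P * (R + 1) * N * N := by
  -- The digits p and s together act as the step of one long elimination with number 0.
  have h := elimIdx_lt (N := N) (R := R) (p := 0) (s := P * (R + 1)) (s' := p * (R + 1) + s)
    (q := 0) (j := 0) (q' := q) (j' := j) ?_ hq hj
  · simpa [elimIdx] using h
  · have := Nat.mul_le_mul_right (R + 1) (show p + 1 ≤ P by omega)
    rw [add_mul] at this
    omega

section

variable {α : Type} [Ctx α]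

theorem PF4.dot {N : α → ℕ} {a v : α → ℕ → F4} (hN : PF N) (ha : PF4 fun x : α × ℕ => a x.1 x.2)
    (hv : PF4 fun x : α × ℕ => v x.1 x.2) : PF4 fun x => QuantumBCH.dot (N x) (a x) (v x) :=
  PF4.sum (f := fun x j => a x j * v x j) hN (ha.mul hv)

theorem PF.elimIdx {N R p s q j : α → ℕ} (hN : PF N) (hR : PF R) (hp : PF p) (hs : PF s)
    (hq : PF q) (hj : PF j) :
    PF fun x => QuantumBCH.elimIdx (N x) (R x) (p x) (s x) (q x) (j x) :=
  (((((hp.mul (hR.add (PF.const 1))).add hs).mul hN).add hq).mul hN).add hj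

end

theorem PF4.elimEntry (k : Fin 8) {N R : Base → ℕ} {row : Base → ℕ → ℕ → ℕ → F4} (hN : PFB N)
    (hR : PFB R) (hrow : PFB₃ row) {α : Type} [Ctx α] {i : α → ℕ} (hi : PF i) :
    PF4 fun x => QuantumBCH.elimEntry (N (Ctx.base x)) (R (Ctx.base x)) (row (Ctx.base x))
      (fun i => QuantumBCH.dec (Ctx.base x).η ((Ctx.base x).data k i)) (i x) := by
  classical
  -- These facts hold in every context because they are used again below the variables bound by the
  -- pivot search and by the scalar products.
  have hs {β : Type} [Ctx β] {i : β → ℕ} (hi : PF i) :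
      PF fun x => i x / N (Ctx.base x) / N (Ctx.base x) % (R (Ctx.base x) + 1) :=
    ((hi.div (hN β)).div (hN β)).mod ((hR β).add (PF.const 1))
  have hp {β : Type} [Ctx β] {i : β → ℕ} (hi : PF i) :
      PF fun x => i x / N (Ctx.base x) / N (Ctx.base x) / (R (Ctx.base x) + 1) :=
    ((hi.div (hN β)).div (hN β)).div ((hR β).add (PF.const 1))
  have hv {β : Type} [Ctx β] {i q j : β → ℕ} (hi : PF i) (hq : PF q) (hj : PF j) :
      PF4 fun x => QuantumBCH.dec (Ctx.base x).η ((Ctx.base x).data k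
        (elimIdx (N (Ctx.base x)) (R (Ctx.base x))
          (i x / N (Ctx.base x) / N (Ctx.base x) / (R (Ctx.base x) + 1))
          (i x / N (Ctx.base x) / N (Ctx.base x) % (R (Ctx.base x) + 1) - 1) (q x) (j x))) :=
    PF4.dec (PF.rd k (PF.elimIdx (hN β) (hR β) (hp hi) ((hs hi).sub (PF.const 1)) hq hj))
  have hd {β : Type} [Ctx β] {i q : β → ℕ} (hi : PF i) (hq : PF q) :
      PF4 fun x => QuantumBCH.dot (N (Ctx.base x))
        (row (Ctx.base x) (i x / N (Ctx.base x) / N (Ctx.base x) / (R (Ctx.base x) + 1))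
          (i x / N (Ctx.base x) / N (Ctx.base x) % (R (Ctx.base x) + 1) - 1))
        (fun j => QuantumBCH.dec (Ctx.base x).η ((Ctx.base x).data k
        (elimIdx (N (Ctx.base x)) (R (Ctx.base x))
          (i x / N (Ctx.base x) / N (Ctx.base x) / (R (Ctx.base x) + 1))
          (i x / N (Ctx.base x) / N (Ctx.base x) % (R (Ctx.base x) + 1) - 1) (q x) j))) :=
    PF4.dot (hN β) (hrow (β × ℕ) _ _ _ (hp hi.wk) ((hs hi.wk).sub (PF.const 1)) PF.snd)
      (hv hi.wk hq.wk PF.snd)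
  have hpiv := PF.firstIdx (p := fun (x : α) u => ¬ QuantumBCH.dot (N (Ctx.base x))
        (row (Ctx.base x) (i x / N (Ctx.base x) / N (Ctx.base x) / (R (Ctx.base x) + 1))
          (i x / N (Ctx.base x) / N (Ctx.base x) % (R (Ctx.base x) + 1) - 1))
        (fun j => QuantumBCH.dec (Ctx.base x).η ((Ctx.base x).data k
        (elimIdx (N (Ctx.base x)) (R (Ctx.base x))
          (i x / N (Ctx.base x) / N (Ctx.base x) / (R (Ctx.base x) + 1))
          (i x / N (Ctx.base x) / N (Ctx.base x) % (R (Ctx.base x) + 1) - 1) u j))) = 0)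
    (hN α) (hd hi.wk.wk PF.snd).eq_zero.not
  unfold QuantumBCH.elimEntry pivot
  refine PF4.ite (PD.eq (hs hi) (PF.const 0)) (PF4.ite (PD.eq ((hi.div (hN α)).mod (hN α))
    (hi.mod (hN α))) PF4.one PF4.zero) (PF4.add (hv hi ((hi.div (hN α)).mod (hN α))
    (hi.mod (hN α))) (PF4.mul (PF4.mul (hd hi ((hi.div (hN α)).mod (hN α))) ?_) ?_))
  · exact (hd hi hpiv).inv
  · exact hv hi hpiv (hi.mod (hN α))

/-- A program for elimination: `row p s` are the functionals of the elimination with number `p`. -/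
theorem exists_elim (k : Fin 8) {N R P : Base → ℕ} {row : Base → ℕ → ℕ → ℕ → F4} (hN : PFB N)
    (hR : PFB R) (hP : PFB P) (hrow : PFB₃ row) :
    ∃ (s : ℕ) (c : ℕ[X]) (Pr : ℕ → Program), ∀ W : Machine, s ≤ W.S →
      ∀ {η : F4} (hη : η ^ 2 + η + 1 = 0) (D : Fin 8 → ℕ → ℕ) (ψ : QState) (B : ℕ),
      W.Bounded B D → 3 ≤ B →
      (∀ Z, N (W.base hη (Function.update D k Z)) = N (W.base hη D) ∧
        R (W.base hη (Function.update D k Z)) = R (W.base hη D) ∧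
        row (W.base hη (Function.update D k Z)) = row (W.base hη D)) →
      W.RunsD (Pr W.S) (c.eval B) D ψ fun D' ψ' => ψ' = ψ ∧ W.Bounded B D' ∧
        (∀ a ≠ k, D' a = D a) ∧ ∀ p < P (W.base hη D), ∀ q < N (W.base hη D),
          ∀ j < N (W.base hη D),
          dec η (D' k (elimIdx (N (W.base hη D)) (R (W.base hη D)) p (R (W.base hη D)) q j)) =
            fam (N (W.base hη D)) (row (W.base hη D) p) (R (W.base hη D)) q j := by
  obtain ⟨s, c, Pr, h⟩ := exists_tab k
    (((hP Base).mul ((hR Base).add (PF.const 1))).mul (hN Base) |>.mul (hN Base))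
    (PF4.elimEntry k hN hR hrow (PF.snd (α := Base)))
  refine ⟨s, c, Pr, fun W hS η hη D ψ B hB hB3 hind => ?_⟩
  set n := N (W.base hη D)
  set r := R (W.base hη D)
  set rw' := row (W.base hη D)
  -- The intended table: the index is split into its digits p, s, q and j.
  set F : ℕ → ℕ := fun i => enc η (fam n (rw' (i / n / n / (r + 1))) (i / n / n % (r + 1))
    (i / n % n) (i % n)) with hF
  have hFidx : ∀ p s q j, s ≤ r → q < n → j < n →
      F (elimIdx n r p s q j) = enc η (fam n (rw' p) s q j) := by
    intro p s q j hs hq hj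
    have h1 : ((p * (r + 1) + s) * n + q) % n = q := mul_add_mod_of_lt hq
    have h2 : ((p * (r + 1) + s) * n + q) / n = p * (r + 1) + s := mul_add_div_of_lt hq
    have h3 : (p * (r + 1) + s) % (r + 1) = s := mul_add_mod_of_lt (by omega)
    have h4 : (p * (r + 1) + s) / (r + 1) = p := mul_add_div_of_lt (by omega)
    simp only [hF, elimIdx_div hj, elimIdx_mod hj, h1, h2, h3, h4]
  refine (h W hS hη D ψ B F hB ?_).mono le_rfl ?_
  · intro i hi
    refine ⟨by have := enc_lt hη (fam n (rw' (i / n / n / (r + 1))) (i / n / n % (r + 1))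
      (i / n % n) (i % n)); simp only [hF]; omega, ?_⟩
    have hn : 0 < n := by
      rcases Nat.eq_zero_or_pos n with h0 | h0
      · change i < P (W.base hη D) * (r + 1) * n * n at hi
        simp [h0] at hi
      · exact h0
    obtain ⟨p, s, q, j, hs, hq, hj, rfl⟩ : ∃ p s q j, s ≤ r ∧ q < n ∧ j < n ∧
        i = elimIdx n r p s q j := by
      refine ⟨i / n / n / (r + 1), i / n / n % (r + 1), i / n % n, i % n,
        Nat.le_of_lt_succ (Nat.mod_lt _ (by omega)), Nat.mod_lt _ hn, Nat.mod_lt _ hn, ?_⟩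
      rw [elimIdx, Nat.div_add_mod', Nat.div_add_mod', Nat.div_add_mod']
    obtain ⟨e1, e2, e3⟩ := hind fun i' => if i' < elimIdx n r p s q j then F i' else D k i'
    rw [hFidx p s q j hs hq hj]
    change enc η (elimEntry (N (W.base hη (Function.update D k _)))
      (R (W.base hη (Function.update D k _))) (row (W.base hη (Function.update D k _))) _ _) = _
    rw [e1, e2, e3, elimEntry_eq hs hq hj]
    intro s' hs' q' hq' j' hj'
    simp only [Ctx.base, id, Machine.base, Function.update_self]
    rw [if_pos (elimIdx_lt hs' hq' hj'), hFidx p s' q' j' (by omega) hq' hj', dec_enc hη]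
  · rintro D' ψ' ⟨rfl, hB', rfl⟩
    refine ⟨rfl, hB', fun a ha => Function.update_of_ne ha _ _, fun p hp q hq j hj => ?_⟩
    rw [Function.update_self]
    change dec η (if _ < P (W.base hη D) * (r + 1) * n * n then _ else _) = _
    rw [if_pos (elimIdx_lt_size hp le_rfl hq hj), hFidx p r q j le_rfl hq hj,
      dec_enc hη]

/-! ### Gates -/

theorem zmod_two_cases (c : ZMod 2) : c = 0 ∨ c = 1 := by revert c; decide

theorem sign_zero : sign 0 = 1 := by simp [sign]

theorem sign_one : sign 1 = -1 := by simp [sign, ZMod.val_one]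

theorem sign_add (c d : ZMod 2) : sign (c + d) = sign c * sign d := by
  rcases zmod_two_cases c with rfl | rfl <;> rcases zmod_two_cases d with rfl | rfl <;>
  simp [sign_zero, sign_one, CharTwo.add_self_eq_zero]

theorem weyl_apply {n : ℕ} (a b : Fin n → ZMod 2) (φ : Qubits n) (x : Fin n → ZMod 2) :
    weyl a b φ x = sign (b ⬝ᵥ (x - a)) * φ (x - a) := rfl

theorem bitFlip_apply {n : ℕ} (a : Fin n → ZMod 2) (φ : Qubits n) (x : Fin n → ZMod 2) :
    bitFlip a φ x = φ (x - a) := rfl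

theorem phaseFlip_apply {n : ℕ} (b : Fin n → ZMod 2) (φ : Qubits n) (x : Fin n → ZMod 2) :
    phaseFlip b φ x = sign (b ⬝ᵥ x) * φ x := rfl

theorem bitFlip_phaseFlip {n : ℕ} (a b : Fin n → ZMod 2) (φ : Qubits n) :
    bitFlip a (phaseFlip b φ) = weyl a b φ := rfl

/-- The sign arises when V_b is moved past U_c. -/
theorem weyl_weyl {n : ℕ} (a b c d : Fin n → ZMod 2) (φ : Qubits n) :
    weyl a b (weyl c d φ) = sign (b ⬝ᵥ c) • weyl (a + c) (b + d) φ := by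
  funext x
  simp only [weyl_apply, Pi.smul_apply, smul_eq_mul]
  rw [sub_sub, ← mul_assoc, ← mul_assoc, add_dotProduct, sign_add,
    show b ⬝ᵥ (x - a) = b ⬝ᵥ c + b ⬝ᵥ (x - (a + c)) by rw [← dotProduct_add]; congr 1; abel,
    sign_add, mul_assoc (sign (b ⬝ᵥ c))]

theorem weyl_zero {n : ℕ} (φ : Qubits n) : weyl 0 0 φ = φ := by
  funext x; simp [weyl_apply, sign_zero]

open Classical in
/-- The basis vector that belongs to the labelling `w` of the qubits. -/
noncomputable def ket (w : ℕ → ZMod 2) : QState := fun x => if x = w then 1 else 0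

theorem zeroState_eq : zeroState = ket 0 := rfl

theorem tensor_add {n : ℕ} (φ : Qubits n) (χ χ' : QState) :
    tensor φ (χ + χ') = tensor φ χ + tensor φ χ' := by
  funext x; simp [tensor, mul_add]

theorem tensor_smul {n : ℕ} (φ : Qubits n) (c : ℂ) (χ : QState) :
    tensor φ (c • χ) = c • tensor φ χ := by
  funext x; simp [tensor, mul_left_comm]

theorem smul_tensor {n : ℕ} (φ : Qubits n) (c : ℂ) (χ : QState) :
    tensor (c • φ) χ = c • tensor φ χ := by
  funext x; simp [tensor, mul_assoc]

theorem applyH_add (q : ℕ) (ψ ψ' : QState) : applyH q (ψ + ψ') = applyH q ψ + applyH q ψ' := by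
  funext x; simp only [applyH, Pi.add_apply]; ring

theorem applyT_add (q : ℕ) (ψ ψ' : QState) : applyT q (ψ + ψ') = applyT q ψ + applyT q ψ' := by
  funext x; simp only [applyT, Pi.add_apply]; split_ifs <;> ring

theorem applyCNOT_add (c q : ℕ) (ψ ψ' : QState) :
    applyCNOT c q (ψ + ψ') = applyCNOT c q ψ + applyCNOT c q ψ' := by
  funext x; simp only [applyCNOT, Pi.add_apply]; split_ifs <;> rfl

section tensor

variable {n : ℕ} (φ : Qubits n) (χ : QState)

theorem restrict_update_anc (x : ℕ → ZMod 2) (k : ℕ) (v : ZMod 2) :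
    (fun i : Fin n => Function.update x (n + k) v i) = fun i : Fin n => x i := by
  funext i; rw [Function.update_of_ne (by omega)]

theorem shift_update_anc (x : ℕ → ZMod 2) (k : ℕ) (v : ZMod 2) :
    (fun j => Function.update x (n + k) v (n + j)) = Function.update (fun j => x (n + j)) k v := by
  funext j
  by_cases h : j = k
  · subst h; simp
  · rw [Function.update_of_ne h, Function.update_of_ne (by omega)]

theorem restrict_update (x : ℕ → ZMod 2) (i : Fin n) (v : ZMod 2) :
    (fun j : Fin n => Function.update x (i : ℕ) v j) =
      Function.update (fun j : Fin n => x j) i v := by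
  funext j
  by_cases h : j = i
  · subst h; simp
  · rw [Function.update_of_ne h, Function.update_of_ne (by simpa [Fin.ext_iff] using h)]

theorem shift_update (x : ℕ → ZMod 2) (i : Fin n) (v : ZMod 2) :
    (fun j => Function.update x (i : ℕ) v (n + j)) = fun j => x (n + j) := by
  funext j; rw [Function.update_of_ne (by omega)]

theorem applyH_anc (k : ℕ) : applyH (n + k) (tensor φ χ) = tensor φ (applyH k χ) := by
  funext x
  simp only [applyH, tensor, restrict_update_anc, shift_update_anc]
  ring

theorem applyT_anc (k : ℕ) : applyT (n + k) (tensor φ χ) = tensor φ (applyT k χ) := by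
  funext x
  simp only [applyT, tensor]
  split_ifs <;> ring

theorem project_anc (k : ℕ) (b : ZMod 2) :
    project (n + k) b (tensor φ χ) = tensor φ (project k b χ) := by
  funext x
  simp only [project, tensor]
  split_ifs <;> ring

/-- The Hadamard gate on one of `n` qubits. -/
noncomputable def qubitH (i : Fin n) (φ : Qubits n) : Qubits n := fun x =>
  (φ (Function.update x i 0) + sign (x i) * φ (Function.update x i 1)) / (Real.sqrt 2 : ℂ)

theorem applyH_tensor (i : Fin n) : applyH i (tensor φ χ) = tensor (qubitH i φ) χ := by
  funext x
  simp only [applyH, tensor, qubitH, restrict_update, shift_update]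
  ring

theorem applyT_tensor (i : Fin n) : applyT i (tensor φ χ) =
    tensor (fun x => if x i = 1 then Complex.exp (Complex.I * Real.pi / 4) * φ x else φ x) χ := by
  funext x
  simp only [applyT, tensor]
  split_ifs <;> ring

theorem sub_single (x : Fin n → ZMod 2) (i : Fin n) (v : ZMod 2) :
    x - Pi.single i v = Function.update x i (x i + v) := by
  funext j
  by_cases h : j = i
  · subst h; simp [CharTwo.sub_eq_add]
  · simp [h]

/-- The control is a work qubit in a basis state, so the gate acts on the data as a bit flip decided
by a classical bit. -/
theorem applyCNOT_tensor (k : ℕ) (i : Fin n) (w : ℕ → ZMod 2) :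
    applyCNOT (n + k) i (tensor φ (ket w)) = tensor (bitFlip (Pi.single i (w k)) φ) (ket w) := by
  funext x
  simp only [applyCNOT, tensor, restrict_update, shift_update, bitFlip_apply, sub_single]
  rw [if_neg (by omega)]
  by_cases h : (fun j => x (n + j)) = w
  · rw [← h]
  · simp [ket, h]

theorem sqrt_two_mul_self : (Real.sqrt 2 : ℂ) * (Real.sqrt 2 : ℂ) = 2 := by
  rw [← Complex.ofReal_mul, Real.mul_self_sqrt (by norm_num)]; norm_num

theorem qubitH_qubitH (i : Fin n) : qubitH i (qubitH i φ) = φ := by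
  funext x
  have h : φ x = φ (Function.update x i (x i)) := by rw [Function.update_eq_self]
  rw [h]
  simp only [qubitH, Function.update_self, Function.update_idem, sign_zero, sign_one]
  rcases zmod_two_cases (x i) with hx | hx <;> rw [hx] <;> simp only [sign_zero, sign_one] <;>
  field_simp <;> rw [show (Real.sqrt 2 : ℂ) ^ 2 = 2 by rw [sq, sqrt_two_mul_self]] <;>
  ring

/-- Conjugation by the Hadamard gate exchanges bit flips and phase flips. With CNOT this gives
controlled phase flips. -/
theorem qubitH_bitFlip (i : Fin n) (v : ZMod 2) :
    qubitH i (bitFlip (Pi.single i v) (qubitH i φ)) = phaseFlip (Pi.single i v) φ := by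
  funext x
  have h : φ x = φ (Function.update x i (x i)) := by rw [Function.update_eq_self]
  rw [phaseFlip_apply, h]
  simp only [qubitH, bitFlip_apply, sub_single, Function.update_self, Function.update_idem,
    single_dotProduct]
  rcases zmod_two_cases (x i) with hx | hx <;> rcases zmod_two_cases v with hv | hv <;>
  rw [hx, hv] <;>
  simp only [zero_add, add_zero, mul_one, mul_zero, CharTwo.add_self_eq_zero, sign_zero,
    sign_one] <;>
  field_simp <;> rw [show (Real.sqrt 2 : ℂ) ^ 2 = 2 by rw [sq, sqrt_two_mul_self]] <;>
  ring

theorem qubitH_phaseFlip (i : Fin n) (v : ZMod 2) :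
    qubitH i (phaseFlip (Pi.single i v) (qubitH i φ)) = bitFlip (Pi.single i v) φ := by
  rw [← qubitH_bitFlip, qubitH_qubitH, qubitH_qubitH]

end tensor

theorem applyH_ket (k : ℕ) (w : ℕ → ZMod 2) : applyH k (ket w) = (Real.sqrt 2 : ℂ)⁻¹ •
    (ket (Function.update w k 0) + sign (w k) • ket (Function.update w k 1)) := by
  classical
  funext x
  have hk : ∀ u v : ZMod 2, Function.update x k u = Function.update w k v ↔
      u = v ∧ ∀ j ≠ k, x j = w j := by
    intro u v
    constructor
    · intro h
      refine ⟨by simpa using congrFun h k, fun j hj => ?_⟩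
      simpa [hj] using congrFun h j
    · rintro ⟨rfl, h⟩
      funext j
      by_cases hj : j = k
      · subst hj; simp
      · simp [hj, h j hj]
  have hw : w = Function.update w k (w k) := by simp
  have hx : x = Function.update x k (x k) := by simp
  have e1 : ∀ u, Function.update x k u = w ↔ u = w k ∧ ∀ j ≠ k, x j = w j := fun u => by
    rw [← hk u (w k), ← hw]
  have e2 : ∀ v, x = Function.update w k v ↔ x k = v ∧ ∀ j ≠ k, x j = w j := fun v => by
    rw [← hk (x k) v, ← hx]
  have f1 : ∀ u, ket w (Function.update x k u) =
      if u = w k ∧ ∀ j ≠ k, x j = w j then 1 else 0 := fun u => if_congr (e1 u) rfl rfl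
  have f2 : ∀ v, ket (Function.update w k v) x =
      if x k = v ∧ ∀ j ≠ k, x j = w j then 1 else 0 := fun v => if_congr (e2 v) rfl rfl
  simp only [applyH, Pi.smul_apply, Pi.add_apply, smul_eq_mul, f1, f2]
  by_cases h : ∀ j ≠ k, x j = w j
  · rcases zmod_two_cases (x k) with hx | hx <;> rcases zmod_two_cases (w k) with hw | hw <;>
    simp [hx, hw, sign_zero, sign_one, div_eq_mul_inv]
  · simp [h]

theorem applyT_ket (k : ℕ) (w : ℕ → ZMod 2) : applyT k (ket w) =
    (if w k = 1 then Complex.exp (Complex.I * Real.pi / 4) else 1) • ket w := by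
  funext x
  simp only [applyT, ket, Pi.smul_apply, smul_eq_mul]
  by_cases h : x = w
  · subst h; simp
  · simp [h]

theorem project_ket (k : ℕ) (b : ZMod 2) (w : ℕ → ZMod 2) :
    project k b (ket w) = if w k = b then ket w else 0 := by
  funext x
  simp only [project, ket]
  by_cases h : x = w
  · subst h; by_cases h' : x k = b <;> simp [h', ket]
  · by_cases h' : w k = b <;> simp [h, h', ket]

theorem exp_sq : Complex.exp (Complex.I * Real.pi / 4) * Complex.exp (Complex.I * Real.pi / 4) =
    Complex.I := by
  rw [← Complex.exp_add, show Complex.I * Real.pi / 4 + Complex.I * Real.pi / 4 =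
    Real.pi / 2 * Complex.I by ring, Complex.exp_pi_div_two_mul_I]

/-! ### Phase kickback on a work qubit -/

/-- The state with the branches `φ ⊗ |w⟩` and `φ' ⊗ |w'⟩`, where `w'` differs from `w` in that
the value at `k` is `1` instead of `0`. -/
noncomputable def branches {n : ℕ} (k : ℕ) (w : ℕ → ZMod 2) (φ φ' : Qubits n) : QState :=
  tensor φ (ket (Function.update w k 0)) + tensor φ' (ket (Function.update w k 1))

section branches

variable {n : ℕ} (k : ℕ) (w : ℕ → ZMod 2) (φ φ' : Qubits n)

theorem applyH_eq_branches (hw : w k = 0) : applyH (n + k) (tensor φ (ket w)) =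
    branches k w ((Real.sqrt 2 : ℂ)⁻¹ • φ) ((Real.sqrt 2 : ℂ)⁻¹ • φ) := by
  rw [applyH_anc, applyH_ket, hw, sign_zero, one_smul, tensor_smul, tensor_add, branches,
    smul_tensor, smul_tensor, smul_add]

theorem applyT_branches : applyT (n + k) (branches k w φ φ') =
    branches k w φ (Complex.exp (Complex.I * Real.pi / 4) • φ') := by
  rw [branches, applyT_add, applyT_anc, applyT_anc, applyT_ket, applyT_ket]
  simp [branches, tensor_smul, smul_tensor]

theorem applyCNOT_branches (i : Fin n) : applyCNOT (n + k) i (branches k w φ φ') =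
    branches k w φ (bitFlip (Pi.single i 1) φ') := by
  rw [branches, applyCNOT_add, applyCNOT_tensor, applyCNOT_tensor]
  simp only [Function.update_self, Pi.single_zero, branches]
  rw [show bitFlip 0 φ = φ by funext x; simp [bitFlip_apply]]

/-- In the branch with control 0 the two Hadamard gates cancel; in the other branch they conjugate
the bit flip into a phase flip. -/
theorem applyCZ_branches (i : Fin n) :
    applyH i (applyCNOT (n + k) i (applyH i (branches k w φ φ'))) =
    branches k w φ (phaseFlip (Pi.single i 1) φ') := by
  rw [branches, applyH_add, applyH_tensor, applyH_tensor, ← branches, applyCNOT_branches, branches,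
    applyH_add, applyH_tensor, applyH_tensor, qubitH_qubitH, qubitH_bitFlip, branches]

/-- An eigenvalue of the controlled operator appears as the relative phase of the two branches, and
the second Hadamard gate turns this phase into a basis state that holds the eigenvalue bit. The data
qubits are left in φ. -/
theorem applyH_branches (s : ZMod 2) : applyH (n + k) (branches k w ((Real.sqrt 2 : ℂ)⁻¹ • φ)
    ((Real.sqrt 2 : ℂ)⁻¹ • sign s • φ)) = tensor φ (ket (Function.update w k s)) := by
  have h2 : (Real.sqrt 2 : ℂ)⁻¹ * (Real.sqrt 2 : ℂ)⁻¹ = 1 / 2 := by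
    rw [← mul_inv, sqrt_two_mul_self, one_div]
  rw [branches, applyH_add, applyH_anc, applyH_anc, applyH_ket, applyH_ket]
  simp only [Function.update_self, Function.update_idem, sign_zero, sign_one, tensor_smul,
    smul_tensor, tensor_add, smul_smul, smul_add, h2]
  have h3 : (Real.sqrt 2 : ℂ)⁻¹ * -1 * (Real.sqrt 2 : ℂ)⁻¹ = -(1 / 2) := by
    rw [← h2]; ring
  have h4 : (Real.sqrt 2 : ℂ)⁻¹ * -1 * ((Real.sqrt 2 : ℂ)⁻¹ * -1) = 1 / 2 := by
    rw [← h2]; ring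
  rcases zmod_two_cases s with rfl | rfl
  · simp only [sign_zero, mul_one, h2, h3]
    module
  · simp only [sign_one, mul_one, h2, h4]
    rw [← mul_assoc, h2]
    module

end branches

/-! ### Weyl operators, one qubit at a time -/

/-- The first `j` entries of a vector. -/
def trunc {n : ℕ} (c : Fin n → ZMod 2) (j : ℕ) : Fin n → ZMod 2 := fun i => if (i : ℕ) < j then c i else 0

theorem trunc_zero {n : ℕ} (c : Fin n → ZMod 2) : trunc c 0 = 0 := by
  funext i; simp [trunc]

theorem trunc_self {n : ℕ} (c : Fin n → ZMod 2) : trunc c n = c := by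
  funext i; simp [trunc]

theorem trunc_succ {n : ℕ} (c : Fin n → ZMod 2) (i : Fin n) :
    Pi.single i (c i) + trunc c i = trunc c (i + 1) := by
  funext j
  by_cases h : j = i
  · subst h; simp [trunc]
  · have h' : (j : ℕ) ≠ i := fun e => h (Fin.ext e)
    simp only [trunc, Pi.add_apply, Pi.single_eq_of_ne h, zero_add]
    by_cases hlt : (j : ℕ) < i
    · rw [if_pos hlt, if_pos (by omega)]
    · rw [if_neg hlt, if_neg (by omega)]

/-- No sign appears: the truncated vector is 0 at position i, so the new phase flip commutes with
the bit flips applied before. -/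
theorem weyl_trunc_succ {n : ℕ} (c d : Fin n → ZMod 2) (i : Fin n) (φ : Qubits n) :
    bitFlip (Pi.single i (c i)) (phaseFlip (Pi.single i (d i)) (weyl (trunc c i) (trunc d i) φ)) =
      weyl (trunc c (i + 1)) (trunc d (i + 1)) φ := by
  rw [bitFlip_phaseFlip, weyl_weyl, trunc_succ, trunc_succ, single_dotProduct]
  simp [trunc, sign_zero]

theorem bitFlip_single_zero {n : ℕ} (i : Fin n) (φ : Qubits n) :
    bitFlip (Pi.single i (0 : ZMod 2)) φ = φ := by
  funext x; simp [bitFlip_apply]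

theorem phaseFlip_single_zero {n : ℕ} (i : Fin n) (φ : Qubits n) :
    phaseFlip (Pi.single i (0 : ZMod 2)) φ = φ := by
  funext x; simp [phaseFlip_apply, sign_zero]

theorem val_ne_zero_iff (c : ZMod 2) : c.val ≠ 0 ↔ c = 1 := by revert c; decide

theorem val_eq_zero_iff (c : ZMod 2) : c.val = 0 ↔ c = 0 := by revert c; decide

/-- The number of the work qubit for the current value of the counter in register `10`. -/
def anc (S : ℕ) : Expr := .add (.load (.const 0)) (reg S 10)

namespace Machine

variable {W : Machine}

theorem denotes_anc {A : Arrays} {k : ℕ} (hS : 10 < W.S) (h : A 10 0 = k) :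
    W.Denotes (anc W.S) A (W.n + k) := h ▸ denotes_n.add (denotes_reg hS)

/-- The power `diag(1, ι)^m` on a work qubit. -/
theorem runs_phase (hS : 12 < W.S) {A : Arrays} {k m : ℕ} (hk : A 10 0 = k) (hm : A 11 0 = m)
    (w : ℕ → ZMod 2) (φ φ' : Qubits W.n) :
    W.Runs (forLoop W.S 11 12 (.seq (.tgate (anc W.S)) (.tgate (anc W.S)))) (m * (3 + 3) + 3) A
      (branches k w φ φ') fun A' ψ' => (∀ r < 11, A' r = A r) ∧
        ψ' = branches k w φ (Complex.I ^ m • φ') := by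
  refine runs_forLoop (L := m) (by omega) (by omega) (by omega) hm
    (fun j A' ψ' => (∀ r < 11, A' r = A r) ∧ ψ' = branches k w φ (Complex.I ^ j • φ')) ?_ ?_
    (fun _ _ h => h)
  · exact ⟨fun r hr => Arrays.set_of_ne _ _ _ (by omega), by simp⟩
  · rintro j hj A' ψ' ⟨hA, rfl⟩ hlim hctr
    have ha : W.Denotes (anc W.S) A' (W.n + k) := denotes_anc (by omega) (by rw [hA 10 (by omega), hk])
    refine Runs.seq (c₁ := 1) (c₂ := 1) (Mid := fun A'' ψ'' => A'' = A' ∧ ψ'' = applyT (W.n + k)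
      (branches k w φ (Complex.I ^ j • φ'))) (runs_tgate ha ⟨rfl, rfl⟩) ?_
    rintro A'' ψ'' ⟨rfl, rfl⟩
    refine runs_tgate ha ⟨hlim, hctr, fun r hr => ?_, ?_⟩
    · rw [Arrays.set_of_ne _ _ _ (by omega), hA r hr]
    · rw [applyT_branches, applyT_branches, smul_smul, smul_smul, exp_sq, pow_succ']

/-- Application of `U_c V_d`, controlled by a work qubit. -/
theorem runs_controlled {thi tlo : Tm} (hS : 13 + thi.depth + tlo.depth ≤ W.S) {A : Arrays}
    {k B : ℕ} (hA8 : A 8 0 = 0) (hk : A 10 0 = k) (hn : A 11 0 = W.n) (hB : W.Bounded B A.data)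
    (hkB : k ≤ 2 * W.n) {c d : Fin W.n → ZMod 2}
    (hlo : ∀ i : Fin W.n, tlo.den W.inp A.data (vcons i (vcons k fun _ => 0)) = (c i).val)
    (hhi : ∀ i : Fin W.n, thi.den W.inp A.data (vcons i (vcons k fun _ => 0)) = (d i).val)
    (w : ℕ → ZMod 2) (φ φ' : Qubits W.n) :
    W.Runs (forLoop W.S 11 12
      (.seq (thi.compile W.S (vcons 12 (vcons 10 fun _ => 8)) 13)
      (.seq (.ite (reg W.S 13) (.seq (.hadamard (reg W.S 12)) (.seq (.cnot (anc W.S) (reg W.S 12))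
        (.hadamard (reg W.S 12)))) .skip)
      (.seq (tlo.compile W.S (vcons 12 (vcons 10 fun _ => 8)) 13)
      (.ite (reg W.S 13) (.cnot (anc W.S) (reg W.S 12)) .skip)))))
      (W.n * ((thi.cost.eval (3 * B) + (6 + (tlo.cost.eval (3 * B) + 2 + 1) + 1) + 1) + 3) + 3) A
      (branches k w φ φ') fun A' ψ' => (∀ r < 11, A' r = A r) ∧
        ψ' = branches k w φ (weyl c d φ') := by
  have hp := thi.depth_pos
  have hp' := tlo.depth_pos
  have hnB : W.n ≤ B := W.inp_zero ▸ hB.1 0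
  refine runs_forLoop (L := W.n) (by omega) (by omega) (by omega) hn
    (fun j A' ψ' => (∀ r < 11, A' r = A r) ∧
      ψ' = branches k w φ (weyl (trunc c j) (trunc d j) φ')) ?_ ?_ ?_
  · exact ⟨fun r hr => Arrays.set_of_ne _ _ _ (by omega), by rw [trunc_zero, trunc_zero, weyl_zero]⟩
  · rintro j hj A₁ ψ₁ ⟨hA₁, rfl⟩ hlim hctr
    have hcomp : ∀ (t : Tm) (A' : Arrays) (ψ : QState), 13 + t.depth ≤ W.S →
        (∀ r < 13, A' r = A₁ r) →
        W.Runs (t.compile W.S (vcons 12 (vcons 10 fun _ => 8)) 13) (t.cost.eval (3 * B)) A' ψ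
        fun A'' ψ' => ψ' = ψ ∧ (∀ r < 13, A'' r = A₁ r) ∧
          A'' 13 0 = t.den W.inp A.data (vcons j (vcons k fun _ => 0)) := by
      intro t A' ψ ht hA'
      have hv : (fun i => A' (vcons 12 (vcons 10 fun _ => 8) i) 0) = vcons j (vcons k fun _ => 0) := by
        funext i
        rcases i with _ | _ | i
        · simp only [vcons]; rw [hA' 12 (by omega), hctr]
        · simp only [vcons]; rw [hA' 10 (by omega), hA₁ 10 (by omega), hk]
        · simp only [vcons]; rw [hA' 8 (by omega), hA₁ 8 (by omega), hA8]
      have hdat : A'.data = A.data := Arrays.data_congr (d := 11) (by omega)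
        fun r hr => (hA' r (by omega)).trans (hA₁ r hr)
      -- The generator number is a variable of the term and is only bounded by 2n; hence the bound
      -- 3B.
      refine (runs_compile t (B := 3 * B) ?_ (by omega) (by omega)
        (fun i => (hB.1 i).trans (by omega))
        (fun a i => hdat ▸ (hB.2 a i).trans (by omega)) ?_).mono le_rfl ?_
      · rintro (_ | _ | i) <;> simp [vcons]
      · intro i
        rw [congrFun hv i]
        rcases i with _ | _ | i <;> simp only [vcons] <;> omega
      · rintro A'' ψ' ⟨rfl, h1, h2⟩
        exact ⟨rfl, fun r hr => (h1 r hr).trans (hA' r hr), by rw [h2, hv, hdat]⟩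
    have hden : ∀ A' : Arrays, (∀ r < 13, A' r = A₁ r) → W.Denotes (anc W.S) A' (W.n + k) ∧
        W.Denotes (reg W.S 12) A' j := fun A' hA' =>
      ⟨denotes_anc (by omega) (by rw [hA' 10 (by omega), hA₁ 10 (by omega), hk]),
        fun M hM => (denotes_reg (by omega) M hM).trans (by rw [hA' 12 (by omega), hctr])⟩
    refine (hcomp thi A₁ _ (by omega) fun _ _ => rfl).seq ?_
    rintro A₂ ψ₂ ⟨rfl, hA₂, h13⟩
    rw [hhi ⟨j, hj⟩] at h13
    have r13 : W.Denotes (reg W.S 13) A₂ _ := denotes_reg (by omega)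
    rw [h13] at r13
    -- The phase flip comes before the bit flip because U_c V_d applies V_d first.
    refine Runs.seq (c₁ := 6) (Mid := fun A' ψ' => (∀ r < 13, A' r = A₁ r) ∧ ψ' =
      branches k w φ (phaseFlip (Pi.single ⟨j, hj⟩ (d ⟨j, hj⟩))
        (weyl (trunc c j) (trunc d j) φ'))) ?_ ?_
    · refine runs_ite (c := 5) r13 (fun h => ?_) (fun h => ?_)
      · rw [(val_ne_zero_iff _).1 h]
        obtain ⟨h1, h2⟩ := hden A₂ hA₂
        refine Runs.seq (c₁ := 1) (c₂ := 3) (Mid := fun A' ψ' => A' = A₂ ∧ ψ' = applyH j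
          (branches k w φ (weyl (trunc c j) (trunc d j) φ'))) (runs_hadamard h2 ⟨rfl, rfl⟩) ?_
        rintro A₃ ψ₃ ⟨rfl, rfl⟩
        refine Runs.seq (c₁ := 1) (c₂ := 1) (Mid := fun A' ψ' => A' = A₃ ∧ ψ' =
          applyCNOT (W.n + k) j (applyH j (branches k w φ (weyl (trunc c j) (trunc d j) φ'))))
          (runs_cnot h1 h2 ⟨rfl, rfl⟩) ?_
        rintro A₄ ψ₄ ⟨rfl, rfl⟩
        exact runs_hadamard h2 ⟨hA₂, applyCZ_branches k w φ _ ⟨j, hj⟩⟩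
      · rw [(val_eq_zero_iff _).1 h, phaseFlip_single_zero]
        exact (runs_skip ⟨hA₂, rfl⟩).mono (by omega) fun _ _ h => h
    rintro A₃ ψ₃ ⟨hA₃, rfl⟩
    refine (hcomp tlo A₃ _ (by omega) hA₃).seq ?_
    rintro A₄ ψ₄ ⟨rfl, hA₄, h13⟩
    rw [hlo ⟨j, hj⟩] at h13
    have r13 : W.Denotes (reg W.S 13) A₄ _ := denotes_reg (by omega)
    rw [h13] at r13
    obtain ⟨h1, h2⟩ := hden A₄ hA₄
    have hfin : ∀ ψ', ψ' = branches k w φ (bitFlip (Pi.single ⟨j, hj⟩ (c ⟨j, hj⟩))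
        (phaseFlip (Pi.single ⟨j, hj⟩ (d ⟨j, hj⟩)) (weyl (trunc c j) (trunc d j) φ'))) →
        A₄ 11 0 = W.n ∧ A₄ 12 0 = j ∧ (∀ r < 11, A₄.set 12 0 (j + 1) r = A r) ∧
        ψ' = branches k w φ (weyl (trunc c (j + 1)) (trunc d (j + 1)) φ') := by
      rintro ψ' rfl
      refine ⟨by rw [hA₄ 11 (by omega), hlim], by rw [hA₄ 12 (by omega), hctr], fun r hr => ?_, ?_⟩
      · rw [Arrays.set_of_ne _ _ _ (by omega), hA₄ r (by omega), hA₁ r hr]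
      · rw [← weyl_trunc_succ c d ⟨j, hj⟩ φ']
    refine runs_ite (c := 1) r13 (fun h => ?_) (fun h => ?_)
    · refine runs_cnot h1 h2 (hfin _ ?_)
      rw [(val_ne_zero_iff _).1 h]
      exact applyCNOT_branches k w φ _ ⟨j, hj⟩
    · refine runs_skip (hfin _ ?_)
      rw [(val_eq_zero_iff _).1 h, bitFlip_single_zero]
  · rintro A' ψ' ⟨hA', rfl⟩
    exact ⟨hA', by rw [trunc_self, trunc_self]⟩

end Machine

/-! ### Measuring the stabiliser generators -/

/-- The program that measures the operators `ι^(ph k) U_(c k) V_(d k)` for `k < 2 n`. -/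
theorem exists_measure : ∃ (s : ℕ) (C : ℕ[X]) (P : ℕ → Program), ∀ W : Machine, s ≤ W.S →
    ∀ {η : F4} (_ : η ^ 2 + η + 1 = 0) (D : Fin 8 → ℕ → ℕ) (B : ℕ) (φ : Qubits W.n) (c d : ℕ → Fin W.n → ZMod 2) (σ : ℕ → ZMod 2),
    W.Bounded B D → 1 ≤ B →
    (∀ k < 2 * W.n, ∀ i : Fin W.n, D 0 (k * W.n + i) % 2 = (c k i).val ∧
      D 0 (k * W.n + i) / 2 = (d k i).val) →
    (∀ k < 2 * W.n, Complex.I ^ W.inp (3 * W.n + 4 + k) • weyl (c k) (d k) φ = sign (σ k) • φ) →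
    W.RunsD (P W.S) (C.eval B) D (tensor φ (ket 0)) fun D' ψ' => (∃ w, ψ' = tensor φ (ket w)) ∧
      W.Bounded B D' ∧
      D' = Function.update D 1 fun k => if k < 2 * W.n then (σ k).val else D 1 k := by
  obtain ⟨thi, hthi⟩ : PF fun x : (Base × ℕ) × ℕ => (Ctx.base x).data 0
      (x.1.2 * (Ctx.base x).inp 0 + x.2) / 2 :=
    (PF.rd 0 ((PF.snd.wk.mul (PF.inp (PF.const 0))).add PF.snd)).div (PF.const 2)
  obtain ⟨tlo, htlo⟩ : PF fun x : (Base × ℕ) × ℕ => (Ctx.base x).data 0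
      (x.1.2 * (Ctx.base x).inp 0 + x.2) % 2 :=
    (PF.rd 0 ((PF.snd.wk.mul (PF.inp (PF.const 0))).add PF.snd)).mod (PF.const 2)
  obtain ⟨tph, htph⟩ : PF fun x : Base × ℕ => (Ctx.base x).inp
      (3 * (Ctx.base x).inp 0 + 4 + x.2) :=
    PF.inp ((((PF.const 3).mul (PF.inp (PF.const 0))).add (PF.const 4)).add PF.snd)
  set K : ℕ[X] := thi.cost.comp (3 * X) + (6 + (tlo.cost.comp (3 * X) + 2 + 1) + 1) + 1 with hK
  set Cb : ℕ[X] := 1 + (tph.cost.comp (3 * X) + ((X * (3 + 3) + 3) + (1 + ((X * (K + 3) + 3) +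
    (1 + 1 + 1) + 1) + 1) + 1) + 1) + 1 with hCb
  refine ⟨13 + thi.depth + tlo.depth + tph.depth, 1 + (2 * X * (Cb + 3) + 3) + 1, fun S =>
    .seq (.assign (addr S 9 (.const 0)) (.add (.load (.const 0)) (.load (.const 0))))
    (Machine.forLoop S 9 10 (.seq (.hadamard (anc S))
    (.seq (tph.compile S (vcons 10 fun _ => 8) 11)
    (.seq (Machine.forLoop S 11 12 (.seq (.tgate (anc S)) (.tgate (anc S))))
    (.seq (.assign (addr S 11 (.const 0)) (.load (.const 0)))
    (.seq (Machine.forLoop S 11 12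
      (.seq (thi.compile S (vcons 12 (vcons 10 fun _ => 8)) 13)
      (.seq (.ite (reg S 13) (.seq (.hadamard (reg S 12)) (.seq (.cnot (anc S) (reg S 12))
        (.hadamard (reg S 12)))) .skip)
      (.seq (tlo.compile S (vcons 12 (vcons 10 fun _ => 8)) 13)
      (.ite (reg S 13) (.cnot (anc S) (reg S 12)) .skip)))))
    (.seq (.hadamard (anc S)) (.measure (anc S) (addr S 1 (reg S 10)))))))))), ?_⟩
  intro W hS η hη D B φ c d σ hB hB1 hcd hσ A hA h8
  have hp := thi.depth_pos
  have hp' := tlo.depth_pos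
  have hp'' := tph.depth_pos
  have hnB : W.n ≤ B := W.inp_zero ▸ hB.1 0
  set G : ℕ → Fin 8 → ℕ → ℕ :=
    fun j => Function.update D 1 fun k => if k < j then (σ k).val else D 1 k with hG
  have hGB : ∀ j, W.Bounded B (G j) := by
    refine fun j => ⟨hB.1, fun a i => ?_⟩
    by_cases ha : a = 1
    · subst ha
      simp only [hG, Function.update_self]
      split_ifs
      · have := ZMod.val_lt (σ i); omega
      · exact hB.2 _ _
    · simp only [hG, Function.update_of_ne ha]; exact hB.2 _ _
  have hG0 : ∀ j, G j 0 = D 0 := fun j => Function.update_of_ne (by decide) _ _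
  have hCbv : Cb.eval B = 1 + (tph.cost.eval (3 * B) + ((B * (3 + 3) + 3) + (1 +
      ((B * (K.eval B + 3) + 3) + (1 + 1 + 1) + 1) + 1) + 1) + 1) + 1 := by
    simp [hCb, eval_comp]
  have hKv : K.eval B = thi.cost.eval (3 * B) + (6 + (tlo.cost.eval (3 * B) + 2 + 1) + 1) + 1 := by
    simp [hK, eval_comp]
  have hn : ∀ A : Arrays, W.Denotes (.load (.const 0)) A W.n := fun _ => Machine.denotes_n
  refine Machine.Runs.mono (c := 1 + (2 * W.n * (Cb.eval B + 3) + 3) + 1)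
    (Machine.Runs.seq (Mid := fun A' ψ' => A' = A.set 9 0 (W.n + W.n) ∧ ψ' = tensor φ (ket 0))
      (Machine.runs_assign_reg (by omega) ((hn A).add (hn A)) ⟨rfl, rfl⟩)
      ?_) ?_ fun _ _ h => h
  · rintro A₀ ψ₀ ⟨rfl, rfl⟩
    -- Round k uses work qubit k. The invariant records that the work qubits from k on are still 0
    -- and that the register remains a product state.
    refine Machine.runs_forLoop (L := 2 * W.n) (by omega) (by omega) (by omega) ?_
      (fun k A' ψ' => A' 8 0 = 0 ∧ A'.data = G k ∧
        ∃ w : ℕ → ZMod 2, (∀ j, k ≤ j → w j = 0) ∧ ψ' = tensor φ (ket w)) ?_ ?_ ?_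
    · rw [Arrays.set_self]; ring
    · refine ⟨?_, ?_, 0, fun _ _ => rfl, rfl⟩
      · rw [Arrays.set_of_ne _ _ _ (by omega), Arrays.set_of_ne _ _ _ (by omega), h8]
      · rw [Arrays.data_congr (d := 9) (A := A) (by omega), hA]
        · simp [hG]
        · intro r hr
          rw [Arrays.set_of_ne _ _ _ (by omega), Arrays.set_of_ne _ _ _ (by omega)]
    · rintro k hk A₁ ψ₁ ⟨h8₁, hD₁, w, hw, rfl⟩ hlim hctr
      have hfr : ∀ A' : Arrays, (∀ r < 11, A' r = A₁ r) → A' 8 0 = 0 ∧ A'.data = G k ∧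
          A' 9 0 = 2 * W.n ∧ A' 10 0 = k ∧ W.Denotes (anc W.S) A' (W.n + k) := fun A' h =>
        ⟨by rw [h 8 (by omega), h8₁], by rw [Arrays.data_congr (d := 11) (by omega) h, hD₁],
          by rw [h 9 (by omega), hlim], by rw [h 10 (by omega), hctr],
          Machine.denotes_anc (by omega) (by rw [h 10 (by omega), hctr])⟩
      rw [hCbv]
      set φ' := (Real.sqrt 2 : ℂ)⁻¹ • φ
      refine Machine.Runs.seq (Mid := fun A' ψ' => A' = A₁ ∧ ψ' = branches k w φ' φ')
        (Machine.runs_hadamard (hfr A₁ fun _ _ => rfl).2.2.2.2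
          ⟨rfl, applyH_eq_branches k w φ (hw k le_rfl)⟩) ?_
      rintro A₂ ψ₂ ⟨rfl, rfl⟩
      have hv : (fun i => A₂ (vcons 10 (fun _ => 8) i) 0) = vcons k fun _ => 0 := by
        funext i; rcases i with _ | i
        · exact hctr
        · exact h8₁
      refine (Machine.runs_compile tph (d := 11) (B := 3 * B) ?_ (by omega) (by omega)
        (fun i => (hB.1 i).trans (by omega))
        (fun a i => hD₁ ▸ ((hGB k).2 a i).trans (by omega)) ?_).seq ?_
      · rintro (_ | i) <;> simp [vcons]
      · intro i
        rw [congrFun hv i]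
        rcases i with _ | i <;> simp only [vcons] <;> omega
      rintro A₃ ψ₃ ⟨rfl, hA₃, h11⟩
      -- In the input the phases start at 3n + 4 = 1 + 3(n + 1), after the length and three lists of
      -- n + 1 coefficient bits.
      rw [hv, hD₁, show tph.den W.inp (G k) (vcons k fun _ => 0) = W.inp (3 * W.n + 4 + k) from
        (htph (W.base hη (G k), k)).trans (by simp [Ctx.base, Machine.base, W.inp_zero])] at h11
      refine Machine.Runs.seq (c₁ := B * (3 + 3) + 3) ((Machine.runs_phase (by omega)
        (hfr A₃ hA₃).2.2.2.1 h11 w φ' φ').mono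
        (by have := Nat.mul_le_mul_right (3 + 3) (hB.1 (3 * W.n + 4 + k)); omega)
        fun _ _ h => h) ?_
      rintro A₄ ψ₄ ⟨hA₄, rfl⟩
      have hA₄ : ∀ r < 11, A₄ r = A₂ r := fun r hr => (hA₄ r hr).trans (hA₃ r hr)
      refine Machine.Runs.seq (c₁ := 1) (Mid := fun A' ψ' => A' = A₄.set 11 0 W.n ∧ ψ' =
        branches k w φ' (Complex.I ^ W.inp (3 * W.n + 4 + k) • φ'))
        (Machine.runs_assign_reg (by omega) (hn A₄) ⟨rfl, rfl⟩) ?_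
      rintro A₅ ψ₅ ⟨hA₅', rfl⟩
      have hA₅ : ∀ r < 11, A₅ r = A₂ r := fun r hr => by
        rw [hA₅', Arrays.set_of_ne _ _ _ (by omega), hA₄ r hr]
      obtain ⟨e8, eD, e9, e10, -⟩ := hfr A₅ hA₅
      refine Machine.Runs.seq (c₁ := B * (K.eval B + 3) + 3) (c₂ := 1 + 1 + 1)
        ((Machine.runs_controlled (thi := thi) (tlo := tlo) (B := B) (c := c k) (d := d k) (by omega)
        e8 e10 (by rw [hA₅', Arrays.set_self]) (eD ▸ hGB k) hk.le ?_ ?_ w φ' _).mono ?_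
        fun _ _ h => h) ?_
      · intro i
        rw [eD, ← (hcd k hk i).1, ← hG0 k]
        exact (htlo ((W.base hη (G k), k), i)).trans (by simp [Ctx.base, Machine.base, W.inp_zero])
      · intro i
        rw [eD, ← (hcd k hk i).2, ← hG0 k]
        exact (hthi ((W.base hη (G k), k), i)).trans (by simp [Ctx.base, Machine.base, W.inp_zero])
      · rw [hKv]
        exact Nat.add_le_add_right (Nat.mul_le_mul_right _ hnB) _
      rintro A₆ ψ₆ ⟨hA₆, rfl⟩
      have hA₆ : ∀ r < 11, A₆ r = A₂ r := fun r hr => (hA₆ r hr).trans (hA₅ r hr)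
      obtain ⟨f8, fD, f9, f10, fa⟩ := hfr A₆ hA₆
      -- By hypothesis the operator with its phase acts on φ as the sign of σ k, so kickback writes
      -- σ k to the work qubit.
      have hst : applyH (W.n + k) (branches k w φ' (weyl (c k) (d k)
          (Complex.I ^ W.inp (3 * W.n + 4 + k) • φ'))) =
          tensor φ (ket (Function.update w k (σ k))) := by
        rw [← applyH_branches k w φ (σ k), ← hσ k hk]
        simp only [φ', map_smul]
        rw [smul_comm]
      refine Machine.Runs.seq (c₁ := 1) (c₂ := 1) (Mid := fun A' ψ' => A' = A₆ ∧ ψ' =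
        tensor φ (ket (Function.update w k (σ k)))) (Machine.runs_hadamard fa ⟨rfl, hst⟩) ?_
      rintro A₇ ψ₇ ⟨rfl, rfl⟩
      have r10 : W.Denotes (reg W.S 10) A₇ _ := Machine.denotes_reg (by omega)
      rw [f10] at r10
      refine Machine.runs_measure (by omega) fa r10 fun b hb => ?_
      rw [project_anc, project_ket, Function.update_self] at hb ⊢
      -- The other outcome has zero amplitude. The measurement therefore neither branches nor
      -- changes the state.
      have hbσ : σ k = b := by
        by_contra h
        apply hb
        rw [if_neg h]
        funext x; simp [tensor]
      subst hbσ
      rw [if_pos rfl]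
      refine ⟨?_, ?_, ?_, ?_, Function.update w k (σ k), fun j hj => ?_, rfl⟩
      · rw [Arrays.set_of_ne _ _ _ (by omega), f9]
      · rw [Arrays.set_of_ne _ _ _ (by omega), f10]
      · rw [Arrays.set_of_ne _ _ _ (by omega), Arrays.set_of_ne _ _ _ (by omega), f8]
      · rw [Arrays.data_congr (d := 10) (A := A₇.set 1 k (σ k).val) (by omega)
          (fun r hr => Arrays.set_of_ne _ _ _ (by omega))]
        have := A₇.data_set 1 k (σ k).val
        refine this.trans ?_
        rw [fD]
        simp only [hG, Function.update_idem, Function.update_self]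
        congr 1
        funext i
        by_cases hi : i = k
        · subst hi; simp
        · rw [Function.update_of_ne hi]
          by_cases h : i < k
          · simp [h, h.trans (Nat.lt_succ_self k)]
          · have : ¬ i < k + 1 := by omega
            simp [h, this]
      · rw [Function.update_of_ne (by omega), hw j (by omega)]
    · rintro A' ψ' ⟨h8', hD', w, -, rfl⟩
      exact ⟨h8', ⟨w, rfl⟩, hD' ▸ hGB _, hD'⟩
  · simp only [eval_add, eval_mul, eval_X, eval_ofNat, eval_one]
    have := Nat.mul_le_mul_right (Cb.eval B + 3) (Nat.mul_le_mul_left 2 hnB)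
    omega

/-- T⁴ is diag(1, -1), so phase flips need no further gate. -/
theorem applyT_four {n : ℕ} (i : Fin n) (φ : Qubits n) (χ : QState) :
    applyT i (applyT i (applyT i (applyT i (tensor φ χ)))) =
      tensor (phaseFlip (Pi.single i 1) φ) χ := by
  simp only [applyT_tensor]
  congr 1
  funext x
  rw [phaseFlip_apply, single_dotProduct]
  rcases zmod_two_cases (x i) with h | h
  · simp [h, sign_zero]
  · simp only [h, if_true, mul_one, sign_one]
    rw [← mul_assoc, exp_sq, ← mul_assoc, ← mul_assoc, mul_assoc Complex.I, exp_sq, Complex.I_mul_I]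

/-- The program for the gate `diag(1, -1)` on qubit `q`. -/
def fourT (q : Expr) : Program := .seq (.tgate q) (.seq (.tgate q) (.seq (.tgate q) (.tgate q)))

theorem Machine.runs_fourT {W : Machine} {A : Arrays} {e : Expr} (i : Fin W.n)
    (he : W.Denotes e A i) (φ : Qubits W.n) (χ : QState) :
    W.Runs (fourT e) 7 A (tensor φ χ) fun A' ψ' =>
      A' = A ∧ ψ' = tensor (phaseFlip (Pi.single i 1) φ) χ := by
  refine Runs.seq (c₁ := 1) (c₂ := 5) (Mid := fun A' ψ' => A' = A ∧ ψ' = applyT i (tensor φ χ))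
    (runs_tgate he ⟨rfl, rfl⟩) ?_
  rintro A _ ⟨rfl, rfl⟩
  refine Runs.seq (c₁ := 1) (c₂ := 3) (Mid := fun A' ψ' => A' = A ∧
    ψ' = applyT i (applyT i (tensor φ χ))) (runs_tgate he ⟨rfl, rfl⟩) ?_
  rintro A _ ⟨rfl, rfl⟩
  refine Runs.seq (c₁ := 1) (c₂ := 1) (Mid := fun A' ψ' => A' = A ∧
    ψ' = applyT i (applyT i (applyT i (tensor φ χ)))) (runs_tgate he ⟨rfl, rfl⟩) ?_
  rintro A _ ⟨rfl, rfl⟩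
  exact runs_tgate he ⟨rfl, applyT_four i φ χ⟩

/-- The program that applies `U_c V_d` for the vectors that are stored in array `7`. -/
theorem exists_correction : ∃ (s : ℕ) (C : ℕ[X]) (P : ℕ → Program), ∀ W : Machine, s ≤ W.S →
    ∀ {η : F4} (_ : η ^ 2 + η + 1 = 0) (D : Fin 8 → ℕ → ℕ) (B : ℕ) (φ : Qubits W.n) (χ : QState)
    (c d : Fin W.n → ZMod 2), W.Bounded B D →
    (∀ i : Fin W.n, D 7 i % 2 = (c i).val ∧ D 7 i / 2 = (d i).val) →
    W.RunsD (P W.S) (C.eval B) D (tensor φ χ) fun _ ψ' => ψ' = tensor (weyl c d φ) χ := by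
  obtain ⟨thi, hthi⟩ : PF fun x : Base × ℕ => (Ctx.base x).data 7 x.2 / 2 :=
    (PF.rd 7 PF.snd).div (PF.const 2)
  obtain ⟨tlo, htlo⟩ : PF fun x : Base × ℕ => (Ctx.base x).data 7 x.2 % 2 :=
    (PF.rd 7 PF.snd).mod (PF.const 2)
  refine ⟨11 + thi.depth + tlo.depth, 1 + (X * ((thi.cost + (8 + (tlo.cost + 12 + 1) + 1) + 1) + 3)
    + 3) + 1, fun S => .seq (.assign (addr S 9 (.const 0)) (.load (.const 0)))
    (Machine.forLoop S 9 10 (.seq (thi.compile S (vcons 10 fun _ => 8) 11)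
      (.seq (.ite (reg S 11) (fourT (reg S 10)) .skip)
      (.seq (tlo.compile S (vcons 10 fun _ => 8) 11)
      (.ite (reg S 11) (.seq (.hadamard (reg S 10)) (.seq (fourT (reg S 10))
        (.hadamard (reg S 10)))) .skip))))), ?_⟩
  intro W hS η hη D B φ χ c d hB hcd A hA h8
  have hp := thi.depth_pos
  have hp' := tlo.depth_pos
  have hnB : W.n ≤ B := W.inp_zero ▸ hB.1 0
  refine Machine.Runs.mono (c := 1 + (W.n * ((thi.cost.eval B + (8 + (tlo.cost.eval B + 12 + 1) + 1)
    + 1) + 3) + 3) + 1)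
    (Machine.Runs.seq (Mid := fun A' ψ' => A' = A.set 9 0 W.n ∧ ψ' = tensor φ χ)
      (Machine.runs_assign_reg (by omega) Machine.denotes_n ⟨rfl, rfl⟩)
      ?_) ?_ fun _ _ h => h
  · rintro A₀ ψ₀ ⟨rfl, rfl⟩
    refine Machine.runs_forLoop (L := W.n) (by omega) (by omega) (by omega) (Arrays.set_self _ _ _ _)
      (fun j A' ψ' => A' 8 0 = 0 ∧ A'.data = D ∧
        ψ' = tensor (weyl (trunc c j) (trunc d j) φ) χ) ?_ ?_ ?_
    · refine ⟨?_, ?_, by rw [trunc_zero, trunc_zero, weyl_zero]⟩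
      · rw [Arrays.set_of_ne _ _ _ (by omega), Arrays.set_of_ne _ _ _ (by omega), h8]
      · rw [Arrays.data_congr (d := 9) (A := A) (by omega), hA]
        intro r hr
        rw [Arrays.set_of_ne _ _ _ (by omega), Arrays.set_of_ne _ _ _ (by omega)]
    · rintro j hj A₁ ψ₁ ⟨h8₁, hD₁, rfl⟩ hlim hctr
      have hcomp : ∀ (t : Tm) (A' : Arrays) (ψ : QState), 11 + t.depth ≤ W.S →
          (∀ r < 11, A' r = A₁ r) →
          W.Runs (t.compile W.S (vcons 10 fun _ => 8) 11) (t.cost.eval B) A' ψ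
          fun A'' ψ' => ψ' = ψ ∧ (∀ r < 11, A'' r = A₁ r) ∧
            A'' 11 0 = t.den W.inp D (vcons j fun _ => 0) := by
        intro t A' ψ ht hA'
        have hv : (fun i => A' (vcons 10 (fun _ => 8) i) 0) = vcons j fun _ => 0 := by
          funext i
          rcases i with _ | i
          · simp only [vcons]; rw [hA' 10 (by omega), hctr]
          · simp only [vcons]; rw [hA' 8 (by omega), h8₁]
        have hdat : A'.data = D := (Arrays.data_congr (d := 11) (by omega) hA').trans hD₁
        refine (Machine.runs_compile t (B := B) ?_ (by omega) (by omega) hB.1 (hdat ▸ hB.2)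
          ?_).mono le_rfl ?_
        · rintro (_ | i) <;> simp [vcons]
        · intro i
          rw [congrFun hv i]
          rcases i with _ | i <;> simp only [vcons] <;> omega
        · rintro A'' ψ' ⟨rfl, h1, h2⟩
          exact ⟨rfl, fun r hr => (h1 r hr).trans (hA' r hr), by rw [h2, hv, hdat]⟩
      have hden : ∀ A' : Arrays, (∀ r < 11, A' r = A₁ r) → W.Denotes (reg W.S 10) A' j :=
        fun A' hA' M hM => (Machine.denotes_reg (by omega) M hM).trans
          (by rw [hA' 10 (by omega), hctr])
      refine (hcomp thi A₁ _ (by omega) fun _ _ => rfl).seq ?_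
      rintro A₂ ψ₂ ⟨rfl, hA₂, h11⟩
      rw [show thi.den W.inp D (vcons j fun _ => 0) = (d ⟨j, hj⟩).val from
        (hthi (W.base hη D, j)).trans (hcd ⟨j, hj⟩).2] at h11
      have r11 : W.Denotes (reg W.S 11) A₂ _ := Machine.denotes_reg (by omega)
      rw [h11] at r11
      refine Machine.Runs.seq (c₁ := 8) (Mid := fun A' ψ' => (∀ r < 11, A' r = A₁ r) ∧ ψ' =
        tensor (phaseFlip (Pi.single ⟨j, hj⟩ (d ⟨j, hj⟩))
          (weyl (trunc c j) (trunc d j) φ)) χ) ?_ ?_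
      · refine Machine.runs_ite (c := 7) r11 (fun h => ?_) (fun h => ?_)
        · rw [(val_ne_zero_iff _).1 h]
          refine (Machine.runs_fourT ⟨j, hj⟩ (hden A₂ hA₂) _ χ).mono le_rfl ?_
          rintro _ _ ⟨rfl, rfl⟩
          exact ⟨hA₂, rfl⟩
        · rw [(val_eq_zero_iff _).1 h, phaseFlip_single_zero]
          exact (Machine.runs_skip ⟨hA₂, rfl⟩).mono (by omega) fun _ _ h => h
      rintro A₃ ψ₃ ⟨hA₃, rfl⟩
      refine (hcomp tlo A₃ _ (by omega) hA₃).seq ?_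
      rintro A₄ ψ₄ ⟨rfl, hA₄, h11⟩
      rw [show tlo.den W.inp D (vcons j fun _ => 0) = (c ⟨j, hj⟩).val from
        (htlo (W.base hη D, j)).trans (hcd ⟨j, hj⟩).1] at h11
      have r11 : W.Denotes (reg W.S 11) A₄ _ := Machine.denotes_reg (by omega)
      rw [h11] at r11
      have h10 := hden A₄ hA₄
      have hfin : ∀ ψ', ψ' = tensor (bitFlip (Pi.single ⟨j, hj⟩ (c ⟨j, hj⟩))
          (phaseFlip (Pi.single ⟨j, hj⟩ (d ⟨j, hj⟩)) (weyl (trunc c j) (trunc d j) φ))) χ →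
          A₄ 9 0 = W.n ∧ A₄ 10 0 = j ∧ A₄.set 10 0 (j + 1) 8 0 = 0 ∧
          (A₄.set 10 0 (j + 1)).data = D ∧
          ψ' = tensor (weyl (trunc c (j + 1)) (trunc d (j + 1)) φ) χ := by
        rintro ψ' rfl
        refine ⟨by rw [hA₄ 9 (by omega), hlim], by rw [hA₄ 10 (by omega), hctr], ?_, ?_, ?_⟩
        · rw [Arrays.set_of_ne _ _ _ (by omega), hA₄ 8 (by omega), h8₁]
        · rw [Arrays.data_congr (d := 10) (A := A₄) (by omega)
            (fun r hr => Arrays.set_of_ne _ _ _ (by omega)), Arrays.data_congr (d := 11) (by omega) hA₄,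
            hD₁]
        · rw [← weyl_trunc_succ c d ⟨j, hj⟩ φ]
      -- The bit flip is performed as H T⁴ H.
      refine Machine.runs_ite (c := 11) r11 (fun h => ?_) (fun h => ?_)
      · refine Machine.Runs.seq (c₁ := 1) (c₂ := 9) (Mid := fun A' ψ' => A' = A₄ ∧ ψ' =
          tensor (qubitH ⟨j, hj⟩ (phaseFlip (Pi.single ⟨j, hj⟩ (d ⟨j, hj⟩))
            (weyl (trunc c j) (trunc d j) φ))) χ)
          (Machine.runs_hadamard h10 ⟨rfl, applyH_tensor _ χ ⟨j, hj⟩⟩) ?_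
        rintro _ _ ⟨rfl, rfl⟩
        refine Machine.Runs.seq (c₁ := 7) (c₂ := 1) (Machine.runs_fourT ⟨j, hj⟩ h10 _ χ) ?_
        rintro _ _ ⟨rfl, rfl⟩
        refine Machine.runs_hadamard h10 (hfin _ ?_)
        rw [(val_ne_zero_iff _).1 h, ← qubitH_phaseFlip]
        exact applyH_tensor _ χ ⟨j, hj⟩
      · refine (Machine.runs_skip (hfin _ ?_)).mono (by omega) fun _ _ h => h
        rw [(val_eq_zero_iff _).1 h, bitFlip_single_zero]
    · rintro A' ψ' ⟨h8', -, rfl⟩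
      exact ⟨h8', by rw [trunc_self, trunc_self]⟩
  · simp only [eval_add, eval_mul, eval_X, eval_ofNat, eval_one]
    have := Nat.mul_le_mul_right (thi.cost.eval B + (8 + (tlo.cost.eval B + 12 + 1) + 1) + 1 + 3) hnB
    omega

/-! ### The ring `𝔽₄[X]/(Xⁿ - 1)` -/

/-- The ring `𝔽₄[X]/(Xⁿ - 1)`. -/
abbrev Cyc (n : ℕ) : Type := AdjoinRoot (X ^ n - 1 : F4[X])

/-- The class of `X`. -/
noncomputable abbrev xi (n : ℕ) : Cyc n := AdjoinRoot.root (X ^ n - 1 : F4[X])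

/-- The value at `ξ^w` of the polynomial with coefficients `c 0, …, c n`. -/
noncomputable def evalXi (n : ℕ) (c : ℕ → F4) (w : ℕ) : Cyc n :=
  ∑ y ∈ Finset.range (n + 1), c y • xi n ^ (y * w)

/-- The element with coefficients `v 0, …, v (n - 1)`. -/
noncomputable def vec (n : ℕ) (v : ℕ → F4) : Cyc n := ∑ x ∈ Finset.range n, v x • xi n ^ x

/-- The matrix of the multiplication by `evalXi n c w`. -/
noncomputable def mulMat (n : ℕ) (c : ℕ → F4) (w x x' : ℕ) : F4 :=
  ∑ y ∈ Finset.range (n + 1), if (x' + y * w) % n = x then c y else 0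

/-- The coefficients of `1 + X + ⋯ + X^(n-1)`. -/
noncomputable def ones (n y : ℕ) : F4 := if y < n then 1 else 0

section

variable {n : ℕ}

theorem xi_pow_n : xi n ^ n = 1 := by
  have h : AdjoinRoot.mk (X ^ n - 1 : F4[X]) (X ^ n - 1) = 0 := AdjoinRoot.mk_self
  rwa [map_sub, map_pow, AdjoinRoot.mk_X, map_one, sub_eq_zero] at h

theorem xi_pow_mod (k : ℕ) : xi n ^ (k % n) = xi n ^ k := by
  conv_rhs => rw [← Nat.mod_add_div k n, pow_add, pow_mul, xi_pow_n, one_pow, mul_one]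

/-- Exponents of ξ may be reduced modulo n, which makes multiplication an explicit matrix over 𝔽₄.
Equations in the ring thereby become linear equations for coefficients. -/
theorem evalXi_mul_vec (hn : 0 < n) (c v : ℕ → F4) (w : ℕ) : evalXi n c w * vec n v =
    vec n fun x => ∑ x' ∈ Finset.range n, mulMat n c w x x' * v x' := by
  have key : ∀ k, xi n ^ k = ∑ x ∈ Finset.range n, (if k % n = x then (1 : F4) else 0) • xi n ^ x := by
    intro k
    simp only [ite_smul, one_smul, zero_smul]
    rw [Finset.sum_ite_eq, if_pos (Finset.mem_range.2 (Nat.mod_lt _ hn)), xi_pow_mod]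
  unfold evalXi vec mulMat
  rw [Finset.sum_mul_sum, Finset.sum_comm]
  simp only [Finset.sum_mul, Finset.sum_smul]
  rw [Finset.sum_comm (s := Finset.range n) (t := Finset.range n)]
  refine Finset.sum_congr rfl fun x' _ => ?_
  rw [Finset.sum_comm]
  refine Finset.sum_congr rfl fun y _ => ?_
  rw [smul_mul_smul_comm, ← pow_add, add_comm, key, Finset.smul_sum]
  refine Finset.sum_congr rfl fun x _ => ?_
  rw [smul_smul]
  congr 1
  split_ifs <;> ring

theorem vec_eq_mk (v : ℕ → F4) : vec n v =
    AdjoinRoot.mk (X ^ n - 1 : F4[X]) (∑ x ∈ Finset.range n, C (v x) * X ^ x) := by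
  simp only [vec, map_sum, map_mul, map_pow, AdjoinRoot.mk_X, AdjoinRoot.mk_C, Algebra.smul_def]
  rfl

theorem degree_sum_lt (hn : 0 < n) (v : ℕ → F4) :
    (∑ x ∈ Finset.range n, C (v x) * X ^ x).degree < (X ^ n - 1 : F4[X]).degree := by
  rw [show (X ^ n - 1 : F4[X]) = X ^ n - C 1 by simp, degree_X_pow_sub_C hn]
  rw [Finset.sum_range]
  exact degree_sum_fin_lt _

theorem monic_X_pow_sub_one (hn : 0 < n) : (X ^ n - 1 : F4[X]).Monic := by
  simpa using monic_X_pow_sub_C (1 : F4) hn.ne'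

theorem coeff_sum_range (v : ℕ → F4) {x : ℕ} (hx : x < n) :
    (∑ x ∈ Finset.range n, C (v x) * X ^ x).coeff x = v x := by
  simp [finsetSum_coeff, coeff_X_pow, hx]

theorem vec_eq_zero (hn : 0 < n) {v : ℕ → F4} : vec n v = 0 ↔ ∀ x < n, v x = 0 := by
  constructor
  · intro h x hx
    rw [vec_eq_mk, AdjoinRoot.mk_eq_zero] at h
    have := eq_zero_of_dvd_of_degree_lt h (degree_sum_lt hn v)
    rw [← coeff_sum_range v hx, this, coeff_zero]
  · intro h
    exact Finset.sum_eq_zero fun x hx => by rw [h x (Finset.mem_range.1 hx), zero_smul]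

theorem eq_sum_range_of_degree_lt {f : F4[X]} (hf : f.degree < n) :
    f = ∑ x ∈ Finset.range n, C (f.coeff x) * X ^ x := by
  ext k
  by_cases hk : k < n
  · rw [coeff_sum_range _ hk]
  · rw [coeff_eq_zero_of_degree_lt (hf.trans_le (by exact_mod_cast not_lt.1 hk))]
    symm
    simp only [finsetSum_coeff, coeff_C_mul, coeff_X_pow]
    exact Finset.sum_eq_zero fun x hx => by
      have := Finset.mem_range.1 hx
      rw [if_neg (by omega), mul_zero]

theorem exists_vec (hn : 0 < n) (a : Cyc n) : ∃ v, vec n v = a := by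
  obtain ⟨f, rfl⟩ := AdjoinRoot.mk_surjective a
  refine ⟨fun x => (f %ₘ (X ^ n - 1)).coeff x, ?_⟩
  have hdeg := degree_modByMonic_lt f (monic_X_pow_sub_one hn)
  rw [show (X ^ n - 1 : F4[X]) = X ^ n - C 1 by simp, degree_X_pow_sub_C hn] at hdeg
  rw [vec_eq_mk, ← eq_sum_range_of_degree_lt (by simpa using hdeg), AdjoinRoot.mk_eq_mk]
  rw [modByMonic_eq_sub_mul_div]
  exact ⟨-(f /ₘ (X ^ n - 1)), by ring⟩

/-! ### Primitive elements and the Vandermonde argument -/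

/-- Elements that belong to primitive roots of unity. -/
def IsPrim (n : ℕ) (v : Cyc n) : Prop := ∀ i < n, 0 < i → evalXi n (ones n) i * v = 0

theorem evalXi_ones (i : ℕ) : evalXi n (ones n) i = ∑ j ∈ Finset.range n, xi n ^ (j * i) := by
  rw [evalXi, Finset.sum_range_succ]
  simp only [ones, lt_self_iff_false, if_false, zero_smul, add_zero]
  exact Finset.sum_congr rfl fun j hj => by rw [if_pos (Finset.mem_range.1 hj), one_smul]

theorem IsPrim.mul {v : Cyc n} (hv : IsPrim n v) (a : Cyc n) : IsPrim n (a * v) := fun i hi h0 => by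
  rw [mul_left_comm, hv i hi h0, mul_zero]

/-- If ξ^i fixes v, the geometric sum in ξ^i multiplies v by n, which is 1 since n is odd and the
characteristic is 2. But this sum annihilates v. -/
theorem IsPrim.eq_zero_of_pow_mul {v : Cyc n} (hv : IsPrim n v) (ho : Odd n) {i : ℕ} (hi : i < n)
    (h0 : 0 < i) (h : xi n ^ i * v = v) : v = 0 := by
  have h1 : ∀ j, xi n ^ (j * i) * v = v := by
    intro j
    induction j with
    | zero => simp
    | succ j ih => rw [add_mul, one_mul, pow_add, mul_assoc, h, ih]
  have := hv i hi h0
  rw [evalXi_ones, Finset.sum_mul, Finset.sum_congr rfl fun j _ => h1 j, Finset.sum_const,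
    Finset.card_range] at this
  obtain ⟨k, hk⟩ := ho
  have h2 : (2 : Cyc n) = 0 := by
    have h : algebraMap F4 (Cyc n) 2 = 0 := by rw [F4.two, map_zero]
    rwa [map_ofNat] at h
  have e : n • v = (2 * k + 1) • v := congrArg (fun m : ℕ => m • v) hk
  rw [this, nsmul_eq_mul] at e
  push_cast at e
  rw [h2] at e
  simpa using e.symm

/-- The ring has zero divisors, but the differences of distinct powers of ξ act injectively on
primitive elements. This replaces the field axioms in the Vandermonde argument. -/
theorem IsPrim.eq_zero_of_sub_mul {v : Cyc n} (hv : IsPrim n v) (ho : Odd n) {i i' : ℕ} (hi : i < n)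
    (hi' : i' < n) (hne : i ≠ i') (h : (xi n ^ i - xi n ^ i') * v = 0) : v = 0 := by
  wlog hlt : i' < i generalizing i i'
  · exact this hi' hi hne.symm (by
      rw [show xi n ^ i' - xi n ^ i = -(xi n ^ i - xi n ^ i') by ring, neg_mul, h, neg_zero]) (by omega)
  have h' : xi n ^ (n - i') * ((xi n ^ i - xi n ^ i') * v) = 0 := by rw [h, mul_zero]
  rw [← mul_assoc, mul_sub, ← pow_add, ← pow_add, show n - i' + i' = n by omega,
    show n - i' + i = n + (i - i') by omega, pow_add, xi_pow_n, one_mul, sub_mul, one_mul,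
    sub_eq_zero] at h'
  exact hv.eq_zero_of_pow_mul ho (by omega) (by omega) h'

theorem IsPrim.eq_zero_of_prod_mul {v : Cyc n} (hv : IsPrim n v) (ho : Odd n) {i : ℕ} (hi : i < n)
    (S : Finset ℕ) (hS : ∀ i' ∈ S, i' < n ∧ i ≠ i')
    (h : (∏ i' ∈ S, (xi n ^ i - xi n ^ i')) * v = 0) : v = 0 := by
  induction S using Finset.induction_on with
  | empty => simpa using h
  | insert a S ha ih =>
    rw [Finset.prod_insert ha, mul_assoc] at h
    have h1 := hS a (Finset.mem_insert_self a S)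
    exact ih (fun i' hi' => hS i' (Finset.mem_insert_of_mem hi'))
      ((hv.mul _).eq_zero_of_sub_mul ho hi h1.1 h1.2 h)

/-- Combine the equations with the coefficients of the product of X - ξ^i' over i' ≠ i. All terms
except the one for i vanish, and its factor is a product of differences, which is injective on
primitive elements. -/
theorem vandermonde (ho : Odd n) (S : Finset ℕ) (hS : ∀ i ∈ S, i < n) {w : ℕ → Cyc n}
    (hw : ∀ i ∈ S, IsPrim n (w i))
    (h : ∀ j < S.card, ∑ i ∈ S, xi n ^ (i * j) * w i = 0) : ∀ i ∈ S, w i = 0 := by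
  classical
  intro i hi
  set q : (Cyc n)[X] := ∏ i' ∈ S.erase i, (X - C (xi n ^ i')) with hq
  have hdeg : q.natDegree < S.card := by
    refine (natDegree_prod_le _ _).trans_lt ?_
    refine (Finset.sum_le_card_nsmul _ _ 1 fun i' _ => natDegree_X_sub_C_le _).trans_lt ?_
    rw [Finset.card_erase_of_mem hi, smul_eq_mul, mul_one]
    have := Finset.card_pos.2 ⟨i, hi⟩
    omega
  have h1 : ∑ i' ∈ S, q.eval (xi n ^ i') * w i' = 0 := by
    simp only [eval_eq_sum_range' hdeg, Finset.sum_mul]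
    rw [Finset.sum_comm]
    refine Finset.sum_eq_zero fun k hk => ?_
    have := congrArg (fun a => q.coeff k * a) (h k (Finset.mem_range.1 hk))
    simp only [mul_zero, Finset.mul_sum] at this
    rw [← this]
    exact Finset.sum_congr rfl fun i' _ => by rw [← pow_mul, mul_assoc]
  rw [← Finset.add_sum_erase _ _ hi, Finset.sum_eq_zero (s := S.erase i), add_zero] at h1
  · rw [hq, eval_prod] at h1
    simp only [eval_sub, eval_X, eval_C] at h1
    exact (hw i hi).eq_zero_of_prod_mul ho (hS i hi) _ (fun i' hi' =>
      ⟨hS i' (Finset.mem_of_mem_erase hi'), (Finset.ne_of_mem_erase hi').symm⟩) h1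
  · intro i' hi'
    rw [hq, eval_prod, Finset.prod_eq_zero hi' (by simp), zero_mul]

/-! ### Error locators over the ring -/

/-- The conditions on the coefficients `Λ k` of an error locator. -/
structure IsLocator (n : ℕ) (h r : ℕ → F4) (l t : ℕ) (Λ : ℕ → Cyc n) : Prop where
  prim : ∀ k < n, IsPrim n (Λ k)
  root : ∀ k < n, ∀ i < n, i < 2 * t → evalXi n h (l + i) * Λ k = 0
  key : ∀ i < n, i < t → ∑ k ∈ Finset.range n, evalXi n r (l + i + k) * Λ k = 0
  deg : ∀ k < n, t < k → Λ k = 0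

/-- Elements that belong to primitive roots of unity `β` such that the polynomial with coefficients
`h` vanishes at `β^l, …, β^(l+2t-1)`. -/
structure IsKilled (n : ℕ) (h : ℕ → F4) (l t : ℕ) (v : Cyc n) : Prop where
  prim : IsPrim n v
  root : ∀ i < n, i < 2 * t → evalXi n h (l + i) * v = 0

theorem IsKilled.mul {h : ℕ → F4} {l t : ℕ} {v : Cyc n} (hv : IsKilled n h l t v) (a : Cyc n) :
    IsKilled n h l t (a * v) :=
  ⟨hv.prim.mul a, fun i hi ht => by rw [mul_left_comm, hv.root i hi ht, mul_zero]⟩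

theorem IsLocator.isKilled {h r : ℕ → F4} {l t : ℕ} {Λ : ℕ → Cyc n} (hΛ : IsLocator n h r l t Λ)
    {k : ℕ} (hk : k < n) : IsKilled n h l t (Λ k) := ⟨hΛ.prim k hk, hΛ.root k hk⟩

theorem evalXi_eq {e : ℕ → F4} {S : Finset ℕ} (hS : ∀ i ∈ S, i < n)
    (he : ∀ i ≤ n, i ∉ S → e i = 0) (w : ℕ) :
    evalXi n e w = ∑ i ∈ S, e i • xi n ^ (i * w) := by
  symm
  refine Finset.sum_subset (fun i hi => Finset.mem_range.2 ((hS i hi).trans (Nat.lt_succ_self n)))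
    fun i hi hi' => ?_
  rw [he i (Nat.lt_succ_iff.1 (Finset.mem_range.1 hi)) hi', zero_smul]

theorem smul_eq_zero_of_ne {c : F4} {v : Cyc n} (hv : v ≠ 0) (h : c • v = 0) : c = 0 := by
  by_contra hc
  apply hv
  have := congrArg (fun a => c⁻¹ • a) h
  simpa [smul_smul, inv_mul_cancel₀ hc] using this

theorem xi_pow_mul_eq_zero {v : Cyc n} (hn : 0 < n) (k : ℕ) (h : xi n ^ k * v = 0) : v = 0 := by
  have h1 : xi n ^ (n * k - k) * (xi n ^ k * v) = 0 := by rw [h, mul_zero]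
  rwa [← mul_assoc, ← pow_add, Nat.sub_add_cancel (Nat.le_mul_of_pos_left k hn), pow_mul, xi_pow_n,
    one_pow, one_mul] at h1

/-- The BCH bound with v in the role of a primitive root of unity: a word with at most 2t nonzero
entries is determined by 2t consecutive values. The Vandermonde unknowns are δ i ξ^(i l) v. -/
theorem eq_zero_of_killed (ho : Odd n) {h : ℕ → F4} {l t : ℕ} {v : Cyc n}
    (hv : IsKilled n h l t v) (hv0 : v ≠ 0) {δ : ℕ → F4} {S : Finset ℕ} (hS : ∀ i ∈ S, i < n)
    (hδ : ∀ i ≤ n, i ∉ S → δ i = 0) (hcard : S.card ≤ 2 * t)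
    (hz : ∀ j < 2 * t, evalXi n δ (l + j) * v = 0) : ∀ i ≤ n, δ i = 0 := by
  intro i hi
  by_cases hiS : i ∈ S
  · have := vandermonde ho S hS (w := fun i => (δ i • xi n ^ (i * l)) * v) (fun i _ => hv.prim.mul _)
      (fun j hj => ?_) i hiS
    · refine smul_eq_zero_of_ne (v := v) hv0 (xi_pow_mul_eq_zero ho.pos (i * l) ?_)
      rw [← this]
      simp [mul_comm]
    · rw [← hz j (by omega), evalXi_eq hS hδ, Finset.sum_mul]
      refine Finset.sum_congr rfl fun i _ => ?_
      rw [← mul_assoc, mul_smul_comm, ← pow_add]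
      congr 3
      ring
  · exact hδ i hi hiS

/-- Error locators vanish exactly at the positions of the errors. -/
theorem exists_locator_iff (ho : Odd n) {h r e : ℕ → F4} {l t : ℕ} {v : Cyc n}
    (hv : IsKilled n h l t v) (hv0 : v ≠ 0) {S : Finset ℕ} (hS : ∀ i ∈ S, i < n ∧ e i ≠ 0)
    (he : ∀ i ≤ n, i ∉ S → e i = 0) (hcard : S.card ≤ t) (htn : 2 * t ≤ n)
    (hre : ∀ j < 2 * t, ∀ v, IsKilled n h l t v →
      evalXi n r (l + j) * v = evalXi n e (l + j) * v) {i : ℕ} (hi : i < n) :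
    (∃ Λ, IsLocator n h r l t Λ ∧ ∑ k ∈ Finset.range n, xi n ^ (i * k) * Λ k ≠ 0) ↔ i ∉ S := by
  have hpos := ho.pos
  have htn' : t < n := by omega
  have hS' : ∀ i ∈ S, i < n := fun i hi => (hS i hi).1
  -- After an exchange of the sums, the j-th key equation is the j-th Vandermonde equation for the
  -- unknowns e_i ξ^(i l) Λ(ξ^i), with i in S.
  have hsum : ∀ Λ : ℕ → Cyc n, (∀ k < n, IsKilled n h l t (Λ k)) → (∀ k < n, t < k → Λ k = 0) →
      ∀ j < t, ∑ k ∈ Finset.range n, evalXi n r (l + j + k) * Λ k =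
        ∑ i ∈ S, xi n ^ (i * j) *
          ((e i • xi n ^ (i * l)) * ∑ k ∈ Finset.range n, xi n ^ (i * k) * Λ k) := by
    intro Λ hΛ hdeg j hj
    have : ∀ k ∈ Finset.range n, evalXi n r (l + j + k) * Λ k =
        ∑ i ∈ S, (e i • xi n ^ (i * (l + j + k))) * Λ k := by
      intro k hk
      have hk := Finset.mem_range.1 hk
      -- For k ≤ t the exponent offset j + k is below 2t, the range in which r and e have the same
      -- values.
      by_cases hkt : t < k
      · simp [hdeg k hk hkt]
      · rw [add_assoc, hre (j + k) (by omega) _ (hΛ k hk), evalXi_eq hS' he, Finset.sum_mul]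
    rw [Finset.sum_congr rfl this, Finset.sum_comm]
    refine Finset.sum_congr rfl fun i _ => ?_
    rw [Finset.mul_sum, Finset.mul_sum]
    refine Finset.sum_congr rfl fun k _ => ?_
    rw [show i * (l + j + k) = i * j + i * l + i * k by ring, pow_add, pow_add]
    simp only [Algebra.smul_def]
    ring
  constructor
  · rintro ⟨Λ, hΛ, hne⟩ hiS
    apply hne
    have := vandermonde ho S hS' (w := fun i => (e i • xi n ^ (i * l)) *
      ∑ k ∈ Finset.range n, xi n ^ (i * k) * Λ k) (fun i _ => IsPrim.mul ?_ _) (fun j hj => ?_) i hiS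
    · have h1 : e i • (xi n ^ (i * l) * ∑ k ∈ Finset.range n, xi n ^ (i * k) * Λ k) = 0 := by
        rw [← this, smul_mul_assoc]
      refine xi_pow_mul_eq_zero hpos (i * l) ?_
      by_contra h2
      exact (hS i hiS).2 (smul_eq_zero_of_ne h2 h1)
    · intro j hj h0
      rw [Finset.mul_sum]
      refine Finset.sum_eq_zero fun k hk => ?_
      exact ((hΛ.prim k (Finset.mem_range.1 hk)).mul _) j hj h0
    · rw [← hsum Λ (fun k hk => hΛ.isKilled hk) hΛ.deg j (by omega)]
      exact hΛ.key j (by omega) (by omega)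
  · intro hiS
    -- The classical error locator polynomial. Its coefficients times v form the required locator.
    set q : (Cyc n)[X] := ∏ i' ∈ S, (X - C (xi n ^ i')) with hq
    have hdeg : q.natDegree ≤ t := by
      refine (natDegree_prod_le _ _).trans ?_
      refine (Finset.sum_le_card_nsmul _ _ 1 fun i' _ => natDegree_X_sub_C_le _).trans ?_
      simpa using hcard
    have hev : ∀ i, ∑ k ∈ Finset.range n, xi n ^ (i * k) * (q.coeff k * v) =
        (∏ i' ∈ S, (xi n ^ i - xi n ^ i')) * v := by
      intro i
      have : (∏ i' ∈ S, (xi n ^ i - xi n ^ i')) = q.eval (xi n ^ i) := by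
        rw [hq, eval_prod]; simp
      rw [this, eval_eq_sum_range' (n := n) (by omega), Finset.sum_mul]
      exact Finset.sum_congr rfl fun k _ => by rw [← pow_mul]; ring
    have hk : ∀ k < n, IsKilled n h l t (q.coeff k * v) := fun k _ => hv.mul _
    have hd : ∀ k < n, t < k → q.coeff k * v = 0 := fun k _ ht => by
      rw [coeff_eq_zero_of_natDegree_lt (by omega), zero_mul]
    refine ⟨fun k => q.coeff k * v, ⟨fun k hk' => (hk k hk').prim, fun k hk' => (hk k hk').root,
      fun j hj hjt => ?_, hd⟩, ?_⟩
    · rw [hsum _ hk hd j hjt]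
      refine Finset.sum_eq_zero fun i' hi' => ?_
      rw [hev, Finset.prod_eq_zero hi' (sub_self _)]
      simp
    · rw [hev]
      exact fun h0 => hv0 (hv.prim.eq_zero_of_prod_mul ho hi S
        (fun i' hi' => ⟨hS' i' hi', fun e => hiS (e ▸ hi')⟩) h0)

end

/-! ### Roots of unity -/

section

variable {n : ℕ}

/-- The polynomial `c 0 + c 1 X^w + ⋯ + c n X^(n w)`. -/
noncomputable def coeffPoly (n : ℕ) (c : ℕ → F4) (w : ℕ) : F4[X] :=
  ∑ y ∈ Finset.range (n + 1), C (c y) * X ^ (y * w)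

theorem mk_coeffPoly (c : ℕ → F4) (w : ℕ) :
    AdjoinRoot.mk (X ^ n - 1 : F4[X]) (coeffPoly n c w) = evalXi n c w := by
  simp only [coeffPoly, evalXi, map_sum, map_mul, map_pow, AdjoinRoot.mk_X, AdjoinRoot.mk_C,
    Algebra.smul_def]
  rfl

theorem aeval_coeffPoly {A : Type*} [CommRing A] [Algebra F4 A] (c : ℕ → F4) (w : ℕ) (β : A) :
    aeval β (coeffPoly n c w) = ∑ y ∈ Finset.range (n + 1), algebraMap F4 A (c y) * (β ^ w) ^ y := by
  simp only [coeffPoly, map_sum, map_mul, map_pow, aeval_X, aeval_C]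
  exact Finset.sum_congr rfl fun y _ => by rw [← pow_mul, mul_comm y]

theorem aeval_coeffPoly_coeff {A : Type*} [CommRing A] [Algebra F4 A] {h : F4[X]}
    (hh : h.natDegree ≤ n) (w : ℕ) (β : A) :
    aeval β (coeffPoly n h.coeff w) = aeval (β ^ w) h := by
  rw [aeval_coeffPoly, aeval_eq_sum_range' (Nat.lt_succ_of_le hh)]
  exact Finset.sum_congr rfl fun y _ => by rw [Algebra.smul_def]

theorem evalXi_coeff {h : F4[X]} (hh : h.natDegree ≤ n) (w : ℕ) :
    evalXi n h.coeff w = aeval (xi n ^ w) h := by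
  rw [evalXi, aeval_eq_sum_range' (Nat.lt_succ_of_le hh)]
  exact Finset.sum_congr rfl fun y _ => by rw [← pow_mul, mul_comm]

/-- The annihilator of v is generated by a polynomial that is no unit, since v ≠ 0, and nonzero,
since it divides X^n - 1. Any root of the generator will do. -/
theorem exists_root_of_ne_zero (hn : 0 < n) {v : Cyc n} (hv : v ≠ 0) :
    ∃ β : AlgebraicClosure F4, ∀ f : F4[X],
      AdjoinRoot.mk (X ^ n - 1 : F4[X]) f * v = 0 → aeval β f = 0 := by
  let I : Ideal F4[X] :=
    { carrier := {f | AdjoinRoot.mk (X ^ n - 1 : F4[X]) f * v = 0}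
      add_mem' := fun {a b} ha hb => by
        have ha : AdjoinRoot.mk (X ^ n - 1 : F4[X]) a * v = 0 := ha
        have hb : AdjoinRoot.mk (X ^ n - 1 : F4[X]) b * v = 0 := hb
        change AdjoinRoot.mk (X ^ n - 1 : F4[X]) (a + b) * v = 0
        rw [map_add, add_mul, ha, hb, add_zero]
      zero_mem' := by
        change AdjoinRoot.mk (X ^ n - 1 : F4[X]) 0 * v = 0
        rw [map_zero, zero_mul]
      smul_mem' := fun c a ha => by
        have ha : AdjoinRoot.mk (X ^ n - 1 : F4[X]) a * v = 0 := ha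
        change AdjoinRoot.mk (X ^ n - 1 : F4[X]) (c * a) * v = 0
        rw [map_mul, mul_assoc, ha, mul_zero] }
  set p := Submodule.IsPrincipal.generator I with hp
  have hmem : ∀ f, f ∈ I ↔ p ∣ f := fun f => Submodule.IsPrincipal.mem_iff_generator_dvd I
  have hX : (X ^ n - 1 : F4[X]) ∈ I := by
    change AdjoinRoot.mk (X ^ n - 1 : F4[X]) (X ^ n - 1) * v = 0
    rw [AdjoinRoot.mk_self, zero_mul]
  have hp0 : p ≠ 0 := fun h0 => by
    have := (hmem _).1 hX
    rw [h0, zero_dvd_iff] at this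
    exact (monic_X_pow_sub_one hn).ne_zero this
  have hpu : ¬ IsUnit p := fun hu => by
    have : (1 : F4[X]) ∈ I := (hmem 1).2 (hu.dvd)
    have : AdjoinRoot.mk (X ^ n - 1 : F4[X]) 1 * v = 0 := this
    rw [map_one, one_mul] at this
    exact hv this
  obtain ⟨β, hβ⟩ := IsAlgClosed.exists_aeval_eq_zero (AlgebraicClosure F4) p
    (fun h0 => hpu (isUnit_iff_degree_eq_zero.2 h0))
  refine ⟨β, fun f hf => ?_⟩
  obtain ⟨q, rfl⟩ := (hmem f).1 hf
  rw [map_mul, hβ, zero_mul]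

/-- The class of (X^n - 1) divided by the minimal polynomial of β is nonzero by degree, and every
multiple of the minimal polynomial annihilates it. -/
theorem exists_ne_zero_of_root (hn : 0 < n) {β : AlgebraicClosure F4} (hβ : β ^ n = 1) :
    ∃ v : Cyc n, v ≠ 0 ∧ ∀ f : F4[X], aeval β f = 0 →
      AdjoinRoot.mk (X ^ n - 1 : F4[X]) f * v = 0 := by
  have hint : IsIntegral F4 β := Algebra.IsIntegral.isIntegral β
  obtain ⟨q, hq⟩ : minpoly F4 β ∣ X ^ n - 1 := minpoly.dvd _ _ (by simp [hβ])
  have h0 : (X ^ n - 1 : F4[X]) ≠ 0 := (monic_X_pow_sub_one hn).ne_zero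
  have hq0 : q ≠ 0 := fun h => h0 (by rw [hq, h, mul_zero])
  refine ⟨AdjoinRoot.mk _ q, fun h => ?_, fun f hf => ?_⟩
  · rw [AdjoinRoot.mk_eq_zero] at h
    have h1 := natDegree_le_of_dvd h hq0
    rw [hq, natDegree_mul (minpoly.ne_zero hint) hq0] at h1
    have := minpoly.natDegree_pos hint
    omega
  · obtain ⟨s, rfl⟩ := minpoly.dvd F4 β hf
    rw [← map_mul, AdjoinRoot.mk_eq_zero, hq]
    exact ⟨s, by ring⟩

/-- Linear conditions on v turn into statements about a true root of unity; through this lemma the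
maximality in the definition of the BCH distance applies to the pairs found by the algorithm. -/
theorem exists_primitiveRoot_of_isKilled (ho : Odd n) {h : F4[X]} (hh : h.natDegree ≤ n) {l t : ℕ}
    (htn : 2 * t ≤ n) {v : Cyc n} (hv : IsKilled n h.coeff l t v) (hv0 : v ≠ 0) :
    ∃ β : AlgebraicClosure F4, IsPrimitiveRoot β n ∧
      ∀ i < 2 * t, aeval (β ^ (l + i)) h = 0 := by
  obtain ⟨β, hβ⟩ := exists_root_of_ne_zero ho.pos hv0
  have h1 : β ^ n = 1 := by
    have := hβ (X ^ n - 1) (by rw [AdjoinRoot.mk_self, zero_mul])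
    simpa [sub_eq_zero] using this
  refine ⟨β, IsPrimitiveRoot.mk_of_lt β ho.pos h1 fun i hi0 hi hβi => ?_, fun i hi => ?_⟩
  -- If β^i were 1, the vanishing geometric sum would be n copies of 1, which is 1 for odd n in
  -- characteristic 2.
  · have := hβ (coeffPoly n (ones n) i) (by rw [mk_coeffPoly]; exact hv.prim i hi hi0)
    rw [aeval_coeffPoly, Finset.sum_range_succ] at this
    simp only [hβi, one_pow, mul_one, ones, lt_self_iff_false, if_false, map_zero, add_zero] at this
    rw [Finset.sum_congr rfl fun j hj => by rw [if_pos (Finset.mem_range.1 hj), map_one],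
      Finset.sum_const, Finset.card_range, nsmul_eq_mul, mul_one] at this
    obtain ⟨k, hk⟩ := ho
    have h2 : (2 : AlgebraicClosure F4) = 0 := by
      have h : algebraMap F4 (AlgebraicClosure F4) 2 = 0 := by rw [F4.two, map_zero]
      rwa [map_ofNat] at h
    rw [hk] at this
    push_cast at this
    rw [h2] at this
    simp at this
  · rw [← aeval_coeffPoly_coeff hh]
    exact hβ _ (by rw [mk_coeffPoly]; exact hv.root i (by omega) hi)

theorem exists_isKilled_of_primitiveRoot (hn : 0 < n) {h : F4[X]} (hh : h.natDegree ≤ n) {l t : ℕ}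
    {β : AlgebraicClosure F4} (hβ : IsPrimitiveRoot β n)
    (hr : ∀ i < 2 * t, aeval (β ^ (l + i)) h = 0) :
    ∃ v : Cyc n, v ≠ 0 ∧ IsKilled n h.coeff l t v := by
  obtain ⟨v, hv0, hv⟩ := exists_ne_zero_of_root hn hβ.pow_eq_one
  refine ⟨v, hv0, fun i hi hi0 => ?_, fun i _ hi => ?_⟩
  · rw [← mk_coeffPoly]
    apply hv
    rw [aeval_coeffPoly, Finset.sum_range_succ]
    simp only [ones, lt_self_iff_false, if_false, map_zero, zero_mul, add_zero]
    rw [Finset.sum_congr rfl fun j hj => by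
      rw [if_pos (Finset.mem_range.1 hj), map_one, one_mul]]
    -- The geometric sum in β^i vanishes because β^i ≠ 1 while its n-th power is 1.
    have h1 : β ^ i - 1 ≠ 0 := sub_ne_zero.2 (hβ.pow_ne_one_of_pos_of_lt hi0.ne' hi)
    have h2 := geom_sum_mul (β ^ i) n
    rw [← pow_mul, mul_comm i, pow_mul, hβ.pow_eq_one, one_pow, sub_self] at h2
    exact (mul_eq_zero.1 h2).resolve_right h1
  · rw [← mk_coeffPoly]
    exact hv _ (by rw [aeval_coeffPoly_coeff hh]; exact hr i hi)

/-! ### The parity checks -/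

/-- The coefficients of `X^k g h` modulo `Xⁿ - 1`. -/
noncomputable def check (n : ℕ) (g h : ℕ → F4) (k i : ℕ) : F4 :=
  ∑ a ∈ Finset.range (n + 1), ∑ b ∈ Finset.range (n + 1),
    if (a + b + k) % n = i then g a * h b else 0

theorem F4.sum_sq {ι : Type*} (s : Finset ι) (f : ι → F4) :
    (∑ i ∈ s, f i) ^ 2 = ∑ i ∈ s, f i ^ 2 := sum_pow_char 2 s f

theorem check_sq (g h : ℕ → F4) (k i : ℕ) :
    check n g h k i ^ 2 = check n (fun a => g a ^ 2) (fun b => h b ^ 2) k i := by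
  unfold check
  rw [F4.sum_sq]
  refine Finset.sum_congr rfl fun a _ => ?_
  rw [F4.sum_sq]
  refine Finset.sum_congr rfl fun b _ => ?_
  split_ifs <;> ring

theorem sum_range_add_of_periodic {M : Type*} [AddCommGroup M] {F : ℕ → M}
    (hF : ∀ k, F (n + k) = F k) (s : ℕ) :
    ∑ k ∈ Finset.range n, F (s + k) = ∑ k ∈ Finset.range n, F k := by
  induction s with
  | zero => simp
  | succ s ih =>
    rw [← ih]
    have h1 := Finset.sum_range_succ' (fun k => F (s + k)) n
    rw [Finset.sum_range_succ] at h1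
    simp only [add_zero] at h1
    rw [add_comm s n, hF] at h1
    rw [add_right_cancel h1]
    exact Finset.sum_congr rfl fun k _ => by rw [add_assoc, add_comm 1]

/-- The parity checks are the cyclic correlation of δ with g h. A Fourier sum at β turns this into a
product, with g h taken at β⁻¹ because of the correlation. -/
theorem sum_check_mul (hn : 0 < n) (g h δ : ℕ → F4) {β : AlgebraicClosure F4} (hβ : β ^ n = 1) :
    ∑ k ∈ Finset.range n, β ^ k *
      algebraMap F4 (AlgebraicClosure F4) (∑ i ∈ Finset.range n, δ i * check n g h k i) =
    (∑ a ∈ Finset.range (n + 1), algebraMap F4 (AlgebraicClosure F4) (g a) * (β⁻¹) ^ a) *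
    (∑ b ∈ Finset.range (n + 1), algebraMap F4 (AlgebraicClosure F4) (h b) * (β⁻¹) ^ b) *
      ∑ i ∈ Finset.range n, algebraMap F4 (AlgebraicClosure F4) (δ i) * β ^ i := by
  have hβ0 : β ≠ 0 := fun h0 => by rw [h0, zero_pow hn.ne'] at hβ; exact zero_ne_one hβ
  have h1 : ∀ k, ∑ i ∈ Finset.range n, δ i * check n g h k i =
      ∑ a ∈ Finset.range (n + 1), ∑ b ∈ Finset.range (n + 1),
        g a * h b * δ ((a + b + k) % n) := by
    intro k
    simp only [check, Finset.mul_sum]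
    rw [Finset.sum_comm]
    refine Finset.sum_congr rfl fun a _ => ?_
    rw [Finset.sum_comm]
    refine Finset.sum_congr rfl fun b _ => ?_
    simp only [mul_ite, mul_zero]
    rw [Finset.sum_ite_eq, if_pos (Finset.mem_range.2 (Nat.mod_lt _ hn)), mul_comm]
  have h2 : ∀ s, ∑ k ∈ Finset.range n, β ^ k * algebraMap F4 (AlgebraicClosure F4) (δ ((s + k) % n)) =
      (β⁻¹) ^ s * ∑ i ∈ Finset.range n, algebraMap F4 (AlgebraicClosure F4) (δ i) * β ^ i := by
    intro s
    have h3 := sum_range_add_of_periodic (n := n)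
      (F := fun k => algebraMap F4 (AlgebraicClosure F4) (δ (k % n)) * β ^ k)
      (fun k => by simp [pow_add, hβ]) s
    have h4 : ∑ k ∈ Finset.range n, algebraMap F4 (AlgebraicClosure F4) (δ (k % n)) * β ^ k =
        ∑ k ∈ Finset.range n, algebraMap F4 (AlgebraicClosure F4) (δ k) * β ^ k :=
      Finset.sum_congr rfl fun i hi => by rw [Nat.mod_eq_of_lt (Finset.mem_range.1 hi)]
    rw [← h4, ← h3, Finset.mul_sum]
    refine Finset.sum_congr rfl fun k _ => ?_
    rw [pow_add, inv_pow]
    field_simp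
  generalize ∑ i ∈ Finset.range n, algebraMap F4 (AlgebraicClosure F4) (δ i) * β ^ i = D at h2 ⊢
  simp only [h1, map_sum, map_mul]
  rw [Finset.sum_mul_sum, Finset.sum_mul]
  simp only [Finset.mul_sum (s := Finset.range (n + 1))]
  rw [Finset.sum_comm]
  refine Finset.sum_congr rfl fun a _ => ?_
  rw [Finset.sum_comm, Finset.sum_mul]
  refine Finset.sum_congr rfl fun b _ => ?_
  have h5 := congrArg (fun c => algebraMap F4 (AlgebraicClosure F4) (g a) *
    algebraMap F4 (AlgebraicClosure F4) (h b) * c) (h2 (a + b))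
  simp only [pow_add] at h5
  rw [Finset.mul_sum] at h5
  rw [mul_mul_mul_comm, mul_assoc, ← h5]
  exact Finset.sum_congr rfl fun k _ => by ring

/-- Raising to the power 4^m is additive in characteristic 2 and fixes the coefficients, which lie
in 𝔽₄. -/
theorem F4.sum_pow_four_pow (c : ℕ → F4) (β : AlgebraicClosure F4) (m N : ℕ) :
    ∑ a ∈ Finset.range N, algebraMap F4 (AlgebraicClosure F4) (c a) * (β ^ 4 ^ m) ^ a =
      (∑ a ∈ Finset.range N, algebraMap F4 (AlgebraicClosure F4) (c a) * β ^ a) ^ 4 ^ m := by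
  rw [show (4 : ℕ) ^ m = 2 ^ (2 * m) by rw [pow_mul]; norm_num, sum_pow_char_pow 2]
  refine Finset.sum_congr rfl fun a _ => ?_
  rw [mul_pow, ← pow_mul, ← pow_mul, mul_comm a, ← map_pow]
  congr 2
  have : ∀ m, c a ^ 2 ^ (2 * m) = c a := by
    intro m
    induction m with
    | zero => simp
    | succ m ih => rw [mul_add, pow_add, pow_mul, ih]; norm_num [F4.pow_four]
  rw [this]

theorem liftPoly_X_pow_sub_one : liftPoly (X ^ n - 1) = X ^ n - 1 := by simp [liftPoly]

theorem sigma_sigma (f : F4[X]) : sigma (sigma f) = f := by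
  rw [sigma, sigma, Polynomial.map_map]
  conv_rhs => rw [← Polynomial.map_id (p := f)]
  congr 1
  ext x
  simp only [RingHom.comp_apply, frobenius_def, RingHom.id_apply]
  rw [← pow_mul]
  exact F4.pow_four x

section

variable {m : ℕ} {g : (ZMod 2)[X]} {h : F4[X]}

theorem IsGeneratingPair.mul_eq (hp : IsGeneratingPair m g h) :
    liftPoly g * liftPoly ((X ^ (4 ^ m + 1) - 1) / g) = X ^ (4 ^ m + 1) - 1 := by
  rw [← liftPoly_X_pow_sub_one, liftPoly, liftPoly, ← Polynomial.map_mul, liftPoly,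
    EuclideanDomain.mul_div_cancel' _ hp.dvd_left]
  rintro rfl
  have := hp.dvd_left
  rw [zero_dvd_iff] at this
  exact (monic_X_pow_sub_C (1 : ZMod 2) (n := 4 ^ m + 1) (Nat.succ_ne_zero _)).ne_zero (by simpa using this)

theorem IsGeneratingPair.dvd_X_pow_sub_one (hp : IsGeneratingPair m g h) :
    h ∣ X ^ (4 ^ m + 1) - 1 := by
  rw [← hp.mul_eq]
  exact hp.dvd_right.mul_left _

theorem separable_X_pow_sub_one (hm : 1 ≤ m) : (X ^ (4 ^ m + 1) - 1 : F4[X]).Separable := by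
  have := separable_X_pow_sub_C (F := F4) (n := 4 ^ m + 1) 1 ?_ one_ne_zero
  · simpa using this
  · obtain ⟨k, rfl⟩ := Nat.exists_eq_add_of_le hm
    have : (2 : F4) = 0 := F4.two
    have h4 : (4 : F4) = 0 := by
      rw [show (4 : F4) = 2 * 2 by norm_num, this, zero_mul]
    push_cast
    rw [pow_add, h4]
    simp

theorem IsGeneratingPair.natDegree_le (hp : IsGeneratingPair m g h) :
    h.natDegree ≤ 4 ^ m + 1 := by
  have := natDegree_le_of_dvd hp.dvd_X_pow_sub_one (monic_X_pow_sub_one (Nat.succ_pos _)).ne_zero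
  refine this.trans ?_
  rw [show (X ^ (4 ^ m + 1) - 1 : F4[X]) = X ^ (4 ^ m + 1) - C 1 by simp, natDegree_X_pow_sub_C]

theorem IsGeneratingPair.natDegree_left_le (hp : IsGeneratingPair m g h) :
    (liftPoly g).natDegree ≤ 4 ^ m + 1 := by
  have := natDegree_le_of_dvd (Dvd.intro _ hp.mul_eq) (monic_X_pow_sub_one (Nat.succ_pos _)).ne_zero
  refine this.trans ?_
  rw [show (X ^ (4 ^ m + 1) - 1 : F4[X]) = X ^ (4 ^ m + 1) - C 1 by simp, natDegree_X_pow_sub_C]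

theorem coeff_liftPoly_sq (g : (ZMod 2)[X]) (a : ℕ) :
    (liftPoly g).coeff a ^ 2 = (liftPoly g).coeff a := by
  rw [liftPoly, coeff_map, ← map_pow]
  congr 1
  exact ZMod.pow_card (p := 2) _

/-- This is where the length 4^m + 1 matters: inversion of roots of unity is a power of the
Frobenius map over 𝔽₄, so g and σ(h) at β⁻¹ vanish only if they vanish at β. At a root β of h they
do not, hence β is a root of δ. -/
theorem IsGeneratingPair.dvd_of_check (hm : 1 ≤ m) (hp : IsGeneratingPair m g h) {δ : ℕ → F4}
    (hδ : ∀ k < 4 ^ m + 1, ∑ i ∈ Finset.range (4 ^ m + 1),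
      δ i * check (4 ^ m + 1) (liftPoly g).coeff h.coeff k i ^ 2 = 0) :
    h ∣ ∑ i ∈ Finset.range (4 ^ m + 1), C (δ i) * X ^ i := by
  have hsep := separable_X_pow_sub_one hm
  have hmain : ∀ β : AlgebraicClosure F4, aeval β h = 0 →
      aeval β (∑ i ∈ Finset.range (4 ^ m + 1), C (δ i) * X ^ i) = 0 := by
    intro β hβ
    have hβn : β ^ (4 ^ m + 1) = 1 := by
      obtain ⟨q, hq⟩ := hp.dvd_X_pow_sub_one
      have := congrArg (aeval β) hq
      rw [map_mul, hβ, zero_mul] at this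
      simpa [sub_eq_zero] using this
    have hinv : β⁻¹ = β ^ 4 ^ m := inv_eq_of_mul_eq_one_left (by rw [← pow_succ, hβn])
    -- A common root of g and its cofactor, which h divides, would be a double root of X^n - 1.
    have hg : aeval β (liftPoly g) ≠ 0 := by
      intro h0
      obtain ⟨u, w, huw⟩ := (hp.mul_eq ▸ hsep).isCoprime
      have := congrArg (aeval β) huw
      obtain ⟨q, hq⟩ := hp.dvd_right
      rw [map_add, map_mul, map_mul, h0, hq, map_mul, hβ] at this
      simp at this
    -- Otherwise the minimal polynomial of β divides h and σ(h), so both it and its conjugate divide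
    -- h.
    have hs : aeval β (sigma h) ≠ 0 := by
      intro h0
      have hint : IsIntegral F4 β := Algebra.IsIntegral.isIntegral β
      have h1 := minpoly.dvd F4 β hβ
      refine (hp.conj _ (minpoly.irreducible hint) (h1.trans hp.dvd_right)).1 h1 ?_
      rw [← sigma_sigma h]
      exact Polynomial.map_dvd _ (minpoly.dvd F4 β h0)
    have key := sum_check_mul (n := 4 ^ m + 1) (Nat.succ_pos _) (fun a => (liftPoly g).coeff a ^ 2)
      (fun b => h.coeff b ^ 2) δ hβn
    simp only [← check_sq] at key
    rw [Finset.sum_eq_zero fun k hk => by rw [hδ k (Finset.mem_range.1 hk), map_zero, mul_zero],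
      hinv, F4.sum_pow_four_pow, F4.sum_pow_four_pow] at key
    have e1 : ∑ a ∈ Finset.range (4 ^ m + 1 + 1), algebraMap F4 (AlgebraicClosure F4)
        ((liftPoly g).coeff a ^ 2) * β ^ a = aeval β (liftPoly g) := by
      rw [aeval_eq_sum_range' (Nat.lt_succ_of_le hp.natDegree_left_le)]
      exact Finset.sum_congr rfl fun a _ => by rw [coeff_liftPoly_sq, Algebra.smul_def]
    have e2 : ∑ b ∈ Finset.range (4 ^ m + 1 + 1), algebraMap F4 (AlgebraicClosure F4)
        (h.coeff b ^ 2) * β ^ b = aeval β (sigma h) := by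
      rw [aeval_eq_sum_range' (p := sigma h) (n := 4 ^ m + 1 + 1)
        (Nat.lt_succ_of_le ((natDegree_map_le).trans hp.natDegree_le))]
      exact Finset.sum_congr rfl fun a _ => by
        rw [sigma, coeff_map, Algebra.smul_def, frobenius_def]
    rw [e1, e2] at key
    have := (mul_eq_zero.1 key.symm).resolve_left
      (mul_ne_zero (pow_ne_zero _ hg) (pow_ne_zero _ hs))
    simpa [map_sum] using this
  have hh0 : h ≠ 0 := by
    rintro rfl
    exact hsep.ne_zero (zero_dvd_iff.1 hp.dvd_X_pow_sub_one)
  set D := ∑ i ∈ Finset.range (4 ^ m + 1), C (δ i) * X ^ i with hD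
  by_cases hD0 : D = 0
  · rw [hD0]; exact dvd_zero h
  -- As h is separable, divisibility may be tested on roots in the algebraic closure.
  rw [← map_dvd_map' (algebraMap F4 (AlgebraicClosure F4))]
  refine (IsAlgClosed.splits _).dvd_of_roots_le_roots (map_ne_zero hh0) ?_
  rw [Multiset.le_iff_subset
    (nodup_roots ((hsep.of_dvd hp.dvd_X_pow_sub_one).map))]
  intro β hβ
  rw [mem_roots (map_ne_zero hh0), IsRoot, eval_map_algebraMap] at hβ
  rw [mem_roots (map_ne_zero hD0), IsRoot, eval_map_algebraMap]
  exact hmain β hβ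

/-- The relevant values of a polynomial are determined by its parity checks. -/
theorem IsGeneratingPair.evalXi_mul_eq (hm : 1 ≤ m) (hp : IsGeneratingPair m g h) {r e : ℕ → F4}
    (hr : r (4 ^ m + 1) = 0) (he : e (4 ^ m + 1) = 0)
    (hre : ∀ k < 4 ^ m + 1, ∑ i ∈ Finset.range (4 ^ m + 1),
        r i * check (4 ^ m + 1) (liftPoly g).coeff h.coeff k i ^ 2 =
      ∑ i ∈ Finset.range (4 ^ m + 1),
        e i * check (4 ^ m + 1) (liftPoly g).coeff h.coeff k i ^ 2)
    {l t : ℕ} (ht : 2 * t ≤ 4 ^ m + 1) {v : Cyc (4 ^ m + 1)}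
    (hv : IsKilled (4 ^ m + 1) h.coeff l t v) {j : ℕ} (hj : j < 2 * t) :
    evalXi (4 ^ m + 1) r (l + j) * v = evalXi (4 ^ m + 1) e (l + j) * v := by
  obtain ⟨q, hq⟩ := hp.dvd_of_check hm (δ := fun i => r i - e i) (fun k hk => by
    simp only [sub_mul, Finset.sum_sub_distrib]
    rw [hre k hk, sub_self])
  have h1 := congrArg (aeval (xi (4 ^ m + 1) ^ (l + j))) hq
  rw [map_mul, ← evalXi_coeff hp.natDegree_le] at h1
  have h2 : aeval (xi (4 ^ m + 1) ^ (l + j))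
      (∑ i ∈ Finset.range (4 ^ m + 1), C (r i - e i) * X ^ i) =
      evalXi (4 ^ m + 1) r (l + j) - evalXi (4 ^ m + 1) e (l + j) := by
    rw [evalXi, evalXi, Finset.sum_range_succ _ (4 ^ m + 1), Finset.sum_range_succ _ (4 ^ m + 1),
      hr, he]
    simp only [zero_smul, add_zero]
    rw [← Finset.sum_sub_distrib, map_sum]
    refine Finset.sum_congr rfl fun i _ => ?_
    rw [map_mul, map_pow, aeval_X, aeval_C, ← sub_smul, Algebra.smul_def, ← pow_mul, mul_comm i]
  rw [h2] at h1
  -- The difference r - e is h times a cofactor, and the value of h at ξ^(l+j) annihilates v.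
  rw [← sub_eq_zero, ← sub_mul, h1, mul_right_comm, hv.root j (by omega) hj, zero_mul]

end

end

/-! ### The bits of an element of `𝔽₄` -/

section bits

variable {η : F4}

/-- The bit `u` of `u + η v`. -/
noncomputable def lo (η x : F4) : ZMod 2 := (loBit η x : ZMod 2)

/-- The bit `v` of `u + η v`. -/
noncomputable def hi (x : F4) : ZMod 2 := (hiBit x : ZMod 2)

theorem loBit_lt (x : F4) : loBit η x < 2 := by unfold loBit; split_ifs <;> omega

theorem hiBit_lt (x : F4) : hiBit x < 2 := by unfold hiBit; split_ifs <;> omega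

theorem enc_mod_two (x : F4) : enc η x % 2 = (lo η x).val := by
  rw [lo, ZMod.val_natCast, enc]; omega

theorem enc_div_two (x : F4) : enc η x / 2 = (hi x).val := by
  have := loBit_lt (η := η) x
  have := hiBit_lt x
  rw [hi, ZMod.val_natCast, enc]; omega

theorem algebraMap_eq_cast_val (a : ZMod 2) : algebraMap (ZMod 2) F4 a = (a.val : F4) := by
  conv_lhs => rw [← ZMod.natCast_zmod_val a]
  exact map_natCast _ _

theorem lo_add_hi (hη : η ^ 2 + η + 1 = 0) (x : F4) :
    algebraMap (ZMod 2) F4 (lo η x) + η * algebraMap (ZMod 2) F4 (hi x) = x := by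
  conv_rhs => rw [enc_split hη x]
  rw [enc_mod_two, enc_div_two, algebraMap_eq_cast_val, algebraMap_eq_cast_val]

theorem lo_hi_of_eq (hη : η ^ 2 + η + 1 = 0) (a b : ZMod 2) :
    lo η (algebraMap (ZMod 2) F4 a + η * algebraMap (ZMod 2) F4 b) = a ∧
      hi (algebraMap (ZMod 2) F4 a + η * algebraMap (ZMod 2) F4 b) = b := by
  have h := enc_add_mul hη a.val b.val
  rw [← algebraMap_eq_cast_val, ← algebraMap_eq_cast_val] at h
  have h1 := enc_mod_two (η := η) (algebraMap (ZMod 2) F4 a + η * algebraMap (ZMod 2) F4 b)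
  have h2 := enc_div_two (η := η) (algebraMap (ZMod 2) F4 a + η * algebraMap (ZMod 2) F4 b)
  rw [h] at h1 h2
  have ha := a.val_lt
  have hb := b.val_lt
  exact ⟨ZMod.val_injective 2 (by omega), ZMod.val_injective 2 (by omega)⟩

theorem lo_hi_eta_mul (hη : η ^ 2 + η + 1 = 0) (x : F4) :
    lo η (η * x) = hi x ∧ hi (η * x) = lo η x + hi x := by
  have h := lo_hi_of_eq hη (hi x) (lo η x + hi x)
  rwa [show algebraMap (ZMod 2) F4 (hi x) + η * algebraMap (ZMod 2) F4 (lo η x + hi x) = η * x by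
    conv_rhs => rw [← lo_add_hi hη x]
    rw [map_add]
    linear_combination algebraMap (ZMod 2) F4 (hi x) * ((1 + η) * F4.two - hη)] at h

theorem algebraMap_sq (a : ZMod 2) :
    algebraMap (ZMod 2) F4 a ^ 2 = algebraMap (ZMod 2) F4 a := by
  rw [← map_pow]
  congr 1
  exact ZMod.pow_card (p := 2) a

/-- The two symplectic products of `x` with `y` and `η y`, as an element of `𝔽₄`. -/
theorem mul_sq_eq (hη : η ^ 2 + η + 1 = 0) (a b : ZMod 2) (y : F4) :
    (algebraMap (ZMod 2) F4 a + η * algebraMap (ZMod 2) F4 b) * y ^ 2 =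
      algebraMap (ZMod 2) F4 (hi (η * y) * a + b * lo η (η * y)) +
        η * algebraMap (ZMod 2) F4 (hi y * a + b * lo η y) := by
  rw [(lo_hi_eta_mul hη y).1, (lo_hi_eta_mul hη y).2]
  conv_lhs => rw [← lo_add_hi hη y]
  simp only [map_add, map_mul]
  have h1 := algebraMap_sq (lo η y)
  have h2 := algebraMap_sq (hi y)
  generalize algebraMap (ZMod 2) F4 (lo η y) = u at *
  generalize algebraMap (ZMod 2) F4 (hi y) = v at *
  generalize algebraMap (ZMod 2) F4 a = a at *
  generalize algebraMap (ZMod 2) F4 b = b at *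
  have h3 := F4.two
  have h4 : η ^ 2 = 1 + η := by linear_combination hη - (1 + η) * F4.two
  have e : (a + η * b) * (u + η * v) ^ 2 =
      (a + η * b) * (u ^ 2 + η ^ 2 * v ^ 2) + 2 * ((a + η * b) * (u * (η * v))) := by ring
  rw [e, h3, h1, h2, h4]
  linear_combination b * v * h4 + η * b * v * h3

end bits

/-! ### Gottesman subgroups -/

section gottesman

variable {n : ℕ}

theorem scalar_mul_weyl_apply (ω : ℂˣ) (a b : Fin n → ZMod 2) (φ : Qubits n) :
    (scalar n ω * weyl a b) φ = (ω : ℂ) • weyl a b φ := rfl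

theorem exists_iota_pow_eq_sign (c : ZMod 2) : ∃ k, ((iota ^ k : ℂˣ) : ℂ) = sign c := by
  rcases zmod_two_cases c with rfl | rfl
  · exact ⟨0, by simp [sign_zero]⟩
  · exact ⟨2, by simp [sign_one, iota]⟩

theorem iota_pow_four : iota ^ 4 = 1 := by
  ext; simp [iota]

theorem weyl_mul_weyl (a b c d : Fin n → ZMod 2) :
    ∃ k, weyl a b * weyl c d = scalar n (iota ^ k) * weyl (a + c) (b + d) := by
  obtain ⟨k, hk⟩ := exists_iota_pow_eq_sign (b ⬝ᵥ c)
  refine ⟨k, LinearEquiv.ext fun φ => ?_⟩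
  rw [scalar_mul_weyl_apply, hk, LinearEquiv.mul_apply, weyl_weyl]

/-- The operators ι^k U_a V_b are closed under products and inverses, so the group contains nothing
else. -/
theorem exists_of_mem_errorGroup {E : Qubits n ≃ₗ[ℂ] Qubits n} (hE : E ∈ errorGroup n) :
    ∃ k a b, E = scalar n (iota ^ k) * weyl a b := by
  have hmul : ∀ k a b k' (a' b' : Fin n → ZMod 2), ∃ k'', (scalar n (iota ^ k) * weyl a b) *
      (scalar n (iota ^ k') * weyl a' b') = scalar n (iota ^ k'') * weyl (a + a') (b + b') := by
    intro k a b k' a' b'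
    obtain ⟨j, hj⟩ := weyl_mul_weyl a b a' b'
    refine ⟨k + k' + j, LinearEquiv.ext fun φ => ?_⟩
    have := LinearEquiv.congr_fun hj φ
    rw [scalar_mul_weyl_apply, LinearEquiv.mul_apply] at this
    rw [LinearEquiv.mul_apply, scalar_mul_weyl_apply, scalar_mul_weyl_apply,
      scalar_mul_weyl_apply, map_smul, this, smul_smul, smul_smul, pow_add, pow_add]
    push_cast
    ring_nf
  unfold errorGroup at hE
  induction hE using Subgroup.closure_induction with
  | mem E h =>
    obtain ⟨a, b, rfl | rfl⟩ := h
    · exact ⟨0, a, b, LinearEquiv.ext fun φ => by rw [scalar_mul_weyl_apply]; simp⟩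
    · exact ⟨1, a, b, by rw [pow_one]⟩
  | one => exact ⟨0, 0, 0, LinearEquiv.ext fun φ => by
      rw [scalar_mul_weyl_apply, weyl_zero]; simp⟩
  | mul E E' _ _ h h' =>
    obtain ⟨k, a, b, rfl⟩ := h
    obtain ⟨k', a', b', rfl⟩ := h'
    obtain ⟨k'', h⟩ := hmul k a b k' a' b'
    exact ⟨k'', _, _, h⟩
  | inv E _ h =>
    obtain ⟨k, a, b, rfl⟩ := h
    obtain ⟨j, hj⟩ := hmul k a b 0 a b
    have h2 : ∀ a : Fin n → ZMod 2, a + a = 0 := fun a => funext fun i =>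
      CharTwo.add_self_eq_zero (a i)
    -- The product of E with U_a V_b is ι^j, and ι^(3j) is the inverse of ι^j.
    refine ⟨3 * j, a, b, ?_⟩
    rw [inv_eq_iff_mul_eq_one]
    refine LinearEquiv.ext fun φ => ?_
    have := LinearEquiv.congr_fun hj φ
    rw [LinearEquiv.mul_apply, scalar_mul_weyl_apply, scalar_mul_weyl_apply,
      scalar_mul_weyl_apply, map_smul, h2, h2,
      weyl_zero] at this
    rw [LinearEquiv.mul_apply, scalar_mul_weyl_apply, scalar_mul_weyl_apply, map_smul, smul_comm]
    simp only [pow_zero, Units.val_one, one_smul] at this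
    rw [this, smul_smul, ← Units.val_mul, ← pow_add, show 3 * j + j = 4 * j by ring, pow_mul,
      iota_pow_four]
    simp

/-- The set in the definition of `phase` is nonempty: applied to the basis vector at 0 and read at
label c, an element of the group shows that its scalar is a power of ι. The exponent matters modulo
4 only. -/
theorem phase_spec {G : Subgroup (Qubits n ≃ₗ[ℂ] Qubits n)} (hG : IsGottesman G)
    {c d : Fin n → ZMod 2} (h : (c, d) ∈ underlying G) :
    scalar n (iota ^ phase G c d) * weyl c d ∈ G ∧ phase G c d < 4 := by
  obtain ⟨ω, hω⟩ := h
  obtain ⟨k, a, b, hk⟩ := exists_of_mem_errorGroup (hG.le_errorGroup hω)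
  have h1 := congrFun (LinearEquiv.congr_fun hk (Pi.single 0 1)) c
  rw [scalar_mul_weyl_apply, scalar_mul_weyl_apply] at h1
  simp only [Pi.smul_apply, smul_eq_mul, weyl_apply, sub_self, dotProduct_zero, sign_zero,
    Pi.single_eq_same, mul_one] at h1
  have hca : c - a = 0 := by
    by_contra hne
    rw [Pi.single_eq_of_ne hne, mul_zero, mul_zero] at h1
    exact ω.ne_zero h1
  rw [hca, Pi.single_eq_same, dotProduct_zero, sign_zero, mul_one, mul_one] at h1
  have h2 : ω = iota ^ k := Units.ext h1
  have h3 : k % 4 ∈ {k : ℕ | scalar n (iota ^ k) * weyl c d ∈ G} := by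
    change scalar n (iota ^ (k % 4)) * weyl c d ∈ G
    have : iota ^ (k % 4) = iota ^ k := by
      conv_rhs => rw [← Nat.mod_add_div k 4, pow_add, pow_mul, iota_pow_four, one_pow, mul_one]
    rwa [this, ← h2]
  exact ⟨Nat.sInf_mem ⟨_, h3⟩, (Nat.sInf_le h3).trans_lt (Nat.mod_lt _ (by norm_num))⟩

theorem weyl_comm (a b c d : Fin n → ZMod 2) (φ : Qubits n) :
    weyl c d (weyl a b φ) = sign (d ⬝ᵥ a + b ⬝ᵥ c) • weyl a b (weyl c d φ) := by
  rw [weyl_weyl, weyl_weyl, smul_smul, sign_add, mul_assoc, sign_mul_self, mul_one, add_comm c,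
    add_comm d]

/-- The stabiliser element fixes φ and commutes with the error up to the symplectic sign. The
damaged state is therefore an eigenvector, and the measurement yields the syndrome bit with
certainty. -/
theorem phase_smul_weyl {G : Subgroup (Qubits n ≃ₗ[ℂ] Qubits n)} (hG : IsGottesman G)
    {c d : Fin n → ZMod 2} (h : (c, d) ∈ underlying G) {φ : Qubits n} (hφ : φ ∈ stabiliserCode G)
    (a b : Fin n → ZMod 2) :
    Complex.I ^ phase G c d • weyl c d (weyl a b φ) = sign (d ⬝ᵥ a + b ⬝ᵥ c) • weyl a b φ := by
  have h1 := hφ _ (phase_spec hG h).1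
  rw [scalar_mul_weyl_apply] at h1
  rw [weyl_comm, smul_comm, ← map_smul]
  congr 2

end gottesman

/-! ### The classical description -/

section description

variable {n : ℕ}

theorem vec_check (hn : 0 < n) {f g : F4[X]} (hf : f.natDegree ≤ n) (hg : g.natDegree ≤ n) (k : ℕ) :
    vec n (check n f.coeff g.coeff k) = AdjoinRoot.mk (X ^ n - 1 : F4[X]) (X ^ k * (f * g)) := by
  have h1 : ∀ {f : F4[X]}, f.natDegree ≤ n → AdjoinRoot.mk (X ^ n - 1 : F4[X]) f =
      ∑ a ∈ Finset.range (n + 1), f.coeff a • xi n ^ a := fun hf => by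
    rw [← AdjoinRoot.aeval_eq, aeval_eq_sum_range' (Nat.lt_succ_of_le hf)]
  rw [map_mul, map_mul, map_pow, AdjoinRoot.mk_X, h1 hf, h1 hg, Finset.sum_mul_sum, Finset.mul_sum]
  simp only [vec, check, Finset.sum_smul]
  rw [Finset.sum_comm]
  refine Finset.sum_congr rfl fun a _ => ?_
  rw [Finset.sum_comm, Finset.mul_sum]
  refine Finset.sum_congr rfl fun b _ => ?_
  simp only [ite_smul, zero_smul]
  rw [Finset.sum_ite_eq, if_pos (Finset.mem_range.2 (Nat.mod_lt _ hn)), xi_pow_mod, pow_add, pow_add]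
  simp only [Algebra.smul_def, map_mul]
  ring

theorem vec_inj (hn : 0 < n) {v w : ℕ → F4} (h : vec n v = vec n w) {x : ℕ} (hx : x < n) :
    v x = w x := by
  have : vec n (fun x => v x - w x) = 0 := by
    rw [← sub_eq_zero] at h
    rw [← h]
    simp only [vec, sub_smul, Finset.sum_sub_distrib]
  exact sub_eq_zero.1 ((vec_eq_zero hn).1 this x hx)

theorem vec_coeff_modByMonic (hn : 0 < n) (f : F4[X]) :
    vec n (f %ₘ (X ^ n - 1)).coeff = AdjoinRoot.mk (X ^ n - 1 : F4[X]) f := by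
  have hdeg := degree_modByMonic_lt f (monic_X_pow_sub_one hn)
  rw [show (X ^ n - 1 : F4[X]) = X ^ n - C 1 by simp, degree_X_pow_sub_C hn] at hdeg
  rw [vec_eq_mk, ← eq_sum_range_of_degree_lt (by simpa using hdeg), AdjoinRoot.mk_eq_mk]
  rw [modByMonic_eq_sub_mul_div]
  exact ⟨-(f /ₘ (X ^ n - 1)), by ring⟩

/-- The `2n` generators of the underlying set, as elements of `𝔽₄ⁿ`. -/
noncomputable def generator (n : ℕ) (η : F4) (g h : ℕ → F4) (k i : ℕ) : F4 :=
  (if k < n then 1 else η) * check n g h (k % n) i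

/-- The polynomials that belong to the generators. -/
noncomputable def generatorPoly (n : ℕ) (η : F4) (f : F4[X]) (k : ℕ) : F4[X] :=
  if k < n then X ^ k * f else C η * (X ^ (k - n) * f)

theorem vec_generator (hn : 0 < n) {η : F4} {f g : F4[X]} (hf : f.natDegree ≤ n)
    (hg : g.natDegree ≤ n) {k : ℕ} (hk : k < 2 * n) :
    vec n (generator n η f.coeff g.coeff k) =
      AdjoinRoot.mk (X ^ n - 1 : F4[X]) (generatorPoly n η (f * g) k) := by
  unfold generator generatorPoly
  split_ifs with h
  · simp only [one_mul, Nat.mod_eq_of_lt h]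
    exact vec_check hn hf hg k
  · rw [map_mul, ← Nat.mod_eq_of_lt (show k - n < n by omega), ← Nat.mod_eq_sub_mod (not_lt.1 h),
      ← vec_check hn hf hg, vec, vec, Finset.mul_sum]
    refine Finset.sum_congr rfl fun x _ => ?_
    rw [mul_smul, Algebra.smul_def η]
    rfl

theorem coeff_generatorPoly (hn : 0 < n) {η : F4} {f g : F4[X]} (hf : f.natDegree ≤ n)
    (hg : g.natDegree ≤ n) {k : ℕ} (hk : k < 2 * n) {i : ℕ} (hi : i < n) :
    (generatorPoly n η (f * g) k %ₘ (X ^ n - 1)).coeff i =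
      generator n η f.coeff g.coeff k i :=
  vec_inj hn ((vec_coeff_modByMonic hn _).trans (vec_generator hn hf hg hk).symm) hi

theorem pairElem_lo_hi {η : F4} (hη : η ^ 2 + η + 1 = 0) (v : ℕ → F4) :
    pairElem n η (fun i => lo η (v i)) (fun i => hi (v i)) = vec n v := by
  rw [pairElem, vec_eq_mk, Finset.sum_range]
  simp only [lo_add_hi hη]

end description

section codeGroup

variable {m : ℕ} {η : F4} {g : (ZMod 2)[X]} {h : F4[X]}
  {G : Subgroup (Qubits (4 ^ m + 1) ≃ₗ[ℂ] Qubits (4 ^ m + 1))}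

theorem IsCodeGroup.generator_mem (hG : IsCodeGroup m η g h G) (hη : η ^ 2 + η + 1 = 0) {k : ℕ}
    (hk : k < 2 * (4 ^ m + 1)) :
    ((fun i => lo η (generator (4 ^ m + 1) η (liftPoly g).coeff h.coeff k i),
      fun i => hi (generator (4 ^ m + 1) η (liftPoly g).coeff h.coeff k i)) :
        (Fin (4 ^ m + 1) → ZMod 2) × (Fin (4 ^ m + 1) → ZMod 2)) ∈ underlying G := by
  rw [hG.underlying_eq]
  change pairElem _ _ _ _ ∈ Ideal.span _
  rw [pairElem_lo_hi hη, vec_generator (Nat.succ_pos _) hG.pair.natDegree_left_le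
    hG.pair.natDegree_le hk, Ideal.mem_span_singleton]
  apply _root_.map_dvd
  unfold generatorPoly
  split_ifs
  · exact Dvd.intro_left _ rfl
  · exact (Dvd.intro_left _ rfl).mul_left _

theorem IsCodeGroup.polyPhase_eq (hG : IsCodeGroup m η g h G) {k : ℕ} (hk : k < 2 * (4 ^ m + 1)) :
    polyPhase η G (generatorPoly (4 ^ m + 1) η (liftPoly g * h) k) =
      phase G (fun i => lo η (generator (4 ^ m + 1) η (liftPoly g).coeff h.coeff k i))
        (fun i => hi (generator (4 ^ m + 1) η (liftPoly g).coeff h.coeff k i)) := by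
  unfold polyPhase
  congr 1 <;> funext i <;> rw [coeff_generatorPoly (Nat.succ_pos _) hG.pair.natDegree_left_le
    hG.pair.natDegree_le hk i.2] <;> rfl

/-- The entries of the description. -/
structure IsInput (n : ℕ) (η : F4) (g h : ℕ → F4) (ph : ℕ → ℕ) (inp : ℕ → ℕ) : Prop where
  pos : 0 < n
  zero : inp 0 = n
  left : ∀ k ≤ n, (inp (1 + k) : F4) = g k
  right : ∀ k ≤ n, (inp (n + 2 + k) : F4) + η * (inp (2 * n + 3 + k) : F4) = h k
  phase : ∀ k < 2 * n, inp (3 * n + 4 + k) = ph k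
  bound : ∀ i, inp i ≤ max n 3
  eq_zero : ∀ i, 5 * n + 4 ≤ i → inp i = 0

theorem getD_append_ite {α : Type*} (l l' : List α) (d : α) (i : ℕ) :
    (l ++ l').getD i d = if i < l.length then l.getD i d else l'.getD (i - l.length) d := by
  split_ifs with h
  · exact List.getD_append _ _ _ _ h
  · exact List.getD_append_right _ _ _ _ (not_lt.1 h)

theorem getD_map_range {N : ℕ} (f : ℕ → ℕ) (i : ℕ) :
    ((List.range N).map f).getD i 0 = if i < N then f i else 0 := by
  split_ifs with h <;> simp [List.getD_eq_getElem?_getD, h]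

theorem description_getD {n : ℕ} (η : F4) (g : (ZMod 2)[X]) (h : F4[X])
    (G : Subgroup (Qubits n ≃ₗ[ℂ] Qubits n)) (i : ℕ) :
    (description η g h G).getD i 0 =
      if i < 1 then n
      else if i < n + 2 then (g.coeff (i - 1)).val
      else if i < 2 * n + 3 then loBit η (h.coeff (i - (n + 2)))
      else if i < 3 * n + 4 then hiBit (h.coeff (i - (2 * n + 3)))
      else if i < 5 * n + 4 then polyPhase η G (generatorPoly n η (liftPoly g * h) (i - (3 * n + 4)))
      else 0 := by
  simp only [description, List.append_assoc, getD_append_ite, getD_map_range, List.length_map,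
    List.length_range, List.length_singleton]
  unfold generatorPoly
  rcases lt_or_ge i 1 with h1 | h1
  · obtain rfl : i = 0 := by omega
    simp
  rcases lt_or_ge i (n + 2) with h2 | h2
  · rw [if_neg (by omega), if_pos (by omega), if_pos (by omega), if_neg (by omega), if_pos (by omega)]
  rcases lt_or_ge i (2 * n + 3) with h3 | h3
  · rw [if_neg (by omega), if_neg (by omega), if_pos (by omega), if_pos (by omega),
      if_neg (by omega), if_neg (by omega), if_pos (by omega)]
    congr 2; omega
  rcases lt_or_ge i (3 * n + 4) with h4 | h4
  · rw [if_neg (by omega), if_neg (by omega), if_neg (by omega), if_pos (by omega),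
      if_pos (by omega), if_neg (by omega), if_neg (by omega), if_neg (by omega), if_pos (by omega)]
    congr 2; omega
  rw [if_neg (by omega), if_neg (by omega), if_neg (by omega), if_neg (by omega),
    if_neg (by omega : ¬ i < 1), if_neg (by omega : ¬ i < n + 2), if_neg (by omega : ¬ i < 2 * n + 3),
    if_neg (by omega : ¬ i < 3 * n + 4)]
  have e : i - 1 - (n + 1) - (n + 1) - (n + 1) = i - (3 * n + 4) := by omega
  rw [e]
  rcases lt_or_ge i (5 * n + 4) with h6 | h6
  · rw [if_pos h6]
    split_ifs <;> first | rfl | omega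
  · rw [if_neg (by omega : ¬ i < 5 * n + 4)]
    split_ifs <;> first | rfl | omega

theorem isInput_description {n : ℕ} (hn : 0 < n) (hη : η ^ 2 + η + 1 = 0) (g : (ZMod 2)[X])
    (h : F4[X]) {G : Subgroup (Qubits n ≃ₗ[ℂ] Qubits n)}
    (hph : ∀ k < 2 * n, polyPhase η G (generatorPoly n η (liftPoly g * h) k) < 4) :
    IsInput n η (liftPoly g).coeff h.coeff
      (fun k => polyPhase η G (generatorPoly n η (liftPoly g * h) k))
      (fun i => (description η g h G).getD i 0) := by
  have hd := description_getD η g h G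
  refine ⟨hn, ?_, fun k hk => ?_, fun k hk => ?_, fun k hk => ?_, fun i => ?_, fun i hi => ?_⟩
  · exact (hd 0).trans (if_pos one_pos)
  · rw [hd, if_neg (by omega), if_pos (by omega), liftPoly, coeff_map, algebraMap_eq_cast_val]
    congr 4; omega
  · rw [hd, hd, if_neg (by omega), if_neg (by omega), if_pos (by omega), if_neg (by omega),
      if_neg (by omega), if_neg (by omega), if_pos (by omega),
      show n + 2 + k - (n + 2) = k by omega, show 2 * n + 3 + k - (2 * n + 3) = k by omega]
    conv_rhs => rw [← lo_add_hi hη (h.coeff k)]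
    rw [lo, hi, map_natCast, map_natCast]
  · rw [hd, if_neg (by omega), if_neg (by omega), if_neg (by omega), if_neg (by omega),
      if_pos (by omega), show 3 * n + 4 + k - (3 * n + 4) = k by omega]
  · rw [hd]
    split_ifs with h1 h2 h3 h4 h5
    · exact le_max_left _ _
    · exact le_max_of_le_right (by have := (g.coeff (i - 1)).val_lt; omega)
    · exact le_max_of_le_right (by have := loBit_lt (η := η) (h.coeff (i - (n + 2))); omega)
    · exact le_max_of_le_right (by have := hiBit_lt (h.coeff (i - (2 * n + 3))); omega)
    · exact le_max_of_le_right (by have := hph (i - (3 * n + 4)) (by omega); omega)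
    · exact Nat.zero_le _
  · rw [hd, if_neg (by omega), if_neg (by omega), if_neg (by omega), if_neg (by omega),
      if_neg (by omega)]

theorem IsCodeGroup.isInput (hG : IsCodeGroup m η g h G) (hη : η ^ 2 + η + 1 = 0) :
    IsInput (4 ^ m + 1) η (liftPoly g).coeff h.coeff
      (fun k => polyPhase η G (generatorPoly (4 ^ m + 1) η (liftPoly g * h) k))
      (fun i => (description η g h G).getD i 0) :=
  isInput_description (Nat.succ_pos _) hη g h fun _ hk => by
    rw [hG.polyPhase_eq hk]
    exact (phase_spec hG.gottesman (hG.generator_mem hη hk)).2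

end codeGroup

/-! ### The generators and the linear systems -/

/-- The length of the code. -/
def Base.size (b : Base) : ℕ := b.inp 0

/-- The coefficients of `g`. -/
noncomputable def Base.left (b : Base) (a : ℕ) : F4 := (b.inp (1 + a) : F4)

/-- The coefficients of `h`. -/
noncomputable def Base.right (b : Base) (a : ℕ) : F4 :=
  (b.inp (b.size + 2 + a) : F4) + b.η * (b.inp (2 * b.size + 3 + a) : F4)

section closure

variable {α : Type} [Ctx α]

theorem PF.size : PF fun x : α => (Ctx.base x).size := PF.inp (PF.const 0)

theorem PF4.left {f : α → ℕ} (hf : PF f) : PF4 fun x => (Ctx.base x).left (f x) :=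
  PF4.natCast (PF.inp ((PF.const 1).add hf))

theorem PF4.right {f : α → ℕ} (hf : PF f) : PF4 fun x => (Ctx.base x).right (f x) :=
  PF4.add (PF4.natCast (PF.inp ((PF.size.add (PF.const 2)).add hf)))
    (PF4.eta.mul (PF4.natCast (PF.inp ((((PF.const 2).mul PF.size).add (PF.const 3)).add hf))))

theorem PF4.check {k i : α → ℕ} (hk : PF k) (hi : PF i) : PF4 fun x =>
    QuantumBCH.check (Ctx.base x).size (Ctx.base x).left (Ctx.base x).right (k x) (i x) :=
  PF4.sum (f := fun x a => ∑ b ∈ Finset.range ((Ctx.base x).size + 1),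
      if (a + b + k x) % (Ctx.base x).size = i x then
        (Ctx.base x).left a * (Ctx.base x).right b else 0) (PF.size.add (PF.const 1))
    (PF4.sum (f := fun (x : α × ℕ) b =>
        if (x.2 + b + k x.1) % (Ctx.base x.1).size = i x.1 then
          (Ctx.base x.1).left x.2 * (Ctx.base x.1).right b else 0) (PF.size.wk.add (PF.const 1))
      (PF4.ite (PD.eq (((PF.snd.wk.add PF.snd).add hk.wk.wk).mod PF.size.wk.wk) hi.wk.wk)
        (PF4.mul (PF4.left PF.snd.wk) (PF4.right PF.snd)) PF4.zero))

theorem PF4.mulMat {c : α → ℕ → F4} {w x x' : α → ℕ} (hc : PF4 fun a : α × ℕ => c a.1 a.2)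
    (hw : PF w) (hx : PF x) (hx' : PF x') :
    PF4 fun a => QuantumBCH.mulMat (Ctx.base a).size (c a) (w a) (x a) (x' a) :=
  PF4.sum (f := fun a y => if (x' a + y * w a) % (Ctx.base a).size = x a then c a y else 0)
    (PF.size.add (PF.const 1))
    (PF4.ite (PD.eq ((hx'.wk.add (PF.snd.mul hw.wk)).mod PF.size.wk) hx.wk) hc PF4.zero)

theorem PF4.generator {k i : α → ℕ} (hk : PF k) (hi : PF i) : PF4 fun x =>
    QuantumBCH.generator (Ctx.base x).size (Ctx.base x).η (Ctx.base x).left (Ctx.base x).right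
      (k x) (i x) :=
  PF4.mul (PF4.ite (PD.lt hk PF.size) PF4.one PF4.eta) (PF4.check (hk.mod PF.size) hi)

end closure

/-- Tabulation of a function that does not depend on the previous entries. -/
theorem exists_fill (a : Fin 8) {b : Base → ℕ} {f : Base × ℕ → ℕ} (hb : PF b) (hf : PF f) :
    ∃ (s : ℕ) (c : ℕ[X]) (P : ℕ → Program), ∀ W : Machine, s ≤ W.S →
      ∀ {η : F4} (hη : η ^ 2 + η + 1 = 0) (D : Fin 8 → ℕ → ℕ) (ψ : QState) (B : ℕ),
      W.Bounded B D → (∀ j < b (W.base hη D), f (W.base hη D, j) ≤ B) →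
      (∀ Z j, f (W.base hη (Function.update D a Z), j) = f (W.base hη D, j)) →
      W.RunsD (P W.S) (c.eval B) D ψ fun D' ψ' => ψ' = ψ ∧ W.Bounded B D' ∧
        D' = Function.update D a fun i =>
          if i < b (W.base hη D) then f (W.base hη D, i) else D a i := by
  obtain ⟨s, c, P, h⟩ := exists_tab a hb hf
  exact ⟨s, c, P, fun W hS η hη D ψ B hB hfB hind =>
    h W hS hη D ψ B (fun j => f (W.base hη D, j)) hB fun j hj => ⟨hfB j hj, hind _ j⟩⟩

/-- The program that computes the generators of the underlying set. -/
theorem exists_generators :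
    ∃ (s : ℕ) (c : ℕ[X]) (P : ℕ → Program), ∀ W : Machine, s ≤ W.S →
      ∀ {η : F4} (hη : η ^ 2 + η + 1 = 0) (D : Fin 8 → ℕ → ℕ) (ψ : QState) (B : ℕ),
      W.Bounded B D → 3 ≤ B →
      W.RunsD (P W.S) (c.eval B) D ψ fun D' ψ' => ψ' = ψ ∧ W.Bounded B D' ∧
        (∀ a ≠ 0, D' a = D a) ∧ ∀ k < 2 * W.n, ∀ i < W.n, D' 0 (k * W.n + i) =
          enc η (generator W.n η (W.base hη D).left (W.base hη D).right k i) := by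
  obtain ⟨s, c, P, h⟩ := exists_fill 0 (b := fun b => 2 * b.size * b.size)
    (f := fun x => enc x.1.η (generator x.1.size x.1.η x.1.left x.1.right (x.2 / x.1.size)
      (x.2 % x.1.size))) (((PF.const 2).mul PF.size).mul PF.size)
    (PF4.generator (PF.snd.div PF.size) (PF.snd.mod PF.size))
  refine ⟨s, c, P, fun W hS η hη D ψ B hB h3 => (h W hS hη D ψ B hB (fun j _ => ?_)
    (fun Z j => rfl)).mono le_rfl ?_⟩
  · exact (Nat.le_of_lt_succ (enc_lt hη _)).trans h3
  · rintro D' ψ' ⟨rfl, hB', rfl⟩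
    refine ⟨rfl, hB', fun a ha => Function.update_of_ne ha _ _, fun k hk i hi => ?_⟩
    have hsize : (W.base hη D).size = W.n := W.inp_zero
    rw [Function.update_self, if_pos]
    · simp only [hsize, mul_add_mod_of_lt hi, mul_add_div_of_lt hi]
      rfl
    · simp only [hsize]
      have := Nat.mul_le_mul_right W.n (Nat.succ_le_of_lt hk)
      rw [Nat.succ_mul] at this
      omega

/-- Solutions of the parity check equations with the syndrome in array 1 that vanish at the
positions marked in array 5. -/
structure IsSolution (n : ℕ) (η : F4) (D : Fin 8 → ℕ → ℕ) (x : ℕ → F4) : Prop where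
  check : ∀ s < n, ∑ j ∈ Finset.range n, x j * dec η (D 0 (s * n + j)) ^ 2 =
    (D 1 (n + s) : F4) + η * (D 1 s : F4)
  mark : ∀ j < n, (D 5 j : F4) * x j = 0

/-- The homogeneous linear equations for solutions. -/
noncomputable def solveRow (b : Base) (_ s j : ℕ) : F4 :=
  if s < b.size then
    if j < b.size then dec b.η (b.data 0 (s * b.size + j)) * dec b.η (b.data 0 (s * b.size + j))
    else (b.data 1 (b.size + s) : F4) + b.η * (b.data 1 s : F4)
  else if j = s - b.size then (b.data 5 j : F4) else 0

theorem PFB₃.solveRow : PFB₃ solveRow := fun β _ x y z hx hy hz => by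
  have hd : PF4 fun b : β => dec (Ctx.base b).η
      ((Ctx.base b).data 0 (y b * (Ctx.base b).size + z b)) :=
    PF4.dec (PF.rd 0 ((hy.mul PF.size).add hz))
  exact PF4.ite (PD.lt hy PF.size) (PF4.ite (PD.lt hz PF.size) (hd.mul hd)
    ((PF4.natCast (PF.rd 1 (PF.size.add hy))).add
      (PF4.eta.mul (PF4.natCast (PF.rd 1 hy)))))
    (PF4.ite (PD.eq hz (hy.sub PF.size)) (PF4.natCast (PF.rd 5 hz)) PF4.zero)

/-- The inhomogeneous system is made homogeneous by an extra coordinate with index n, whose column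
holds the syndrome. Division by this coordinate gives back a solution; signs do not matter in
characteristic 2. -/
theorem isSolution_iff {W : Machine} {η : F4} (hη : η ^ 2 + η + 1 = 0) (D : Fin 8 → ℕ → ℕ)
    {v : ℕ → F4} (hv : v W.n ≠ 0) :
    (∀ s < 2 * W.n, dot (W.n + 1) (solveRow (W.base hη D) 0 s) v = 0) ↔
      IsSolution W.n η D fun j => if j < W.n then v j * (v W.n)⁻¹ else 0 := by
  have hsize : (W.base hη D).size = W.n := W.inp_zero
  have h1 : ∀ s < W.n, dot (W.n + 1) (solveRow (W.base hη D) 0 s) v =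
      ∑ j ∈ Finset.range W.n, v j * dec η (D 0 (s * W.n + j)) ^ 2 +
        ((D 1 (W.n + s) : F4) + η * (D 1 s : F4)) * v W.n := by
    intro s hs
    rw [dot, Finset.sum_range_succ]
    simp only [solveRow, hsize, hs, if_true, lt_self_iff_false, if_false]
    congr 1
    refine Finset.sum_congr rfl fun j hj => ?_
    rw [if_pos (Finset.mem_range.1 hj), mul_comm, sq]
    rfl
  have h2 : ∀ s < W.n, dot (W.n + 1) (solveRow (W.base hη D) 0 (W.n + s)) v = (D 5 s : F4) * v s := by
    intro s hs
    rw [dot]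
    simp only [solveRow, hsize]
    rw [Finset.sum_eq_single s]
    · rw [if_neg (by omega), if_pos (by omega)]
      rfl
    · intro j _ hj
      rw [if_neg (by omega), if_neg (by omega), zero_mul]
    · intro h
      exact absurd (Finset.mem_range.2 (by omega)) h
  have h3 : ∀ s, ∑ j ∈ Finset.range W.n, (if j < W.n then v j * (v W.n)⁻¹ else 0) *
      dec η (D 0 (s * W.n + j)) ^ 2 =
      (∑ j ∈ Finset.range W.n, v j * dec η (D 0 (s * W.n + j)) ^ 2) * (v W.n)⁻¹ := by
    intro s
    rw [Finset.sum_mul]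
    refine Finset.sum_congr rfl fun j hj => ?_
    rw [if_pos (Finset.mem_range.1 hj)]
    ring
  have h4 : ∀ a b : F4, a + b * v W.n = 0 ↔ a * (v W.n)⁻¹ = b := by
    intro a b
    rw [CharTwo.add_eq_zero, mul_inv_eq_iff_eq_mul₀ hv]
  constructor
  · intro h
    refine ⟨fun s hs => ?_, fun j hj => ?_⟩
    · rw [h3, ← h4, ← h1 s hs]
      exact h s (by omega)
    · rw [if_pos hj, ← mul_assoc, ← h2 j hj, h _ (by omega), zero_mul]
  · intro h s hs
    rcases lt_or_ge s W.n with hs' | hs'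
    · rw [h1 s hs', h4, ← h3]
      exact h.check s hs'
    · obtain ⟨j, rfl⟩ := Nat.exists_eq_add_of_le hs'
      have := h.mark j (by omega)
      rw [if_pos (by omega), ← mul_assoc] at this
      rw [h2 j (by omega)]
      exact (mul_eq_zero.1 this).resolve_right (inv_ne_zero hv)

open Classical in
/-- The number of a vector with last coordinate nonzero, among those in the array `Z`. -/
noncomputable def solvePivot (n : ℕ) (η : F4) (Z : ℕ → ℕ) : ℕ :=
  firstIdx (n + 1) fun q => ¬ dec η (Z (elimIdx (n + 1) (2 * n) 0 (2 * n) q n)) = 0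

/-- The solution that is computed from the array `Z`. -/
noncomputable def solveEntry (n : ℕ) (η : F4) (Z : ℕ → ℕ) (i : ℕ) : F4 :=
  if i < n then dec η (Z (elimIdx (n + 1) (2 * n) 0 (2 * n) (solvePivot n η Z) i)) *
    (dec η (Z (elimIdx (n + 1) (2 * n) 0 (2 * n) (solvePivot n η Z) n)))⁻¹ else 0

theorem PF4.solveEntry (k : Fin 8) : PF4 fun x : Base × ℕ =>
    QuantumBCH.solveEntry x.1.size x.1.η (x.1.data k) x.2 := by
  classical
  have hv {α : Type} [Ctx α] {q j : α → ℕ} (hq : PF q) (hj : PF j) : PF4 fun x =>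
      QuantumBCH.dec (Ctx.base x).η ((Ctx.base x).data k (elimIdx ((Ctx.base x).size + 1)
        (2 * (Ctx.base x).size) 0 (2 * (Ctx.base x).size) (q x) (j x))) :=
    PF4.dec (PF.rd k (PF.elimIdx (PF.size.add (PF.const 1)) ((PF.const 2).mul PF.size) (PF.const 0)
      ((PF.const 2).mul PF.size) hq hj))
  have hq0 := PF.firstIdx (α := Base) (p := fun b q => ¬ QuantumBCH.dec b.η (b.data k
      (elimIdx (b.size + 1) (2 * b.size) 0 (2 * b.size) q b.size)) = 0) (PF.size.add (PF.const 1))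
      (hv (α := (Base × ℕ) × ℕ) PF.snd PF.size).eq_zero.not
  have hq : PF fun b : Base => solvePivot b.size b.η (b.data k) := by
    refine hq0.congr fun b => ?_
    unfold solvePivot
    congr!
  have h := PF4.ite (PD.lt (PF.snd (α := Base)) PF.size)
    ((hv hq.wk PF.snd).mul (hv hq.wk PF.size).inv) PF4.zero
  exact h.congr fun x => rfl

/-- The program that solves the linear system. -/
theorem exists_solve (k k' : Fin 8) (h0 : k ≠ 0) (h1 : k ≠ 1) (h5 : k ≠ 5) (hk : k' ≠ k) :
    ∃ (s : ℕ) (c : ℕ[X]) (P : ℕ → Program), ∀ W : Machine, s ≤ W.S →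
      ∀ {η : F4} (_ : η ^ 2 + η + 1 = 0) (D : Fin 8 → ℕ → ℕ) (ψ : QState) (B : ℕ),
      W.Bounded B D → 3 ≤ B → (∃ x, IsSolution W.n η D x) →
      W.RunsD (P W.S) (c.eval B) D ψ fun D' ψ' => ψ' = ψ ∧ W.Bounded B D' ∧
        (∀ a, a ≠ k → a ≠ k' → D' a = D a) ∧
        ∃ r, IsSolution W.n η D r ∧ r W.n = 0 ∧ ∀ i ≤ W.n, D' k' i = enc η (r i) := by
  classical
  have hN : PFB fun b => b.size + 1 := fun β _ => PF.size.add (PF.const 1)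
  obtain ⟨s, c, P, h⟩ := exists_elim k hN (R := fun b => 2 * b.size) (P := fun _ => 1)
    (fun β _ => (PF.const 2).mul PF.size) (fun β _ => PF.const 1) PFB₃.solveRow
  obtain ⟨s', c', P', h'⟩ := exists_fill k' (hN Base) (PF4.solveEntry k)
  refine ⟨max s s', c + c' + 1, fun S => .seq (P S) (P' S),
    fun W hS η hη D ψ B hB hB3 hex => ?_⟩
  have hsize : ∀ D, (W.base hη D).size = W.n := fun D => W.inp_zero
  have r1 := h W ((le_max_left _ _).trans hS) hη D ψ B hB hB3 (fun Z => ⟨rfl, rfl, by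
    funext p s j
    simp only [solveRow, Base.size, Machine.base, Function.update_of_ne h0.symm,
      Function.update_of_ne h1.symm, Function.update_of_ne h5.symm]
    rfl⟩)
  simp only [hsize, Nat.lt_one_iff, forall_eq] at r1
  rw [eval_add, eval_add, eval_one]
  refine r1.seq fun D₁ ψ₁ hD₁ => ?_
  obtain ⟨rfl, hB₁, hkeep, hfam⟩ := hD₁
  refine (h' W ((le_max_right _ _).trans hS) hη D₁ ψ₁ B hB₁ (fun j _ => ?_) (fun Z j => ?_)).mono
    le_rfl ?_
  · exact (Nat.le_of_lt_succ (enc_lt hη _)).trans hB3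
  · simp only [Machine.base, Function.update_of_ne hk.symm]
    rfl
  · rintro D' ψ' ⟨rfl, hB', rfl⟩
    refine ⟨rfl, hB', fun a ha ha' => (Function.update_of_ne ha' _ _).trans (hkeep a ha), ?_⟩
    set row := solveRow (W.base hη D) 0 with hrow
    obtain ⟨x, hx⟩ := hex
    -- A solution extended by the extra coordinate 1 lies in the kernel.
    have hker : ∀ s < 2 * W.n, dot (W.n + 1) (row s) (fun j => if j < W.n then x j else 1) = 0 := by
      refine (isSolution_iff hη D (by simp)).2 ⟨fun s hs => ?_, fun j hj => ?_⟩
      · rw [← hx.check s hs]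
        refine Finset.sum_congr rfl fun j hj => ?_
        simp [Finset.mem_range.1 hj]
      · simp [hj, hx.mark j hj]
    have hdn : ∀ v : ℕ → F4, dot (W.n + 1) (fun j => if j = W.n then 1 else 0) v = v W.n := by
      intro v
      simp [dot]
    -- The last coordinate is a functional that is nonzero on the kernel, so it is nonzero on one of
    -- the computed vectors.
    obtain ⟨q, hqn, hq⟩ := exists_fam row hker (a := fun j => if j = W.n then 1 else 0)
      (by rw [hdn]; simp)
    rw [hdn] at hq
    have hspec := firstIdx_spec (N := W.n + 1) (p := fun q => ¬ dec η (D₁ k (elimIdx (W.n + 1)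
      (2 * W.n) 0 (2 * W.n) q W.n)) = 0) ⟨q, hqn, by rwa [hfam q hqn W.n (by omega)]⟩
    change solvePivot W.n η (D₁ k) < W.n + 1 ∧
      ¬ dec η (D₁ k (elimIdx (W.n + 1) (2 * W.n) 0 (2 * W.n) (solvePivot W.n η (D₁ k)) W.n)) = 0 ∧ _
      at hspec
    have hne := hspec.2.1
    rw [hfam _ hspec.1 W.n (by omega)] at hne
    refine ⟨_, (isSolution_iff hη D hne).1 fun s hs => fam_dot row hs hspec.1, by simp,
      fun i hi => ?_⟩
    rw [Function.update_self]
    refine (if_pos (show i < (W.base hη D₁).size + 1 by rw [hsize]; omega)).trans ?_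
    change enc η (solveEntry (W.base hη D₁).size η (D₁ k) i) = _
    rw [hsize]
    rw [solveEntry, hfam _ hspec.1 i (by omega), hfam _ hspec.1 W.n (by omega)]

/-! ### The linear systems for the error locators -/

theorem sum_range_mul {M : Type*} [AddCommMonoid M] {n : ℕ} (a : ℕ) (f : ℕ → ℕ → M) :
    ∑ j ∈ Finset.range (a * n), f (j / n) (j % n) =
      ∑ k ∈ Finset.range a, ∑ x ∈ Finset.range n, f k x := by
  induction a with
  | zero => simp
  | succ a ih =>
    rw [add_mul, one_mul, Finset.sum_range_add, ih, Finset.sum_range_succ]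
    congr 1
    refine Finset.sum_congr rfl fun x hx => ?_
    have hx := Finset.mem_range.1 hx
    rw [mul_add_div_of_lt hx, mul_add_mod_of_lt hx]

theorem dot_blocks {n : ℕ} (f : ℕ → ℕ → F4) (v : ℕ → F4) :
    dot (n * n) (fun j => f (j / n) (j % n)) v =
      ∑ k ∈ Finset.range n, ∑ x ∈ Finset.range n, f k x * v (k * n + x) := by
  rw [← sum_range_mul, dot]
  exact Finset.sum_congr rfl fun j _ => by rw [Nat.div_add_mod']

/-- The entry of the linear system for `(l, t)` in the row `(τ, i, k, x)` and the column
`(k', x')`. -/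
noncomputable def locCoeff (n : ℕ) (h r : ℕ → F4) (l t τ i k x k' x' : ℕ) : F4 :=
  if τ = 0 then if k' = k ∧ 0 < i then mulMat n (ones n) i x x' else 0
  else if τ = 1 then if k' = k ∧ i < 2 * t then mulMat n h (l + i) x x' else 0
  else if τ = 2 then if i < t then mulMat n r (l + i + k') x x' else 0
  else if k' = k ∧ t < k ∧ x' = x then 1 else 0

/-- The element of `𝔽₄[X]/(Xⁿ - 1)` in the block `k` of a vector. -/
noncomputable def block (n : ℕ) (v : ℕ → F4) (k : ℕ) : Cyc n := vec n fun x => v (k * n + x)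

theorem exists_block {n : ℕ} (hn : 0 < n) (Λ : ℕ → Cyc n) : ∃ v, ∀ k, block n v k = Λ k := by
  choose w hw using fun k => exists_vec hn (Λ k)
  refine ⟨fun j => w (j / n) (j % n), fun k => ?_⟩
  rw [← hw k, block, vec, vec]
  refine Finset.sum_congr rfl fun x hx => ?_
  have hx := Finset.mem_range.1 hx
  rw [mul_add_div_of_lt hx, mul_add_mod_of_lt hx]

theorem vec_sum {n : ℕ} {ι : Type*} (s : Finset ι) (f : ι → ℕ → F4) :
    vec n (fun x => ∑ k ∈ s, f k x) = ∑ k ∈ s, vec n (f k) := by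
  simp only [vec, Finset.sum_smul]
  exact Finset.sum_comm

theorem evalXi_mul_block_eq_zero {n : ℕ} (hn : 0 < n) (c : ℕ → F4) (w : ℕ) (v : ℕ → F4) (k : ℕ) :
    evalXi n c w * block n v k = 0 ↔
      ∀ x < n, ∑ x' ∈ Finset.range n, mulMat n c w x x' * v (k * n + x') = 0 := by
  rw [block, evalXi_mul_vec hn, vec_eq_zero hn]

theorem sum_evalXi_mul_block_eq_zero {n : ℕ} (hn : 0 < n) (c : ℕ → F4) (w : ℕ → ℕ) (v : ℕ → F4) :
    ∑ k ∈ Finset.range n, evalXi n c (w k) * block n v k = 0 ↔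
      ∀ x < n, ∑ k ∈ Finset.range n, ∑ x' ∈ Finset.range n,
        mulMat n c (w k) x x' * v (k * n + x') = 0 := by
  simp only [block, evalXi_mul_vec hn]
  rw [← vec_sum, vec_eq_zero hn]

/-- The values 0, 1, 2, 3 of τ encode the conditions `prim`, `root`, `key` and `deg`. For τ = 2 the
index k, and for τ = 3 the index i, only repeats equations, which allows a uniform numbering of the
rows. -/
theorem isLocator_block_iff {n : ℕ} (hn : 0 < n) (h r : ℕ → F4) (l t : ℕ) (v : ℕ → F4) :
    (∀ τ < 4, ∀ i < n, ∀ k < n, ∀ x < n,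
      dot (n * n) (fun j => locCoeff n h r l t τ i k x (j / n) (j % n)) v = 0) ↔
      IsLocator n h r l t (block n v) := by
  have hsum : ∀ {k : ℕ} (_ : k < n) (q : Prop) [Decidable q] (f : ℕ → F4),
      ∑ k' ∈ Finset.range n, ∑ x' ∈ Finset.range n,
        (if k' = k ∧ q then f x' else 0) * v (k' * n + x') =
      if q then ∑ x' ∈ Finset.range n, f x' * v (k * n + x') else 0 := by
    intro k hk q _ f
    rw [Finset.sum_eq_single_of_mem k (Finset.mem_range.2 hk)]
    · by_cases hq : q <;> simp [hq]
    · intro k' _ hne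
      simp [hne]
  have e0 : ∀ i, ∀ k < n, ∀ x,
      dot (n * n) (fun j => locCoeff n h r l t 0 i k x (j / n) (j % n)) v =
      if 0 < i then ∑ x' ∈ Finset.range n, mulMat n (ones n) i x x' * v (k * n + x') else 0 := by
    intro i k hk x
    rw [dot_blocks (locCoeff n h r l t 0 i k x)]
    simp only [locCoeff, if_true]
    exact hsum hk _ _
  have e1 : ∀ i, ∀ k < n, ∀ x,
      dot (n * n) (fun j => locCoeff n h r l t 1 i k x (j / n) (j % n)) v =
      if i < 2 * t then ∑ x' ∈ Finset.range n, mulMat n h (l + i) x x' * v (k * n + x') else 0 := by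
    intro i k hk x
    rw [dot_blocks (locCoeff n h r l t 1 i k x)]
    simp only [locCoeff, one_ne_zero, if_false, if_true]
    exact hsum hk _ _
  have e2 : ∀ i k x,
      dot (n * n) (fun j => locCoeff n h r l t 2 i k x (j / n) (j % n)) v =
      if i < t then ∑ k' ∈ Finset.range n, ∑ x' ∈ Finset.range n,
        mulMat n r (l + i + k') x x' * v (k' * n + x') else 0 := by
    intro i k x
    rw [dot_blocks (locCoeff n h r l t 2 i k x)]
    simp only [locCoeff, OfNat.ofNat_ne_zero, OfNat.ofNat_ne_one, if_false, if_true]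
    split_ifs <;> simp
  have e3 : ∀ i, ∀ k < n, ∀ x < n,
      dot (n * n) (fun j => locCoeff n h r l t 3 i k x (j / n) (j % n)) v =
      if t < k then v (k * n + x) else 0 := by
    intro i k hk x hx
    rw [dot_blocks (locCoeff n h r l t 3 i k x)]
    have : ∀ k' x', locCoeff n h r l t 3 i k x k' x' =
        if k' = k ∧ t < k then (if x' = x then 1 else 0) else 0 := by
      intro k' x'
      simp only [locCoeff]
      norm_num
      split_ifs <;> first | rfl | (exfalso; tauto)
    simp only [this]
    rw [hsum hk]
    simp [hx]
  constructor
  · intro H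
    refine ⟨fun k hk i hi hi0 => ?_, fun k hk i hi hit => ?_, fun i hi hit => ?_, fun k hk ht => ?_⟩
    · refine (evalXi_mul_block_eq_zero hn _ _ _ _).2 fun x hx => ?_
      have := H 0 (by omega) i hi k hk x hx
      rwa [e0 i k hk x, if_pos hi0] at this
    · refine (evalXi_mul_block_eq_zero hn _ _ _ _).2 fun x hx => ?_
      have := H 1 (by omega) i hi k hk x hx
      rwa [e1 i k hk x, if_pos hit] at this
    · refine (sum_evalXi_mul_block_eq_zero hn _ _ _).2 fun x hx => ?_
      have := H 2 (by omega) i hi 0 hn x hx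
      rwa [e2 i 0 x, if_pos hit] at this
    · refine (vec_eq_zero hn).2 fun x hx => ?_
      have := H 3 (by omega) 0 hn k hk x hx
      rwa [e3 0 k hk x hx, if_pos ht] at this
  · intro H τ hτ i hi k hk x hx
    interval_cases τ
    · rw [e0 i k hk x]
      split_ifs with h0
      · exact (evalXi_mul_block_eq_zero hn _ _ _ _).1 (H.prim k hk i hi h0) x hx
      · rfl
    · rw [e1 i k hk x]
      split_ifs with h0
      · exact (evalXi_mul_block_eq_zero hn _ _ _ _).1 (H.root k hk i hi h0) x hx
      · rfl
    · rw [e2 i k x]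
      split_ifs with h0
      · exact (sum_evalXi_mul_block_eq_zero hn _ _ _).1 (H.key i hi h0) x hx
      · rfl
    · rw [e3 i k hk x hx]
      split_ifs with h0
      · exact (vec_eq_zero hn).1 (H.deg k hk h0) x hx
      · rfl

/-- The coefficients of `X`. -/
noncomputable def delta (y : ℕ) : F4 := if y = 1 then 1 else 0

theorem evalXi_delta {n : ℕ} (hn : 0 < n) (w : ℕ) : evalXi n delta w = xi n ^ w := by
  rw [evalXi, Finset.sum_eq_single_of_mem 1 (Finset.mem_range.2 (by omega))]
  · simp [delta]
  · intro y _ hy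
    simp [delta, hy]

theorem sum_xi_mul_block_ne_zero {n : ℕ} (hn : 0 < n) (i : ℕ) (v : ℕ → F4) :
    ∑ k ∈ Finset.range n, xi n ^ (i * k) * block n v k ≠ 0 ↔
      ∃ x < n, dot (n * n) (fun j => mulMat n delta (i * (j / n)) x (j % n)) v ≠ 0 := by
  simp only [← evalXi_delta hn]
  rw [Ne, sum_evalXi_mul_block_eq_zero hn]
  push Not
  refine exists_congr fun x => and_congr_right fun _ => ?_
  rw [dot_blocks fun k x' => mulMat n delta (i * k) x x']

/-- Existence questions about the kernel are decided on the finitely many computed vectors, as soon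
as they are expressed by linear functionals. -/
theorem exists_fam_iff {N : ℕ} (row : ℕ → ℕ → F4) (s : ℕ) (a : ℕ → F4) :
    (∃ q < N, dot N a (fam N row s q) ≠ 0) ↔
      ∃ v, (∀ s' < s, dot N (row s') v = 0) ∧ dot N a v ≠ 0 :=
  ⟨fun ⟨_, hq, h⟩ => ⟨_, fun _ hs => fam_dot row hs hq, h⟩, fun ⟨_, hv, h⟩ => exists_fam row hv h⟩

/-- The number of rows of the linear systems for the error locators. -/
def locRows (n : ℕ) : ℕ := 4 * n * n * n

/-- The rows of the linear systems for the error locators. -/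
noncomputable def locRow (b : Base) (p s j : ℕ) : F4 :=
  locCoeff b.size b.right (fun i => dec b.η (b.data 3 i)) (p % b.size) (p / b.size)
    (s / b.size / b.size / b.size) (s / b.size / b.size % b.size) (s / b.size % b.size)
    (s % b.size) (j / b.size) (j % b.size)

/-- A row number below 4n³ is the same as its digits τ, i, k and x. -/
theorem forall_lt_locRows {n : ℕ} (hn : 0 < n) (f : ℕ → ℕ → ℕ → ℕ → Prop) :
    (∀ s < locRows n, f (s / n / n / n) (s / n / n % n) (s / n % n) (s % n)) ↔
      ∀ τ < 4, ∀ i < n, ∀ k < n, ∀ x < n, f τ i k x := by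
  constructor
  · intro h τ hτ i hi k hk x hx
    have := h (((τ * n + i) * n + k) * n + x) ?_
    · rwa [mul_add_div_of_lt hx, mul_add_mod_of_lt hx, mul_add_div_of_lt hk, mul_add_mod_of_lt hk,
        mul_add_div_of_lt hi, mul_add_mod_of_lt hi] at this
    · unfold locRows
      refine Nat.lt_of_div_lt_div (c := n) ?_
      rw [mul_add_div_of_lt hx, Nat.mul_div_cancel _ hn]
      refine Nat.lt_of_div_lt_div (c := n) ?_
      rw [mul_add_div_of_lt hk, Nat.mul_div_cancel _ hn]
      refine Nat.lt_of_div_lt_div (c := n) ?_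
      rwa [mul_add_div_of_lt hi, Nat.mul_div_cancel _ hn]
  · intro h s hs
    refine h _ ?_ _ (Nat.mod_lt _ hn) _ (Nat.mod_lt _ hn) _ (Nat.mod_lt _ hn)
    unfold locRows at hs
    rw [Nat.div_lt_iff_lt_mul hn, Nat.div_lt_iff_lt_mul hn, Nat.div_lt_iff_lt_mul hn]
    exact hs

theorem forall_locRow_iff {b : Base} (hn : 0 < b.size) (p : ℕ) (v : ℕ → F4) :
    (∀ s < locRows b.size, dot (b.size * b.size) (locRow b p s) v = 0) ↔
      IsLocator b.size b.right (fun i => dec b.η (b.data 3 i)) (p % b.size) (p / b.size)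
        (block b.size v) := by
  rw [← isLocator_block_iff hn]
  exact forall_lt_locRows hn fun τ i k x => dot (b.size * b.size) (fun j => locCoeff b.size b.right
    (fun i => dec b.η (b.data 3 i)) (p % b.size) (p / b.size) τ i k x (j / b.size) (j % b.size)) v = 0

section closure

variable {α : Type} [Ctx α]

theorem PF4.ones {y : α → ℕ} (hy : PF y) : PF4 fun x => QuantumBCH.ones (Ctx.base x).size (y x) :=
  PF4.ite (PD.lt hy PF.size) PF4.one PF4.zero

theorem PF4.delta {y : α → ℕ} (hy : PF y) : PF4 fun x => QuantumBCH.delta (y x) :=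
  PF4.ite (PD.eq hy (PF.const 1)) PF4.one PF4.zero

end closure

theorem PFB₃.locRow : PFB₃ locRow := fun β _ p s j hp hs hj => by
  have hl := hp.mod PF.size
  have ht := hp.div PF.size
  have hτ := ((hs.div PF.size).div PF.size).div PF.size
  have hi := ((hs.div PF.size).div PF.size).mod PF.size
  have hk := (hs.div PF.size).mod PF.size
  have hx := hs.mod PF.size
  have hk' := hj.div PF.size
  have hx' := hj.mod PF.size
  have m0 := PF4.mulMat (c := fun b : β => ones (Ctx.base b).size) (PF4.ones PF.snd) hi hx hx'
  have m1 := PF4.mulMat (c := fun b : β => (Ctx.base b).right) (PF4.right PF.snd) (hl.add hi) hx hx'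
  have m2 := PF4.mulMat (c := fun (b : β) i => dec (Ctx.base b).η ((Ctx.base b).data 3 i))
    (PF4.dec (PF.rd 3 PF.snd)) ((hl.add hi).add hk') hx hx'
  exact PF4.ite (PD.eq hτ (PF.const 0))
    (PF4.ite (PD.and (PD.eq hk' hk) (PD.lt (PF.const 0) hi)) m0 PF4.zero)
    (PF4.ite (PD.eq hτ (PF.const 1))
      (PF4.ite (PD.and (PD.eq hk' hk) (PD.lt hi ((PF.const 2).mul ht))) m1 PF4.zero)
      (PF4.ite (PD.eq hτ (PF.const 2)) (PF4.ite (PD.lt hi ht) m2 PF4.zero)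
        (PF4.ite (PD.and (PD.eq hk' hk) (PD.and (PD.lt ht hk) (PD.eq hx' hx))) PF4.one PF4.zero)))

/-! ### The error positions -/

/-- The number of pairs `(l, t)`. -/
def numPairs (n : ℕ) : ℕ := n * (n / 2 + 1)

/-- The vectors that the elimination has written to the array `Z`. -/
noncomputable def locFam (n : ℕ) (η : F4) (Z : ℕ → ℕ) (p q j : ℕ) : F4 :=
  dec η (Z (elimIdx (n * n) (locRows n) p (locRows n) q j))

/-- There are nonzero error locators for the pair `p`. -/
def HasLocator (n : ℕ) (η : F4) (Z : ℕ → ℕ) (p : ℕ) : Prop :=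
  ∃ q < n * n, ∃ j < n * n, ¬ locFam n η Z p q j = 0

open Classical in
/-- The last pair with nonzero error locators. -/
noncomputable def lastPair (n : ℕ) (η : F4) (Z : ℕ → ℕ) : ℕ :=
  numPairs n - 1 - firstIdx (numPairs n) fun u => HasLocator n η Z (numPairs n - 1 - u)

open Classical in
/-- The mark of position `i`, which is `1` if some error locator does not vanish at `i`. -/
noncomputable def mark (n : ℕ) (η : F4) (Z : ℕ → ℕ) (i : ℕ) : ℕ :=
  if ∃ q < n * n, ∃ x < n, ¬ dot (n * n) (fun j => mulMat n delta (i * (j / n)) x (j % n))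
    (locFam n η Z (lastPair n η Z) q) = 0 then 1 else 0

section closure

variable {α : Type} [Ctx α]

theorem PF.locRows : PF fun x : α => QuantumBCH.locRows (Ctx.base x).size :=
  (((PF.const 4).mul PF.size).mul PF.size).mul PF.size

theorem PF.numPairs : PF fun x : α => QuantumBCH.numPairs (Ctx.base x).size :=
  PF.size.mul ((PF.size.div (PF.const 2)).add (PF.const 1))

theorem PF4.locFam (k : Fin 8) {p q j : α → ℕ} (hp : PF p) (hq : PF q) (hj : PF j) : PF4 fun x =>
    QuantumBCH.locFam (Ctx.base x).size (Ctx.base x).η ((Ctx.base x).data k) (p x) (q x) (j x) :=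
  PF4.dec (PF.rd k (PF.elimIdx (PF.size.mul PF.size) PF.locRows hp PF.locRows hq hj))

theorem PD.hasLocator (k : Fin 8) {p : α → ℕ} (hp : PF p) : PD fun x =>
    HasLocator (Ctx.base x).size (Ctx.base x).η ((Ctx.base x).data k) (p x) :=
  PD.ex (p := fun x q => ∃ j < (Ctx.base x).size * (Ctx.base x).size,
      ¬ QuantumBCH.locFam (Ctx.base x).size (Ctx.base x).η ((Ctx.base x).data k) (p x) q j = 0)
    (PF.size.mul PF.size) (PD.ex (p := fun (x : α × ℕ) j =>
      ¬ QuantumBCH.locFam (Ctx.base x).size (Ctx.base x).η ((Ctx.base x).data k) (p x.1) x.2 j = 0)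
    (PF.size.mul PF.size) (PF4.locFam k hp.wk.wk PF.snd.wk PF.snd).eq_zero.not)

theorem PF.lastPair (k : Fin 8) : PF fun x : α =>
    QuantumBCH.lastPair (Ctx.base x).size (Ctx.base x).η ((Ctx.base x).data k) := by
  classical
  have h := PF.firstIdx (α := α) (p := fun x u => HasLocator (Ctx.base x).size (Ctx.base x).η
    ((Ctx.base x).data k) (QuantumBCH.numPairs (Ctx.base x).size - 1 - u)) PF.numPairs
    (PD.hasLocator (α := (α × ℕ) × ℕ) k ((PF.numPairs.sub (PF.const 1)).sub PF.snd))
  refine ((PF.numPairs.sub (PF.const 1)).sub h).congr fun x => ?_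
  unfold QuantumBCH.lastPair
  congr!

theorem PF.mark (k : Fin 8) {i : α → ℕ} (hi : PF i) : PF fun x : α =>
    QuantumBCH.mark (Ctx.base x).size (Ctx.base x).η ((Ctx.base x).data k) (i x) := by
  classical
  have h1 : PF4 fun y : (α × ℕ) × ℕ => dot ((Ctx.base y).size * (Ctx.base y).size)
      (fun j => QuantumBCH.mulMat (Ctx.base y).size delta (i y.1.1 * (j / (Ctx.base y).size)) y.2
        (j % (Ctx.base y).size))
      (QuantumBCH.locFam (Ctx.base y).size (Ctx.base y).η ((Ctx.base y).data k)
        (QuantumBCH.lastPair (Ctx.base y).size (Ctx.base y).η ((Ctx.base y).data k)) y.1.2) :=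
    PF4.dot (PF.size.mul PF.size)
      (PF4.mulMat (c := fun _ => delta) (PF4.delta PF.snd)
        (hi.wk.wk.wk.mul (PF.snd.div PF.size)) PF.snd.wk (PF.snd.mod PF.size))
      (PF4.locFam k (PF.lastPair k) PF.snd.wk.wk PF.snd)
  have h2 := PD.ex (p := fun (x : α) q => ∃ z < (Ctx.base x).size,
      ¬ dot ((Ctx.base x).size * (Ctx.base x).size)
      (fun j => QuantumBCH.mulMat (Ctx.base x).size delta (i x * (j / (Ctx.base x).size)) z
        (j % (Ctx.base x).size))
      (QuantumBCH.locFam (Ctx.base x).size (Ctx.base x).η ((Ctx.base x).data k)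
        (QuantumBCH.lastPair (Ctx.base x).size (Ctx.base x).η ((Ctx.base x).data k)) q) = 0)
    (PF.size.mul PF.size) (PD.ex (p := fun (x : α × ℕ) z =>
      ¬ dot ((Ctx.base x).size * (Ctx.base x).size)
      (fun j => QuantumBCH.mulMat (Ctx.base x).size delta (i x.1 * (j / (Ctx.base x).size)) z
        (j % (Ctx.base x).size))
      (QuantumBCH.locFam (Ctx.base x).size (Ctx.base x).η ((Ctx.base x).data k)
        (QuantumBCH.lastPair (Ctx.base x).size (Ctx.base x).η ((Ctx.base x).data k)) x.2) = 0)
      PF.size h1.eq_zero.not)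
  refine (PF.ite h2 (PF.const 1) (PF.const 0)).congr fun x => ?_
  unfold QuantumBCH.mark
  congr!

end closure

section

variable {n : ℕ} {η : F4} {Z : ℕ → ℕ} {h r : ℕ → F4}

/-- The pair `(l, t)` has nonzero error locators. -/
def IsGoodPair (n : ℕ) (h r : ℕ → F4) (l t : ℕ) : Prop :=
  ∃ Λ, IsLocator n h r l t Λ ∧ ∃ k < n, Λ k ≠ 0

/-- The array `Z` contains generators of the spaces of error locators. -/
def IsLocatorArray (n : ℕ) (η : F4) (h r : ℕ → F4) (Z : ℕ → ℕ) : Prop :=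
  ∀ p < numPairs n, ∀ a, (∃ q < n * n, ¬ dot (n * n) a (locFam n η Z p q) = 0) ↔
    ∃ v, IsLocator n h r (p % n) (p / n) (block n v) ∧ dot (n * n) a v ≠ 0

theorem evalXi_congr {c c' : ℕ → F4} (hc : ∀ i ≤ n, c i = c' i) (w : ℕ) :
    evalXi n c w = evalXi n c' w := Finset.sum_congr rfl fun i hi => by
  rw [hc i (Nat.lt_succ_iff.1 (Finset.mem_range.1 hi))]

theorem IsLocator.congr {h' r' : ℕ → F4} (hh : ∀ i ≤ n, h i = h' i) (hr : ∀ i ≤ n, r i = r' i)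
    {l t : ℕ} {Λ : ℕ → Cyc n} (H : IsLocator n h r l t Λ) : IsLocator n h' r' l t Λ :=
  ⟨H.prim, by simpa only [evalXi_congr hh] using H.root,
    by simpa only [evalXi_congr hr] using H.key, H.deg⟩

theorem block_ne_zero_iff (hn : 0 < n) (v : ℕ → F4) :
    (∃ k < n, block n v k ≠ 0) ↔ ∃ j < n * n, v j ≠ 0 := by
  simp only [block, Ne, vec_eq_zero hn]
  push Not
  constructor
  · rintro ⟨k, hk, x, hx, h⟩
    refine ⟨_, ?_, h⟩
    have := Nat.mul_le_mul_right n (Nat.succ_le_of_lt hk)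
    rw [Nat.succ_mul] at this
    omega
  · rintro ⟨j, hj, h⟩
    exact ⟨j / n, (Nat.div_lt_iff_lt_mul hn).2 hj, j % n, Nat.mod_lt _ hn, by
      rwa [Nat.div_add_mod']⟩

/-- A locator is nonzero when some coordinate is, and the coordinates are functionals to which the
array condition applies. -/
theorem IsLocatorArray.hasLocator_iff (hn : 0 < n) (hZ : IsLocatorArray n η h r Z) {p : ℕ}
    (hp : p < numPairs n) : HasLocator n η Z p ↔ IsGoodPair n h r (p % n) (p / n) := by
  have hdot : ∀ j < n * n, ∀ v : ℕ → F4, dot (n * n) (fun j' => if j' = j then 1 else 0) v = v j := by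
    intro j hj v
    simp [dot, hj]
  have h1 : HasLocator n η Z p ↔ ∃ j < n * n, ∃ q < n * n, ¬ locFam n η Z p q j = 0 := by
    unfold HasLocator
    constructor
    · rintro ⟨q, hq, j, hj, h⟩
      exact ⟨j, hj, q, hq, h⟩
    · rintro ⟨j, hj, q, hq, h⟩
      exact ⟨q, hq, j, hj, h⟩
  rw [h1]
  constructor
  · rintro ⟨j, hj, q, hq, h⟩
    obtain ⟨v, hv, hv'⟩ := (hZ p hp _).1 ⟨q, hq, by rwa [hdot j hj]⟩
    rw [hdot j hj] at hv'
    exact ⟨_, hv, (block_ne_zero_iff hn v).2 ⟨j, hj, hv'⟩⟩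
  · rintro ⟨Λ, hΛ, hne⟩
    obtain ⟨v, hv⟩ := exists_block hn Λ
    obtain rfl : block n v = Λ := funext hv
    obtain ⟨j, hj, hvj⟩ := (block_ne_zero_iff hn v).1 hne
    obtain ⟨q, hq, hne⟩ := (hZ p hp (fun j' => if j' = j then 1 else 0)).2
      ⟨v, hΛ, by rwa [hdot j hj]⟩
    exact ⟨j, hj, q, hq, by rwa [hdot j hj] at hne⟩

theorem div_le_half (hn : 0 < n) {p : ℕ} (hp : p < numPairs n) : p / n ≤ n / 2 :=
  Nat.le_of_lt_succ ((Nat.div_lt_iff_lt_mul hn).2 (by rwa [numPairs, mul_comm] at hp))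

/-- The pair (l, t) has the number t n + l, so the last good number has the largest good t. The
first-index search runs downwards from the end of the list. -/
theorem IsLocatorArray.lastPair_spec (hn : 0 < n) (hZ : IsLocatorArray n η h r Z)
    (hex : ∃ l < n, ∃ t ≤ n / 2, IsGoodPair n h r l t) :
    lastPair n η Z < numPairs n ∧
      IsGoodPair n h r (lastPair n η Z % n) (lastPair n η Z / n) ∧
      ∀ l < n, ∀ t ≤ n / 2, IsGoodPair n h r l t → t ≤ lastPair n η Z / n := by
  classical
  have hpair : ∀ l < n, ∀ t ≤ n / 2, t * n + l < numPairs n := by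
    intro l hl t ht
    have := Nat.mul_le_mul_left n ht
    rw [numPairs, mul_add, mul_one, mul_comm t]
    omega
  have hgood : ∀ l < n, ∀ t ≤ n / 2, IsGoodPair n h r l t → HasLocator n η Z (t * n + l) := by
    intro l hl t ht hg
    rw [hZ.hasLocator_iff hn (hpair l hl t ht), mul_add_mod_of_lt hl, mul_add_div_of_lt hl]
    exact hg
  obtain ⟨l, hl, t, ht, hlt⟩ := hex
  have h0 := hpair l hl t ht
  have hspec := firstIdx_spec (N := numPairs n)
    (p := fun u => HasLocator n η Z (numPairs n - 1 - u)) ⟨numPairs n - 1 - (t * n + l), by omega, by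
      rw [show numPairs n - 1 - (numPairs n - 1 - (t * n + l)) = t * n + l by omega]
      exact hgood l hl t ht hlt⟩
  have hlast : lastPair n η Z = numPairs n - 1 - firstIdx (numPairs n)
      fun u => HasLocator n η Z (numPairs n - 1 - u) := by
    unfold lastPair
    congr!
  rw [← hlast] at hspec
  have hlt' : lastPair n η Z < numPairs n := by omega
  refine ⟨hlt', (hZ.hasLocator_iff hn hlt').1 hspec.2.1, fun l' hl' t' ht' hg => ?_⟩
  have h1 := hpair l' hl' t' ht'
  rw [Nat.le_div_iff_mul_le hn]
  by_contra hcon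
  refine hspec.2.2 (numPairs n - 1 - (t' * n + l')) (by omega) ?_
  rw [show numPairs n - 1 - (numPairs n - 1 - (t' * n + l')) = t' * n + l' by omega]
  exact hgood l' hl' t' ht' hg

theorem IsLocatorArray.mark_eq (hn : 0 < n) (hZ : IsLocatorArray n η h r Z)
    (hlast : lastPair n η Z < numPairs n) (i : ℕ) [Decidable (∃ Λ,
      IsLocator n h r (lastPair n η Z % n) (lastPair n η Z / n) Λ ∧
        ∑ k ∈ Finset.range n, xi n ^ (i * k) * Λ k ≠ 0)] : mark n η Z i = if ∃ Λ,
      IsLocator n h r (lastPair n η Z % n) (lastPair n η Z / n) Λ ∧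
        ∑ k ∈ Finset.range n, xi n ^ (i * k) * Λ k ≠ 0 then 1 else 0 := by
  classical
  unfold mark
  refine if_congr ?_ rfl rfl
  constructor
  · rintro ⟨q, hq, x, hx, hne⟩
    obtain ⟨v, hv, hv'⟩ := (hZ _ hlast _).1 ⟨q, hq, hne⟩
    exact ⟨_, hv, (sum_xi_mul_block_ne_zero hn i v).2 ⟨x, hx, hv'⟩⟩
  · rintro ⟨Λ, hΛ, hne⟩
    obtain ⟨v, hv⟩ := exists_block hn Λ
    obtain rfl : block n v = Λ := funext hv
    obtain ⟨x, hx, hx'⟩ := (sum_xi_mul_block_ne_zero hn i v).1 hne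
    obtain ⟨q, hq, hne⟩ := (hZ _ hlast _).2 ⟨v, hΛ, hx'⟩
    exact ⟨q, hq, x, hx, hne⟩

end

open Classical in
/-- The program that finds the error positions. -/
theorem exists_marks :
    ∃ (s : ℕ) (c : ℕ[X]) (P : ℕ → Program), ∀ W : Machine, s ≤ W.S →
      ∀ {η : F4} (hη : η ^ 2 + η + 1 = 0) (D : Fin 8 → ℕ → ℕ) (ψ : QState) (B : ℕ) (h r : ℕ → F4),
      W.Bounded B D → 3 ≤ B → (∀ i ≤ W.n, (W.base hη D).right i = h i) →
      (∀ i ≤ W.n, D 3 i = enc η (r i)) →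
      (∃ l < W.n, ∃ t ≤ W.n / 2, IsGoodPair W.n h r l t) →
      W.RunsD (P W.S) (c.eval B) D ψ fun D' ψ' => ψ' = ψ ∧ W.Bounded B D' ∧
        (∀ a, a ≠ 4 → a ≠ 5 → D' a = D a) ∧
        ∃ l t, t ≤ W.n / 2 ∧ IsGoodPair W.n h r l t ∧
          (∀ l' < W.n, ∀ t' ≤ W.n / 2, IsGoodPair W.n h r l' t' → t' ≤ t) ∧
          ∀ i < W.n, D' 5 i = if ∃ Λ, IsLocator W.n h r l t Λ ∧
            ∑ k ∈ Finset.range W.n, xi W.n ^ (i * k) * Λ k ≠ 0 then 1 else 0 := by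
  obtain ⟨s, c, P, hrun⟩ := exists_elim 4 (N := fun b => b.size * b.size)
    (R := fun b => locRows b.size) (P := fun b => numPairs b.size)
    (fun β _ => PF.size.mul PF.size) (fun β _ => PF.locRows) (fun β _ => PF.numPairs) PFB₃.locRow
  obtain ⟨s', c', P', hrun'⟩ := exists_fill 5 (b := Base.size) (PF.size (α := Base))
    (PF.mark (α := Base × ℕ) 4 PF.snd)
  refine ⟨max s s', c + c' + 1, fun S => .seq (P S) (P' S),
    fun W hS η hη D ψ B h r hB hB3 hh hr hex => ?_⟩
  have hsize : ∀ D, (W.base hη D).size = W.n := fun D => W.inp_zero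
  have r1 := hrun W ((le_max_left _ _).trans hS) hη D ψ B hB hB3 (fun Z => ⟨rfl, rfl, rfl⟩)
  rw [eval_add, eval_add, eval_one]
  refine r1.seq fun D₁ ψ₁ hD₁ => ?_
  obtain ⟨rfl, hB₁, hkeep, hfam⟩ := hD₁
  refine (hrun' W ((le_max_right _ _).trans hS) hη D₁ ψ₁ B hB₁ (fun j _ => ?_) (fun Z j => rfl)).mono
    le_rfl ?_
  · unfold mark
    split_ifs <;> omega
  · rintro D' ψ' ⟨rfl, hB', rfl⟩
    have hloc : IsLocatorArray W.n η h r (D₁ 4) := by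
      intro p hp a
      simp only [hsize] at hfam
      have h1 : ∀ q < W.n * W.n, dot (W.n * W.n) a (locFam W.n η (D₁ 4) p q) =
          dot (W.n * W.n) a (fam (W.n * W.n) (locRow (W.base hη D) p) (locRows W.n) q) :=
        fun q hq => dot_congr fun j hj => hfam p hp q hq j hj
      have h2 : ∀ v, (∀ s < locRows W.n, dot (W.n * W.n) (locRow (W.base hη D) p s) v = 0) ↔
          IsLocator W.n h r (p % W.n) (p / W.n) (block W.n v) := by
        intro v
        have h3 := forall_locRow_iff (b := W.base hη D) (by rw [hsize]; exact W.n_pos) p v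
        rw [hsize] at h3
        rw [h3]
        have hr' : ∀ i ≤ W.n, dec η (D 3 i) = r i := fun i hi => by rw [hr i hi, dec_enc hη]
        exact ⟨fun H => H.congr hh hr', fun H => H.congr (fun i hi => (hh i hi).symm)
          fun i hi => (hr' i hi).symm⟩
      simp only [← h2]
      rw [← exists_fam_iff]
      exact exists_congr fun q => and_congr_right fun hq => by rw [h1 q hq]
    have hlast := hloc.lastPair_spec W.n_pos hex
    refine ⟨rfl, hB', fun a ha ha' => (Function.update_of_ne ha' _ _).trans (hkeep a ha), _, _,
      div_le_half W.n_pos hlast.1, hlast.2.1, hlast.2.2, fun i hi => ?_⟩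
    rw [Function.update_self]
    refine (if_pos (show i < (W.base hη D₁).size by rwa [hsize])).trans ?_
    change mark (W.base hη D₁).size η (D₁ 4) i = _
    rw [hsize]
    exact hloc.mark_eq W.n_pos hlast.1 i

/-! ### Decoding -/

/-- `x` and `e` have the same parity checks. -/
def SameChecks (n : ℕ) (g h x e : ℕ → F4) : Prop :=
  ∀ k < n, ∑ i ∈ Finset.range n, x i * check n g h k i ^ 2 =
    ∑ i ∈ Finset.range n, e i * check n g h k i ^ 2

/-- The properties of the code that allow to find `e` from its parity checks. -/
structure Decodes (n : ℕ) (g h e : ℕ → F4) : Prop where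
  exists_pair : ∀ r, r n = 0 → SameChecks n g h r e →
    ∃ l < n, ∃ t ≤ n / 2, IsGoodPair n h r l t
  position : ∀ r, r n = 0 → SameChecks n g h r e → ∀ l t, t ≤ n / 2 → IsGoodPair n h r l t →
    (∀ l' < n, ∀ t' ≤ n / 2, IsGoodPair n h r l' t' → t' ≤ t) → ∀ i < n,
    ((∃ Λ, IsLocator n h r l t Λ ∧ ∑ k ∈ Finset.range n, xi n ^ (i * k) * Λ k ≠ 0) ↔ e i = 0)
  unique : ∀ x, x n = 0 → SameChecks n g h x e → (∀ i < n, e i = 0 → x i = 0) →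
    ∀ i < n, x i = e i

/-- The BCH root gives a good pair with the true t, so the chosen t' is at least t; a nonzero
locator for t' gives a primitive root with 2t' consecutive roots of h, so t' is at most t. The
locator criterion then applies to whichever root the chosen pair belongs to, not only to the
original β. -/
theorem IsGeneratingPair.decodes {m : ℕ} {g : (ZMod 2)[X]} {h : F4[X]} (hm : 1 ≤ m)
    (hp : IsGeneratingPair m g h) {t : ℕ} (hd : IsBCHDistance (4 ^ m + 1) h (2 * t + 1))
    {e : ℕ → F4} (he : e (4 ^ m + 1) = 0)
    {S : Finset ℕ} (hS1 : ∀ i ∈ S, i < 4 ^ m + 1 ∧ e i ≠ 0)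
    (hS2 : ∀ i ≤ 4 ^ m + 1, i ∉ S → e i = 0) (hcard : S.card ≤ t) :
    Decodes (4 ^ m + 1) (liftPoly g).coeff h.coeff e := by
  have hodd : Odd (4 ^ m + 1) := by
    refine Even.add_one ?_
    exact (by decide : Even 4).pow_of_ne_zero (by omega)
  have hcong := fun {r : ℕ → F4} (hr : r (4 ^ m + 1) = 0)
      (hre : SameChecks (4 ^ m + 1) (liftPoly g).coeff h.coeff r e) {l t : ℕ}
      (ht : 2 * t ≤ 4 ^ m + 1) {v} (hv : IsKilled (4 ^ m + 1) h.coeff l t v) {j : ℕ}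
      (hj : j < 2 * t) => hp.evalXi_mul_eq hm hr he hre ht hv hj
  have hdeg := hp.natDegree_le
  have hpos : 0 < 4 ^ m + 1 := Nat.succ_pos _
  generalize 4 ^ m + 1 = n at *
  obtain ⟨⟨ht1, β, hβ, l₀, hl₀⟩, hmax⟩ := hd
  have htn : 2 * t ≤ n := by omega
  -- The exponent l₀ may be reduced modulo n, which brings it into the range of the search.
  obtain ⟨v₀, hv₀0, hv₀⟩ : ∃ v : Cyc n, v ≠ 0 ∧ IsKilled n h.coeff (l₀ % n) t v := by
    refine exists_isKilled_of_primitiveRoot hpos hdeg hβ fun i hi => ?_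
    have := hl₀ i (by omega)
    rwa [← Nat.mod_add_div l₀ n, add_right_comm, pow_add, pow_mul, hβ.pow_eq_one, one_pow,
      mul_one] at this
  have hgood : ∀ r, r n = 0 → SameChecks n (liftPoly g).coeff h.coeff r e →
      IsGoodPair n h.coeff r (l₀ % n) t := by
    intro r hr hre
    -- As t < n, some position is free of errors; a locator that does not vanish there is nonzero.
    obtain ⟨i, hi, hiS⟩ : ∃ i ∈ Finset.range n, i ∉ S :=
      Finset.exists_mem_notMem_of_card_lt_card (by rw [Finset.card_range]; omega)
    obtain ⟨Λ, hΛ, hne⟩ := (exists_locator_iff hodd hv₀ hv₀0 hS1 hS2 hcard htn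
      (fun j hj v hv => hcong hr hre htn hv hj) (Finset.mem_range.1 hi)).2 hiS
    refine ⟨Λ, hΛ, ?_⟩
    by_contra hcon
    push Not at hcon
    exact hne (Finset.sum_eq_zero fun k hk => by rw [hcon k (Finset.mem_range.1 hk), mul_zero])
  refine ⟨fun r hr hre => ⟨l₀ % n, Nat.mod_lt _ hpos, t, by omega, hgood r hr hre⟩, ?_, ?_⟩
  · intro r hr hre l t' ht' ⟨Λ, hΛ, k, hk, hne⟩ hmax' i hi
    have h1 := hΛ.isKilled hk
    obtain ⟨β', hβ', hroot⟩ := exists_primitiveRoot_of_isKilled hodd hdeg (by omega) h1 hne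
    -- Maximality of the BCH distance.
    have h2 : 2 * t' + 1 ≤ 2 * t + 1 :=
      hmax ⟨by omega, β', hβ', l, fun i hi => hroot i (by omega)⟩
    have h3 := hmax' _ (Nat.mod_lt l₀ hpos) t (by omega) (hgood r hr hre)
    -- The first inequality bounds t' from above, the maximality of the chosen pair from below.
    obtain rfl : t' = t := by omega
    rw [exists_locator_iff hodd h1 hne hS1 hS2 hcard htn
      (fun j hj v hv => hcong hr hre htn hv hj) hi]
    exact ⟨hS2 i hi.le, fun h0 hiS => (hS1 i hiS).2 h0⟩
  · intro x hx hxe h0 i hi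
    -- The difference x - e is supported on the error positions and has 2t consecutive zero values,
    -- so the BCH bound applies.
    have hsub : ∀ j < 2 * t, evalXi n (fun i => x i - e i) (l₀ % n + j) * v₀ = 0 := by
      intro j hj
      have : ∀ w, evalXi n (fun i => x i - e i) w = evalXi n x w - evalXi n e w := by
        intro w
        simp only [evalXi, sub_smul, Finset.sum_sub_distrib]
      rw [this, sub_mul, hcong hx hxe htn hv₀ hj, sub_self]
    refine sub_eq_zero.1 (eq_zero_of_killed hodd hv₀ hv₀0 (fun i hi => (hS1 i hi).1)
      (fun i hi hiS => ?_) (by omega) hsub i hi.le)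
    rcases hi.lt_or_eq with hi' | rfl
    · rw [hS2 i hi hiS, h0 i hi' (hS2 i hi hiS), sub_zero]
    · rw [hx, he, sub_zero]

/-! ### The decoder -/

theorem check_congr {n : ℕ} {g g' h h' : ℕ → F4} (hg : ∀ i ≤ n, g i = g' i)
    (hh : ∀ i ≤ n, h i = h' i) (k i : ℕ) : check n g h k i = check n g' h' k i :=
  Finset.sum_congr rfl fun a ha => Finset.sum_congr rfl fun b hb => by
    rw [hg a (Nat.lt_succ_iff.1 (Finset.mem_range.1 ha)),
      hh b (Nat.lt_succ_iff.1 (Finset.mem_range.1 hb))]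

/-- The error `U_a V_b` as a sequence in `𝔽₄`. -/
noncomputable def errorCoeff {n : ℕ} (η : F4) (a b : Fin n → ZMod 2) (i : ℕ) : F4 :=
  if hi : i < n then algebraMap (ZMod 2) F4 (a ⟨i, hi⟩) + η * algebraMap (ZMod 2) F4 (b ⟨i, hi⟩)
  else 0

/-- The syndrome bits of the error `U_a V_b`. -/
noncomputable def syndrome {n : ℕ} (η : F4) (g h : ℕ → F4) (a b : Fin n → ZMod 2) (k : ℕ) : ZMod 2 :=
  (fun i : Fin n => hi (generator n η g h k i)) ⬝ᵥ a +
    b ⬝ᵥ fun i : Fin n => lo η (generator n η g h k i)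

/-- Generators k and n + k belong to f and η f. Their symplectic products with the error are the two
coordinates of the 𝔽₄-bilinear form of e and the conjugate of f; the bit of η f is the low one. -/
theorem syndrome_eq {n : ℕ} {η : F4} (hη : η ^ 2 + η + 1 = 0) (g h : ℕ → F4)
    (a b : Fin n → ZMod 2) {k : ℕ} (hk : k < n) :
    ((syndrome η g h a b (n + k)).val : F4) + η * ((syndrome η g h a b k).val : F4) =
      ∑ i ∈ Finset.range n, errorCoeff η a b i * check n g h k i ^ 2 := by
  have h1 : ∀ i, generator n η g h k i = check n g h k i := fun i => by
    rw [generator, if_pos hk, one_mul, Nat.mod_eq_of_lt hk]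
  have h2 : ∀ i, generator n η g h (n + k) i = η * check n g h k i := fun i => by
    rw [generator, if_neg (by omega), Nat.add_mod_left, Nat.mod_eq_of_lt hk]
  rw [← algebraMap_eq_cast_val, ← algebraMap_eq_cast_val, syndrome, syndrome]
  simp only [h1, h2, dotProduct, ← Finset.sum_add_distrib, map_sum]
  rw [Finset.mul_sum, ← Finset.sum_add_distrib, Finset.sum_range]
  refine Finset.sum_congr rfl fun i _ => ?_
  rw [errorCoeff, dif_pos i.2, mul_sq_eq hη]

/-- The contents of the arrays after the measurement of the syndrome. -/
structure IsMeasured (n : ℕ) (η : F4) (g h : ℕ → F4) (a b : Fin n → ZMod 2)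
    (D : Fin 8 → ℕ → ℕ) : Prop where
  generators : ∀ k < 2 * n, ∀ i < n, D 0 (k * n + i) = enc η (generator n η g h k i)
  syndrome : ∀ k < 2 * n, D 1 k = (syndrome η g h a b k).val

theorem IsMeasured.isSolution_iff {n : ℕ} {η : F4} (hη : η ^ 2 + η + 1 = 0) {g h : ℕ → F4}
    {a b : Fin n → ZMod 2} {D : Fin 8 → ℕ → ℕ} (hD : IsMeasured n η g h a b D) {x : ℕ → F4} :
    IsSolution n η D x ↔
      SameChecks n g h x (errorCoeff η a b) ∧ ∀ j < n, (D 5 j : F4) * x j = 0 := by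
  have h1 : ∀ k < n, ∀ i < n, dec η (D 0 (k * n + i)) = check n g h k i := by
    intro k hk i hi
    rw [hD.generators k (by omega) i hi, dec_enc hη, generator, if_pos hk, one_mul,
      Nat.mod_eq_of_lt hk]
  have h2 : ∀ k < n, (D 1 (n + k) : F4) + η * (D 1 k : F4) =
      ∑ i ∈ Finset.range n, errorCoeff η a b i * check n g h k i ^ 2 := by
    intro k hk
    rw [hD.syndrome _ (by omega), hD.syndrome _ (by omega), syndrome_eq hη g h a b hk]
  have h3 : ∀ k < n, ∑ j ∈ Finset.range n, x j * dec η (D 0 (k * n + j)) ^ 2 =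
      ∑ j ∈ Finset.range n, x j * check n g h k j ^ 2 := fun k hk =>
    Finset.sum_congr rfl fun j hj => by rw [h1 k hk j (Finset.mem_range.1 hj)]
  constructor
  · intro H
    exact ⟨fun k hk => by rw [← h3 k hk, H.check k hk, h2 k hk], H.mark⟩
  · rintro ⟨H, H'⟩
    exact ⟨fun k hk => by rw [h3 k hk, H k hk, h2 k hk], H'⟩

theorem IsMeasured.congr {n : ℕ} {η : F4} {g h : ℕ → F4} {a b : Fin n → ZMod 2}
    {D D' : Fin 8 → ℕ → ℕ} (hD : IsMeasured n η g h a b D) (h0 : D' 0 = D 0) (h1 : D' 1 = D 1) :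
    IsMeasured n η g h a b D' :=
  ⟨by rw [h0]; exact hD.generators, by rw [h1]; exact hD.syndrome⟩

/-- The program of the decoder. -/
theorem exists_decoder :
    ∃ (s : ℕ) (c : ℕ[X]) (P : ℕ → Program), ∀ W : Machine, s ≤ W.S →
      ∀ {η : F4} (_ : η ^ 2 + η + 1 = 0) (g h : ℕ → F4) (ph : ℕ → ℕ) (B : ℕ) (a b : Fin W.n → ZMod 2)
        (φ : Qubits W.n), IsInput W.n η g h ph W.inp → (∀ i, W.inp i ≤ B) → 3 ≤ B →
      (∀ k < 2 * W.n, Complex.I ^ ph k • weyl (fun i : Fin W.n => lo η (generator W.n η g h k i))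
          (fun i => hi (generator W.n η g h k i)) (weyl a b φ) =
        sign (syndrome η g h a b k) • weyl a b φ) →
      Decodes W.n g h (errorCoeff η a b) →
      W.RunsD (P W.S) (c.eval B) (fun _ _ => 0) (tensor (weyl a b φ) (ket 0))
        fun _ ψ' => ∃ χ, ψ' = tensor φ χ := by
  classical
  -- Array 0 holds the generators, 1 the syndrome, 3 a first solution r, 5 the marks and 7 the
  -- error; arrays 2, 4 and 6 hold the eliminations.
  obtain ⟨s₁, c₁, P₁, hgen⟩ := exists_generators
  obtain ⟨s₂, c₂, P₂, hmeas⟩ := exists_measure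
  obtain ⟨s₃, c₃, P₃, hsolve⟩ := exists_solve 2 3 (by decide) (by decide) (by decide) (by decide)
  obtain ⟨s₄, c₄, P₄, hmarks⟩ := exists_marks
  obtain ⟨s₅, c₅, P₅, hsolve'⟩ := exists_solve 6 7 (by decide) (by decide) (by decide) (by decide)
  obtain ⟨s₆, c₆, P₆, hcorr⟩ := exists_correction
  refine ⟨s₁ + s₂ + s₃ + s₄ + s₅ + s₆, c₁ + (c₂ + (c₃ + (c₄ + (c₅ + c₆ + 1) + 1) + 1) + 1) + 1,
    fun S => .seq (P₁ S) (.seq (P₂ S) (.seq (P₃ S) (.seq (P₄ S) (.seq (P₅ S) (P₆ S))))), ?_⟩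
  intro W hS η hη g h ph B a b φ hin hB hB3 hph hdec
  simp only [eval_add, eval_one]
  have hl : ∀ D, ∀ i ≤ W.n, (W.base hη D).left i = g i := fun D i hi => hin.left i hi
  have hr : ∀ D, ∀ i ≤ W.n, (W.base hη D).right i = h i := fun D i hi => by
    have := hin.right i hi
    rw [← W.inp_zero] at this
    exact this
  have hen : errorCoeff η a b W.n = 0 := by simp [errorCoeff]
  refine (hgen W (by omega) hη _ _ B ⟨hB, fun _ _ => Nat.zero_le _⟩ hB3).seq fun D₁ ψ₁ h₁ => ?_
  obtain ⟨rfl, hB₁, hk₁, hD₁⟩ := h₁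
  have hgenr : ∀ k < 2 * W.n, ∀ i < W.n, D₁ 0 (k * W.n + i) = enc η (generator W.n η g h k i) := by
    intro k hk i hi
    rw [hD₁ k hk i hi, generator, generator, check_congr (hl _) (hr _)]
  refine (hmeas W (by omega) hη D₁ B (weyl a b φ)
    (fun k i => lo η (generator W.n η g h k i)) (fun k i => hi (generator W.n η g h k i))
    (syndrome η g h a b) hB₁ (by omega) (fun k hk i => ?_) fun k hk => ?_).seq fun D₂ ψ₂ h₂ => ?_
  · rw [hgenr k hk i i.2, enc_mod_two, enc_div_two]
    exact ⟨rfl, rfl⟩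
  · rw [hin.phase k hk]
    exact hph k hk
  obtain ⟨⟨w, rfl⟩, hB₂, rfl⟩ := h₂
  set D₂ := Function.update D₁ 1 fun k =>
    if k < 2 * W.n then (syndrome η g h a b k).val else D₁ 1 k with hD₂
  have hk₂ : ∀ x : Fin 8, x ≠ 0 → x ≠ 1 → D₂ x = fun _ => 0 := fun x h0 h1 => by
    rw [hD₂, Function.update_of_ne h1, hk₁ x h0]
  have hm₂ : IsMeasured W.n η g h a b D₂ := by
    refine ⟨fun k hk i hi => ?_, fun k hk => ?_⟩
    · rw [hD₂, Function.update_of_ne (by decide), hgenr k hk i hi]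
    · rw [hD₂, Function.update_self, if_pos hk]
  -- Array 5 is still zero, so the first solution is not restricted to any positions.
  refine (hsolve W (by omega) hη D₂ _ B hB₂ hB3 ⟨errorCoeff η a b, (hm₂.isSolution_iff hη).2
    ⟨fun _ _ => rfl, fun j _ => by simp [hk₂ 5 (by decide) (by decide)]⟩⟩).seq fun D₃ ψ₃ h₃ => ?_
  obtain ⟨rfl, hB₃, hk₃, r, hr₃, hrn, hD₃⟩ := h₃
  have hre := ((hm₂.isSolution_iff hη).1 hr₃).1
  refine (hmarks W (by omega) hη D₃ _ B h r hB₃ hB3 (hr D₃) hD₃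
    (hdec.exists_pair r hrn hre)).seq fun D₄ ψ₄ h₄ => ?_
  obtain ⟨rfl, hB₄, hk₄, l, t, ht, hgood, hmax, hD₄⟩ := h₄
  have hm₄ : IsMeasured W.n η g h a b D₄ := hm₂.congr
    (by rw [hk₄ 0 (by decide) (by decide), hk₃ 0 (by decide) (by decide)])
    (by rw [hk₄ 1 (by decide) (by decide), hk₃ 1 (by decide) (by decide)])
  have hmark : ∀ i < W.n, D₄ 5 i = if errorCoeff η a b i = 0 then 1 else 0 := by
    intro i hi
    rw [hD₄ i hi]
    exact if_congr (hdec.position r hrn hre l t ht hgood hmax i hi) rfl rfl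
  -- The marked positions are the error-free ones, so e itself solves the restricted system; it is
  -- the only solution.
  refine (hsolve' W (by omega) hη D₄ _ B hB₄ hB3 ⟨errorCoeff η a b, (hm₄.isSolution_iff hη).2
    ⟨fun _ _ => rfl, fun j hj => by rw [hmark j hj]; split_ifs with h0 <;> simp [h0]⟩⟩).seq
    fun D₅ ψ₅ h₅ => ?_
  obtain ⟨rfl, hB₅, -, x, hx, hxn, hD₅⟩ := h₅
  obtain ⟨hxe, hxm⟩ := (hm₄.isSolution_iff hη).1 hx
  have hxe' := hdec.unique x hxn hxe fun i hi h0 => by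
    have := hxm i hi
    rwa [hmark i hi, if_pos h0, Nat.cast_one, one_mul] at this
  refine (hcorr W (by omega) hη D₅ B (weyl a b φ) (ket w) a b hB₅ fun i => ?_).mono le_rfl ?_
  · rw [hD₅ i i.2.le, hxe' i i.2, enc_mod_two, enc_div_two, errorCoeff, dif_pos i.2,
      (lo_hi_of_eq hη _ _).1, (lo_hi_of_eq hη _ _).2]
    exact ⟨rfl, rfl⟩
  · rintro - _ rfl
    have h2 : ∀ a : Fin W.n → ZMod 2, a + a = 0 := fun a => funext fun i =>
      CharTwo.add_self_eq_zero (a i)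
    -- The square of U_a V_b is this sign, which is moved from the data to the work qubits.
    refine ⟨sign (b ⬝ᵥ a) • ket w, ?_⟩
    rw [weyl_weyl, h2, h2, weyl_zero, smul_tensor, tensor_smul]

/-! ### The initial configuration -/

theorem errorCoeff_eq_zero {n : ℕ} {η : F4} (hη : η ^ 2 + η + 1 = 0) (a b : Fin n → ZMod 2)
    (i : Fin n) : errorCoeff η a b i = 0 ↔ a i = 0 ∧ b i = 0 := by
  rw [errorCoeff, dif_pos i.2]
  constructor
  · intro h
    have h1 := lo_hi_of_eq hη (a i) (b i)
    have h2 := lo_hi_of_eq hη 0 0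
    rw [h] at h1
    simp only [map_zero, mul_zero, add_zero] at h2
    exact ⟨h1.1.symm.trans h2.1, h1.2.symm.trans h2.2⟩
  · rintro ⟨h1, h2⟩
    simp [h1, h2]

/-- The positions of the error `U_a V_b`. -/
def errorPositions {n : ℕ} (a b : Fin n → ZMod 2) : Finset ℕ :=
  (Finset.univ.filter fun i => a i ≠ 0 ∨ b i ≠ 0).map Fin.valEmbedding

theorem card_errorPositions {n : ℕ} (a b : Fin n → ZMod 2) :
    (errorPositions a b).card = jointWeight a b := Finset.card_map _

theorem mem_errorPositions {n : ℕ} {η : F4} (hη : η ^ 2 + η + 1 = 0) (a b : Fin n → ZMod 2)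
    {i : ℕ} : i ∈ errorPositions a b ↔ i < n ∧ errorCoeff η a b i ≠ 0 := by
  simp only [errorPositions, Finset.mem_map, Finset.mem_filter, Finset.mem_univ, true_and,
    Fin.valEmbedding_apply]
  constructor
  · rintro ⟨i, hi, rfl⟩
    refine ⟨i.2, fun h => ?_⟩
    rw [errorCoeff_eq_zero hη] at h
    tauto
  · rintro ⟨hi, h⟩
    refine ⟨⟨i, hi⟩, ?_, rfl⟩
    have := (errorCoeff_eq_zero hη a b ⟨i, hi⟩).not.1 h
    tauto

theorem IsInput.le {n : ℕ} {η : F4} {g h : ℕ → F4} {ph inp : ℕ → ℕ}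
    (hI : IsInput n η g h ph inp) (hn : 3 ≤ n) (i : ℕ) : inp i ≤ n := by
  have := hI.bound i
  omega

/-- The parameters of the run of the decoder with `S` arrays on an input of length `n`. -/
def IsInput.machine {n : ℕ} {η : F4} {g h : ℕ → F4} {ph inp : ℕ → ℕ}
    (hI : IsInput n η g h ph inp) (hn : 3 ≤ n) (S : ℕ) : Machine where
  S := S
  n := n
  inp := inp
  n_pos := hI.pos
  inp_zero := hI.zero
  inp_eq_zero i hi := hI.eq_zero i (by omega)

/-- The description ends before cell 5n + 4, which is at most 8n here, so all arrays are zero at the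
start. -/
theorem IsInput.layout {n : ℕ} {η : F4} {g h : ℕ → F4} {ph inp : ℕ → ℕ}
    (hI : IsInput n η g h ph inp) (hn : 3 ≤ n) (S : ℕ) :
    (hI.machine hn S).Layout (fun _ _ => 0) inp :=
  ⟨fun _ _ => rfl, fun k _ i => hI.eq_zero _ (by
    change 5 * n + 4 ≤ 8 * n + S * i + k
    omega)⟩

end QuantumBCH

open Polynomial QuantumBCH in
theorem mainTheorem5 :
    ∃ (P : Program) (p : Polynomial ℕ),
      ∀ (m : ℕ), 1 ≤ m →
      ∀ (η : F4), η ^ 2 + η + 1 = 0 →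
      ∀ (g : (ZMod 2)[X]) (h : F4[X])
        (G : Subgroup (Qubits (4 ^ m + 1) ≃ₗ[ℂ] Qubits (4 ^ m + 1))),
      IsCodeGroup m η g h G →
      ∀ (t : ℕ), IsBCHDistance (4 ^ m + 1) h (2 * t + 1) →
      ∀ (φ : Qubits (4 ^ m + 1)), φ ∈ stabiliserCode G →
      ∀ (a b : Fin (4 ^ m + 1) → ZMod 2), jointWeight a b ≤ t →
        HaltsWithin (fun γ => ∃ χ : QState, γ.state = tensor φ χ) (p.eval (4 ^ m + 1))
          (initial P (description η g h G) (weyl a b φ)) := by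
  obtain ⟨s, c, P, hrun⟩ := exists_decoder
  refine ⟨P s, c, fun m hm η hη g h G hG t hd φ hφ a b hw => ?_⟩
  -- With n ≥ 3, the number n bounds the input and all codes of elements of 𝔽₄, so the cost
  -- polynomials can be evaluated at n.
  have hn : 3 ≤ 4 ^ m + 1 := by
    have := Nat.pow_le_pow_right (show 0 < 4 by norm_num) hm
    omega
  have hI := hG.isInput hη
  have hdec := hG.pair.decodes hm hd (e := errorCoeff η a b) (by simp [errorCoeff])
    (fun i hi => (mem_errorPositions hη a b).1 hi) (fun i hi hi' => ?_)
    ((card_errorPositions a b).trans_le hw)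
  · have h := hrun (hI.machine hn s) le_rfl hη _ _ _ (4 ^ m + 1) a b φ hI (hI.le hn) hn
      (fun k hk => by
        rw [hG.polyPhase_eq hk]
        exact phase_smul_weyl hG.gottesman (hG.generator_mem hη hk) hφ a b) hdec
    rw [initial, zeroState_eq]
    -- With an empty stack and no further steps as continuation, the cost of the decoder is the
    -- whole running time.
    exact (h (fun _ _ => 0) rfl rfl _ [] (fun γ => ∃ χ : QState, γ.state = tensor φ χ) 0
      (hI.layout hn s) fun _ _ _ _ h' => ⟨rfl, h'.2⟩).mono le_rfl
  · rcases hi.lt_or_eq with h | rfl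
    · by_contra h0
      exact hi' ((mem_errorPositions hη a b).2 ⟨h, h0⟩)
    · simp [errorCoeff]
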